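/- **Conventions.** Let $b(z,w)=-\bar z_1w_1-\bar z_2w_2+\bar z_3w_3$ on $\mathbb C^3$, and $H^5_2(-1)=\{z\in\mathbb C^3: b(z,z)=-1\}$. Let $\pi:H^5_2(-1)\to CH^2_1(-4)$, $z\mapsto z\cdot\mathbb C^*$, be the Hopf fibration. $CH^2_1(-4)$ carries its complex structure $J$ and the pseudo-Riemannian metric $\langle\,,\rangle$ of complex index one for which $\pi$ is a Riemannian submersion, $H^5_2(-1)$ carrying the metric induced by $\operatorname{Re} b$. A surface $L:M\to CH^2_1(-4)$ is *minimal* if its mean curvature vector vanishes, and *flat* if the curvature tensor of the induced metric vanishes. It is *slant* if there is a constant $\alpha\in\mathbb R$ such that at each point the tangent plane has a frame with $\langle e_1,e_1\rangle=\langle e_2,e_2\rangle=0$, $\langle e_1,e_2\rangle=-1$ (so the induced metric is Lorentzian), $Pe_1=(\sinh\alpha)e_1$ and $Pe_2=-(\sinh\alpha)e_2$, where $PX$ is the tangential component of $JX$. It is *Lagrangian* if $J$ maps tangent vectors to normal vectors. **Theorem 7.1.** Let $M$ be a connected smooth surface and let $L:M\to CH^2_1(-4)$ be a smooth map that makes $M$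 a minimal flat slant surface in the Lorentzian complex hyperbolic plane $CH^2_1(-4)$. Then $L$ is Lagrangian. Moreover, $L$ is congruent to $\pi\circ\tilde L$, where $$\tilde L(x,y)=\frac1{\sqrt3}\Big(\sqrt2\,e^{-\frac{i}{2a}(x+a^2y)}\cosh\big(\tfrac{\sqrt3}{2a}(x-a^2y)\big),\ e^{i(ay+\frac xa)},\ \sqrt2\,e^{-\frac{i}{2a}(x+a^2y)}\sinh\big(\tfrac{\sqrt3}{2a}(x-a^2y)\big)\Big)\in H^5_2(-1)$$ and $a$ is a nonzero real number. That is, there are a real number $a\ne0$ and a $b$-unitary linear map $A$ of $\mathbb C^3$, which induces a holomorphic isometry $\phi_A$ of $CH^2_1(-4)$, such that every point of $M$ has an open neighbourhood with smooth local coordinates $(x,y)$ in which $\phi_A\circ L=\pi\circ\tilde L(x,y)$. -/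

import Mathlib

open scoped ContDiff Manifold ComplexConjugate

noncomputable section

/-! ### The space `H⁵₂(-1)` and the Lorentzian complex hyperbolic plane `CH²₁(-4)` -/

/-- The Hermitian form `b_{2,3}(z,w) = -z̄₁w₁ - z̄₂w₂ + z̄₃w₃` on `ℂ³`. -/
def hermForm (z w : Fin 3 → ℂ) : ℂ :=
  -(conj (z 0) * w 0) - conj (z 1) * w 1 + conj (z 2) * w 2

/-- `H⁵₂(-1) = {z ∈ ℂ³ : b_{2,3}(z,z) = -1}`. -/
def H52 : Set (Fin 3 → ℂ) := {z | hermForm z z = -1}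

theorem hermForm_smul_smul (c d : ℂ) (z w : Fin 3 → ℂ) :
    hermForm (c • z) (d • w) = conj c * d * hermForm z w := by
  simp only [hermForm, Pi.smul_apply, smul_eq_mul, map_mul]; ring

theorem hermForm_self_im (z : Fin 3 → ℂ) : (hermForm z z).im = 0 := by
  simp [hermForm]; ring

theorem hermForm_self_eq (z : Fin 3 → ℂ) : hermForm z z = ((hermForm z z).re : ℂ) :=
  Complex.ext (by simp) (by simp [hermForm_self_im])

/-- Two points of `H⁵₂(-1)` are identified when they span the same complex line. -/
instance CH21.setoid : Setoid H52 where
  r z w := ∃ c : ℂ, c ≠ 0 ∧ (w : Fin 3 → ℂ) = c • (z : Fin 3 → ℂ)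
  iseqv :=
    { refl := fun z => ⟨1, one_ne_zero, by simp⟩
      symm := by
        rintro z w ⟨c, hc, h⟩
        exact ⟨c⁻¹, inv_ne_zero hc, by rw [h, smul_smul, inv_mul_cancel₀ hc, one_smul]⟩
      trans := by
        rintro x y z ⟨c, hc, h⟩ ⟨d, hd, h'⟩
        exact ⟨d * c, mul_ne_zero hd hc, by rw [h', h, smul_smul]⟩ }

/-- The Lorentzian complex hyperbolic plane `CH²₁(-4)` as a set of points, with the quotient
topology of `H⁵₂(-1)`. -/
def CH21 : Type := Quotient CH21.setoid

instance CH21.topologicalSpace : TopologicalSpace CH21 :=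
  inferInstanceAs (TopologicalSpace (Quotient CH21.setoid))

/-- The Hopf fibration `π : H⁵₂(-1) → CH²₁(-4)`, `z ↦ z·ℂ*`. -/
def hopf (z : H52) : CH21 := Quotient.mk CH21.setoid z

/-! #### The affine (inhomogeneous) coordinates, which make `CH²₁(-4)` a manifold -/

/-- Inhomogeneous coordinates `(z_j / z_i)_{j ≠ i}`. -/
def affineCoord (i : Fin 3) (z : Fin 3 → ℂ) : Fin 2 → ℂ := fun j => z (i.succAbove j) / z i

/-- The vector of `ℂ³` whose `i`-th entry is `1` and whose other entries are `w`. -/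
def affineVec (i : Fin 3) (w : Fin 2 → ℂ) : Fin 3 → ℂ := i.insertNth (α := fun _ => ℂ) 1 w

/-- The derivative of `affineVec i`: insert `0` in the `i`-th place. -/
def affineTan (i : Fin 3) (u : Fin 2 → ℂ) : Fin 3 → ℂ := i.insertNth (α := fun _ => ℂ) 0 u

theorem affineCoord_smul (i : Fin 3) {c : ℂ} (hc : c ≠ 0) (z : Fin 3 → ℂ) :
    affineCoord i (c • z) = affineCoord i z := by
  funext j
  simp [affineCoord, mul_div_mul_left _ _ hc]

theorem affineVec_affineCoord (i : Fin 3) {z : Fin 3 → ℂ} (hz : z i ≠ 0) :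
    affineVec i (affineCoord i z) = (z i)⁻¹ • z := by
  funext k
  refine Fin.succAboveCases i ?_ (fun j => ?_) k
  · simp [affineVec, hz]
  · simp [affineVec, affineCoord, div_eq_inv_mul]

theorem affineCoord_affineVec (i : Fin 3) (w : Fin 2 → ℂ) :
    affineCoord i (affineVec i w) = w := by
  funext j
  simp [affineCoord, affineVec]

theorem contDiff_affineVec (i : Fin 3) : ContDiff ℝ ∞ (affineVec i) := by
  rw [contDiff_pi]
  intro k
  refine Fin.succAboveCases i ?_ (fun j => ?_) k
  · simpa [affineVec] using contDiff_const
  · simpa [affineVec] using contDiff_apply ℝ ℂ j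

theorem contDiffOn_affineCoord (i : Fin 3) : ContDiffOn ℝ ∞ (affineCoord i) {z | z i ≠ 0} := by
  rw [contDiffOn_pi]
  intro j
  have h1 : ContDiffOn ℝ ∞ (fun z : Fin 3 → ℂ => z (i.succAbove j)) {z | z i ≠ 0} :=
    (contDiff_apply ℝ ℂ (i.succAbove j)).contDiffOn
  have h2 : ContDiffOn ℝ ∞ (fun z : Fin 3 → ℂ => z i) {z | z i ≠ 0} :=
    (contDiff_apply ℝ ℂ i).contDiffOn
  have h3 : ContDiffOn ℝ ∞ (fun z : Fin 3 → ℂ => z (i.succAbove j) * (z i)⁻¹) {z | z i ≠ 0} :=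
    h1.mul (h2.inv fun z hz => hz)
  exact h3

theorem continuous_hermForm_self : Continuous fun z : Fin 3 → ℂ => (hermForm z z).re := by
  unfold hermForm; fun_prop

/-- The positive multiple of a negative vector that lies on `H⁵₂(-1)`. -/
def normalizeVec (z : Fin 3 → ℂ) : Fin 3 → ℂ := (((√(-(hermForm z z).re))⁻¹ : ℝ) : ℂ) • z

theorem normalizeVec_mem {z : Fin 3 → ℂ} (hz : (hermForm z z).re < 0) : normalizeVec z ∈ H52 := by
  have h : 0 < -(hermForm z z).re := by linarith
  have h2 : √(-(hermForm z z).re) * √(-(hermForm z z).re) = -(hermForm z z).re :=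
    Real.mul_self_sqrt h.le
  show hermForm _ _ = -1
  rw [normalizeVec, hermForm_smul_smul, Complex.conj_ofReal, hermForm_self_eq z,
    Complex.ofReal_re]
  rw [← Complex.ofReal_mul, ← Complex.ofReal_mul, ← mul_inv, h2, inv_neg, neg_mul,
    inv_mul_cancel₀ hz.ne]
  simp

/-- A base point of `CH²₁(-4)`; it only serves as a default value. -/
def CH21.base : CH21 := hopf ⟨![1, 0, 0], by simp [H52, hermForm]⟩

theorem CH21.exists_rep (q : CH21) : ∃ z : H52, hopf z = q := Quotient.exists_rep q

theorem isQuotientMap_hopf : Topology.IsQuotientMap hopf := isQuotientMap_quotient_mk'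

/-- `z_i ≠ 0` on the complex line `q`. -/
def CH21.NonzeroAt (i : Fin 3) (q : CH21) : Prop :=
  Quotient.lift (fun z : H52 => (z : Fin 3 → ℂ) i ≠ 0)
    (by rintro z w ⟨c, hc, h⟩; simp [h, hc]) q

/-- The affine coordinates of the complex line `q`. -/
def CH21.coord (i : Fin 3) (q : CH21) : Fin 2 → ℂ :=
  Quotient.lift (fun z : H52 => affineCoord i (z : Fin 3 → ℂ))
    (by rintro z w ⟨c, hc, h⟩; simp only [h, affineCoord_smul i hc]) q

open Classical in
/-- The point of `CH²₁(-4)` with given affine coordinates. -/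
def CH21.ofCoord (i : Fin 3) (w : Fin 2 → ℂ) : CH21 :=
  if h : (hermForm (affineVec i w) (affineVec i w)).re < 0 then
    hopf ⟨normalizeVec (affineVec i w), normalizeVec_mem h⟩ else CH21.base

theorem CH21.nonzeroAt_hopf (i : Fin 3) (z : H52) :
    CH21.NonzeroAt i (hopf z) ↔ (z : Fin 3 → ℂ) i ≠ 0 := Iff.rfl

theorem CH21.coord_hopf (i : Fin 3) (z : H52) :
    CH21.coord i (hopf z) = affineCoord i (z : Fin 3 → ℂ) := rfl

theorem CH21.ofCoord_eq {i : Fin 3} {w : Fin 2 → ℂ}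
    (h : (hermForm (affineVec i w) (affineVec i w)).re < 0) :
    CH21.ofCoord i w = hopf ⟨normalizeVec (affineVec i w), normalizeVec_mem h⟩ := dif_pos h

theorem normalizeVec_factor_ne {z : Fin 3 → ℂ} (hz : (hermForm z z).re < 0) :
    (((√(-(hermForm z z).re))⁻¹ : ℝ) : ℂ) ≠ 0 := by
  have h : 0 < -(hermForm z z).re := by linarith
  exact Complex.ofReal_ne_zero.2 (inv_ne_zero (Real.sqrt_pos.2 h).ne')

theorem hermForm_affineVec_coord_neg {i : Fin 3} {z : H52} (hz : (z : Fin 3 → ℂ) i ≠ 0) :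
    (hermForm (affineVec i (affineCoord i z)) (affineVec i (affineCoord i z))).re < 0 := by
  have hz1 : hermForm (z : Fin 3 → ℂ) z = -1 := z.2
  rw [affineVec_affineCoord i hz, hermForm_smul_smul, hz1, Complex.conj_mul']
  have : 0 < ‖((z : Fin 3 → ℂ) i)⁻¹‖ := norm_pos_iff.2 (inv_ne_zero hz)
  rw [mul_neg_one, Complex.neg_re, ← Complex.ofReal_pow, Complex.ofReal_re]
  linarith [pow_pos this 2]

theorem CH21.isOpen_nonzeroAt (i : Fin 3) : IsOpen {q | CH21.NonzeroAt i q} := by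
  refine isQuotientMap_hopf.isOpen_preimage.1 ?_
  exact isOpen_ne_fun ((continuous_apply i).comp continuous_subtype_val) continuous_const

/-- The `i`-th affine chart of `CH²₁(-4)`, `z·ℂ* ↦ (z_j / z_i)_{j ≠ i}`, on `{z_i ≠ 0}`. -/
def CH21.chart (i : Fin 3) : OpenPartialHomeomorph CH21 (Fin 2 → ℂ) where
  toFun := CH21.coord i
  invFun := CH21.ofCoord i
  source := {q | CH21.NonzeroAt i q}
  target := {w | (hermForm (affineVec i w) (affineVec i w)).re < 0}
  map_source' := by
    intro q hq
    obtain ⟨z, rfl⟩ := q.exists_rep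
    exact hermForm_affineVec_coord_neg hq
  map_target' := by
    intro w hw
    have hw' : (hermForm (affineVec i w) (affineVec i w)).re < 0 := hw
    rw [CH21.ofCoord_eq hw']
    show normalizeVec (affineVec i w) i ≠ 0
    have h1 : affineVec i w i = 1 := by simp [affineVec]
    simpa only [normalizeVec, Pi.smul_apply, smul_eq_mul, h1, mul_one] using
      normalizeVec_factor_ne hw'
  left_inv' := by
    intro q hq
    obtain ⟨z, rfl⟩ := q.exists_rep
    have hz : (z : Fin 3 → ℂ) i ≠ 0 := hq
    have hlt := hermForm_affineVec_coord_neg hz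
    rw [CH21.coord_hopf, CH21.ofCoord_eq hlt]
    refine Quotient.sound (Setoid.symm ?_)
    refine ⟨_, mul_ne_zero (normalizeVec_factor_ne hlt) (inv_ne_zero hz), ?_⟩
    rw [mul_smul, ← affineVec_affineCoord i hz]
    rfl
  right_inv' := by
    intro w hw
    have hw' : (hermForm (affineVec i w) (affineVec i w)).re < 0 := hw
    rw [CH21.ofCoord_eq hw', CH21.coord_hopf]
    show affineCoord i (normalizeVec (affineVec i w)) = w
    rw [normalizeVec, affineCoord_smul i (normalizeVec_factor_ne hw'), affineCoord_affineVec]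
  open_source := CH21.isOpen_nonzeroAt i
  open_target := isOpen_lt
    (continuous_hermForm_self.comp (contDiff_affineVec i).continuous) continuous_const
  continuousOn_toFun := by
    refine (isQuotientMap_hopf.continuousOn_isOpen_iff (CH21.isOpen_nonzeroAt i)).2 ?_
    exact (contDiffOn_affineCoord i).continuousOn.comp continuous_subtype_val.continuousOn
      (fun z hz => hz)
  continuousOn_invFun := by
    rw [continuousOn_iff_continuous_domRestrict]
    have h1 : Continuous fun w : {w : Fin 2 → ℂ |
        (hermForm (affineVec i w) (affineVec i w)).re < 0} => affineVec i (w : Fin 2 → ℂ) :=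
      (contDiff_affineVec i).continuous.comp continuous_subtype_val
    have hN : Continuous fun w : {w : Fin 2 → ℂ |
        (hermForm (affineVec i w) (affineVec i w)).re < 0} =>
          normalizeVec (affineVec i (w : Fin 2 → ℂ)) := by
      unfold normalizeVec
      refine Continuous.smul (Complex.continuous_ofReal.comp (Continuous.inv₀ ?_ ?_)) h1
      · exact (continuous_hermForm_self.comp h1).neg.sqrt
      · intro w
        have hw : (hermForm (affineVec i w.1) (affineVec i w.1)).re < 0 := w.2
        exact (Real.sqrt_pos.2 (by linarith)).ne'
    have h2 : Continuous fun w : {w : Fin 2 → ℂ |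
        (hermForm (affineVec i w) (affineVec i w)).re < 0} =>
          hopf ⟨normalizeVec (affineVec i (w : Fin 2 → ℂ)), normalizeVec_mem w.2⟩ :=
      isQuotientMap_hopf.continuous.comp (hN.subtype_mk _)
    refine h2.congr (fun w => ?_)
    exact (CH21.ofCoord_eq w.2).symm

theorem CH21.exists_mem_source (q : CH21) : ∃ i, q ∈ (CH21.chart i).source := by
  obtain ⟨z, rfl⟩ := q.exists_rep
  by_contra! hcon
  have h : ∀ i, (z : Fin 3 → ℂ) i = 0 := fun i => by_contra fun hne => hcon i hne
  have hz1 : hermForm (z : Fin 3 → ℂ) z = -1 := z.2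
  simp [hermForm, h] at hz1

instance CH21.chartedSpace : ChartedSpace (Fin 2 → ℂ) CH21 where
  atlas := Set.range CH21.chart
  chartAt q := CH21.chart (CH21.exists_mem_source q).choose
  mem_chart_source q := (CH21.exists_mem_source q).choose_spec
  chart_mem_atlas _ := Set.mem_range_self _

/-- `CH²₁(-4)` is a smooth manifold of real dimension four. -/
instance CH21.isManifold : IsManifold 𝓘(ℝ, Fin 2 → ℂ) ∞ CH21 := by
  refine isManifold_of_contDiffOn _ _ _ ?_
  rintro _ _ ⟨i, rfl⟩ ⟨j, rfl⟩
  simp only [modelWithCornersSelf_coe, modelWithCornersSelf_coe_symm, Function.comp_id,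
    Function.id_comp, Set.range_id, Set.inter_univ, Set.preimage_id]
  have key : ∀ w ∈ ((CH21.chart i).symm.trans (CH21.chart j)).source,
      affineVec i w j ≠ 0 ∧
      ((CH21.chart i).symm.trans (CH21.chart j)) w = affineCoord j (affineVec i w) := by
    intro w hw
    rw [OpenPartialHomeomorph.trans_source] at hw
    have hw1 : (hermForm (affineVec i w) (affineVec i w)).re < 0 := hw.1
    have hw2 : (CH21.chart i).symm w ∈ (CH21.chart j).source := hw.2
    have he : (CH21.chart i).symm w
        = hopf ⟨normalizeVec (affineVec i w), normalizeVec_mem hw1⟩ := dif_pos hw1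
    have h3 : (((√(-(hermForm (affineVec i w) (affineVec i w)).re))⁻¹ : ℝ) : ℂ) ≠ 0 := by
      have h : 0 < -(hermForm (affineVec i w) (affineVec i w)).re := by linarith
      exact_mod_cast inv_ne_zero (Real.sqrt_pos.2 h).ne'
    rw [he] at hw2
    have hw3 : normalizeVec (affineVec i w) j ≠ 0 := hw2
    refine ⟨fun h0 => hw3 (by simp [normalizeVec, h0]), ?_⟩
    rw [OpenPartialHomeomorph.coe_trans, Function.comp_apply, he]
    show affineCoord j (normalizeVec (affineVec i w)) = _
    rw [normalizeVec, affineCoord_smul j h3]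
  refine ContDiffOn.congr (f := fun w => affineCoord j (affineVec i w)) ?_
    (fun w hw => (key w hw).2)
  exact (contDiffOn_affineCoord j).comp (contDiff_affineVec i).contDiffOn
    (fun w hw => (key w hw).1)

/-- The component of `ξ ∈ ℂ³` that is `b_{2,3}`-orthogonal to `z`, that is, the horizontal part
of `ξ` with respect to the Hopf fibration. -/
def horizontal (z ξ : Fin 3 → ℂ) : Fin 3 → ℂ := ξ - (hermForm z ξ / hermForm z z) • z

/-- The metric of `CH²₁(-4)` in the `i`-th affine chart, at the point `w` and on the tangent
vectors `u, v`. With `Z = affineVec i w` and `z = Z / √(-b(Z,Z)) ∈ H⁵₂(-1)`, the horizontal lift of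
`u` to `z` is `horizontal Z (affineTan i u) / √(-b(Z,Z))`, and the metric is the real part of
`b_{2,3}` on horizontal lifts. -/
def chMetric (i : Fin 3) (w u v : Fin 2 → ℂ) : ℝ :=
  (hermForm (horizontal (affineVec i w) (affineTan i u))
    (horizontal (affineVec i w) (affineTan i v))).re /
    (-(hermForm (affineVec i w) (affineVec i w)).re)

/-- `π` is a Riemannian submersion for `chMetric`: on vectors `ξ, η` that are horizontal at
`z ∈ H⁵₂(-1)` its differential, in affine coordinates, takes the real part of `b_{2,3}` to
`chMetric`. -/
theorem chMetric_submersion (i : Fin 3) (z : H52) (hz : (z : Fin 3 → ℂ) i ≠ 0)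
    (ξ η : Fin 3 → ℂ) (hξ : hermForm z ξ = 0) (hη : hermForm z η = 0) :
    chMetric i (affineCoord i z) (fderiv ℝ (affineCoord i) z ξ) (fderiv ℝ (affineCoord i) z η) =
      (hermForm ξ η).re := by
  have hz1 : hermForm (z : Fin 3 → ℂ) z = -1 := z.2
  generalize (z : Fin 3 → ℂ) = z at *
  have hd : ∀ ζ : Fin 3 → ℂ, affineTan i (fderiv ℝ (affineCoord i) z ζ) =
      (z i)⁻¹ • ζ - (ζ i / z i) • affineVec i (affineCoord i z) := by
    intro ζ
    have hp : ∀ k : Fin 3, HasFDerivAt (fun y : Fin 3 → ℂ => y k)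
        (ContinuousLinearMap.proj (R := ℝ) (φ := fun _ : Fin 3 => ℂ) k) z :=
      fun k => (ContinuousLinearMap.proj (R := ℝ) (φ := fun _ : Fin 3 => ℂ) k).hasFDerivAt
    have hf : HasFDerivAt (affineCoord i) (ContinuousLinearMap.pi fun j : Fin 2 =>
        z (i.succAbove j) • (-(z i ^ 2)⁻¹ •
            ContinuousLinearMap.proj (R := ℝ) (φ := fun _ : Fin 3 => ℂ) i) +
          (z i)⁻¹ • ContinuousLinearMap.proj (R := ℝ) (φ := fun _ : Fin 3 => ℂ)
            (i.succAbove j)) z := by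
      rw [hasFDerivAt_pi]
      intro j
      have hinv : HasFDerivAt (fun y : Fin 3 → ℂ => (y i)⁻¹)
          (-(z i ^ 2)⁻¹ • ContinuousLinearMap.proj (R := ℝ) (φ := fun _ : Fin 3 => ℂ) i) z :=
        ((hasDerivAt_inv hz).comp_hasFDerivAt_of_eq z (hp i) rfl)
      simp only [affineCoord, div_eq_mul_inv]
      exact (hp (i.succAbove j)).mul hinv
    rw [hf.fderiv]
    funext k
    refine Fin.succAboveCases i ?_ (fun j => ?_) k
    · simp [affineTan, affineVec, div_eq_inv_mul]
    · simp [affineTan, affineVec, affineCoord]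
      field_simp
      ring
  have hh : ∀ ζ : Fin 3 → ℂ, hermForm z ζ = 0 →
      horizontal (affineVec i (affineCoord i z))
        (affineTan i (fderiv ℝ (affineCoord i) z ζ)) = (z i)⁻¹ • ζ := by
    intro ζ hζ
    rw [hd, affineVec_affineCoord i hz]
    have e1 : hermForm ((z i)⁻¹ • z) ((z i)⁻¹ • ζ - (ζ i / z i) • (z i)⁻¹ • z) =
        -(ζ i / z i) * hermForm ((z i)⁻¹ • z) ((z i)⁻¹ • z) := by
      have : hermForm ((z i)⁻¹ • z) ((z i)⁻¹ • ζ - (ζ i / z i) • (z i)⁻¹ • z) =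
          hermForm ((z i)⁻¹ • z) ((z i)⁻¹ • ζ)
            - (ζ i / z i) * hermForm ((z i)⁻¹ • z) ((z i)⁻¹ • z) := by
        simp only [hermForm, Pi.sub_apply, Pi.smul_apply, smul_eq_mul]; ring
      rw [this, hermForm_smul_smul (z i)⁻¹ (z i)⁻¹ z ζ, hζ]; ring
    have e2 : hermForm ((z i)⁻¹ • z) ((z i)⁻¹ • z) ≠ 0 := by
      rw [hermForm_smul_smul, hz1]; simp [hz]
    rw [horizontal, e1, mul_div_assoc, div_self e2]
    simp
  rw [chMetric, hh ξ hξ, hh η hη, affineVec_affineCoord i hz, hermForm_smul_smul,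
    hermForm_smul_smul, hz1, Complex.conj_mul', ← Complex.ofReal_pow, Complex.re_ofReal_mul,
    mul_neg_one, Complex.neg_re, Complex.ofReal_re, neg_neg]
  have : ‖(z i)⁻¹‖ ^ 2 ≠ 0 := pow_ne_zero 2 (norm_ne_zero_iff.2 (inv_ne_zero hz))
  exact mul_div_cancel_left₀ _ this

/-! ### Pseudo-Riemannian geometry in local coordinates -/

/-- The Christoffel symbols (Levi-Civita connection) of a metric `g` on an open part of a vector
space: `christoffel g x u v` is `∇_u v` at `x` for the constant vector fields `u` and `v`, that is,
the vector given by the Koszul formula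
`2 g(∇_u v, w) = u g(v,w) + v g(u,w) - w g(u,v)` for all `w`
(unique where `g` is nondegenerate). -/
def christoffel {E : Type*} [NormedAddCommGroup E] [NormedSpace ℝ E] (g : E → E → E → ℝ)
    (x u v : E) : E :=
  Classical.epsilon fun Γ : E => ∀ w : E, 2 * g x Γ w =
    fderiv ℝ (fun y => g y v w) x u + fderiv ℝ (fun y => g y u w) x v
      - fderiv ℝ (fun y => g y u v) x w

/-- The curvature tensor `R(u,v)w = ∇_u ∇_v w - ∇_v ∇_u w` for constant vector fields. -/
def curvature {E : Type*} [NormedAddCommGroup E] [NormedSpace ℝ E] (g : E → E → E → ℝ)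
    (x u v w : E) : E :=
  (fderiv ℝ (fun y => christoffel g y v w) x u + christoffel g x u (christoffel g x v w))
    - (fderiv ℝ (fun y => christoffel g y u w) x v + christoffel g x v (christoffel g x u w))

/-- The metric induced by a map `f` from the metric `g` of the target. -/
def inducedMetric {E F : Type*} [NormedAddCommGroup E] [NormedSpace ℝ E]
    [NormedAddCommGroup F] [NormedSpace ℝ F] (g : F → F → F → ℝ) (f : E → F) (x u v : E) : ℝ :=
  g (f x) (fderiv ℝ f x u) (fderiv ℝ f x v)

/-- The second fundamental form, by the formula of Gauss `h(u,v) = ∇̃_u v - ∇_u v`, where `∇̃` is the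
Levi-Civita connection of the ambient metric `g`, and `∇` that of the induced metric. -/
def secondFundForm {E F : Type*} [NormedAddCommGroup E] [NormedSpace ℝ E]
    [NormedAddCommGroup F] [NormedSpace ℝ F] (g : F → F → F → ℝ) (f : E → F) (x u v : E) : F :=
  (fderiv ℝ (fun y => fderiv ℝ f y v) x u + christoffel g (f x) (fderiv ℝ f x u) (fderiv ℝ f x v))
    - fderiv ℝ f x (christoffel (inducedMetric g f) x u v)

/-- The `k`-th coordinate vector of `ℝ²`. -/
abbrev coordVec (k : Fin 2) : EuclideanSpace ℝ (Fin 2) := EuclideanSpace.single k 1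

/-- The mean curvature vector `H = ½ trace h = ½ Σ g^{kl} h(∂_k, ∂_l)` of a surface. -/
def meanCurvature {F : Type*} [NormedAddCommGroup F] [NormedSpace ℝ F] (g : F → F → F → ℝ)
    (f : EuclideanSpace ℝ (Fin 2) → F) (x : EuclideanSpace ℝ (Fin 2)) : F :=
  (1 / 2 : ℝ) • ∑ k, ∑ l,
    (Matrix.of fun m n => inducedMetric g f x (coordVec m) (coordVec n))⁻¹ k l •
      secondFundForm g f x (coordVec k) (coordVec l)

/-! ### Surfaces in `CH²₁(-4)` -/

section Surfaces

variable {M : Type*} [TopologicalSpace M] [ChartedSpace (EuclideanSpace ℝ (Fin 2)) M]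

/-- The expression of `L : M → CH²₁(-4)` in a chart `e` of `M` and the `i`-th affine chart. -/
def coordMap (L : M → CH21) (e : OpenPartialHomeomorph M (EuclideanSpace ℝ (Fin 2))) (i : Fin 3) :
    EuclideanSpace ℝ (Fin 2) → (Fin 2 → ℂ) := fun x => CH21.chart i (L (e.symm x))

/-- The set on which the coordinate expression is meaningful. -/
def coordDomain (L : M → CH21) (e : OpenPartialHomeomorph M (EuclideanSpace ℝ (Fin 2)))
    (i : Fin 3) : Set (EuclideanSpace ℝ (Fin 2)) :=
  {x | x ∈ e.target ∧ L (e.symm x) ∈ (CH21.chart i).source}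

/-- `P f i x` holds for all coordinate expressions `f` of `L`, in any smooth chart of `M` and any
affine chart `i` of `CH²₁(-4)`, at all points `x` where they are defined. -/
def InAllCoordinates (L : M → CH21)
    (P : (EuclideanSpace ℝ (Fin 2) → (Fin 2 → ℂ)) → Fin 3 → EuclideanSpace ℝ (Fin 2) → Prop) :
    Prop :=
  ∀ e ∈ IsManifold.maximalAtlas (𝓡 2) ∞ M, ∀ i : Fin 3, ∀ x ∈ coordDomain L e i,
    P (coordMap L e i) i x

/-- `ξ`, a tangent vector of `CH²₁(-4)` at `f x`, is normal to the surface. -/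
def IsNormalTo (f : EuclideanSpace ℝ (Fin 2) → (Fin 2 → ℂ)) (i : Fin 3)
    (x : EuclideanSpace ℝ (Fin 2)) (ξ : Fin 2 → ℂ) : Prop :=
  ∀ u, chMetric i (f x) ξ (fderiv ℝ f x u) = 0

/-- Minimal surface: the mean curvature vector vanishes. -/
def IsMinimalSurface (L : M → CH21) : Prop :=
  InAllCoordinates L fun f i x => meanCurvature (chMetric i) f x = 0

/-- Flat surface: the curvature tensor of the induced metric vanishes. -/
def IsFlatSurface (L : M → CH21) : Prop :=
  InAllCoordinates L fun f i x => ∀ u v w, curvature (inducedMetric (chMetric i) f) x u v w = 0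

/-- `α`-slant surface: at each point there is a pseudo-orthonormal frame `e₁, e₂` of the tangent
plane, `⟨e₁,e₁⟩ = ⟨e₂,e₂⟩ = 0`, `⟨e₁,e₂⟩ = -1` (so the surface is immersed and Lorentzian), such that
the tangential component `P` of the complex structure `J` (multiplication by `i` in affine
coordinates) satisfies `P e₁ = (sinh α) e₁` and `P e₂ = -(sinh α) e₂`. -/
def IsSlantWithAngle (L : M → CH21) (α : ℝ) : Prop :=
  InAllCoordinates L fun f i x => ∃ e₁ e₂ : EuclideanSpace ℝ (Fin 2),
    inducedMetric (chMetric i) f x e₁ e₁ = 0 ∧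
    inducedMetric (chMetric i) f x e₂ e₂ = 0 ∧
    inducedMetric (chMetric i) f x e₁ e₂ = -1 ∧
    IsNormalTo f i x (Complex.I • fderiv ℝ f x e₁ - fderiv ℝ f x (Real.sinh α • e₁)) ∧
    IsNormalTo f i x (Complex.I • fderiv ℝ f x e₂ - fderiv ℝ f x (-Real.sinh α • e₂))

/-- Slant surface: the Wirtinger angle is constant. -/
def IsSlantSurface (L : M → CH21) : Prop := ∃ α : ℝ, IsSlantWithAngle L α

/-- Lagrangian surface: `J` maps tangent vectors to normal vectors. -/
def IsLagrangianSurface (L : M → CH21) : Prop :=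
  InAllCoordinates L fun f i x => ∀ u, IsNormalTo f i x (Complex.I • fderiv ℝ f x u)

end Surfaces

/-! ### Congruences and the explicit surface -/

/-- The unitary group of `b_{2,3}`. -/
def HermUnitary : Type :=
  {A : (Fin 3 → ℂ) ≃ₗ[ℂ] (Fin 3 → ℂ) // ∀ z w, hermForm (A z) (A w) = hermForm z w}

/-- The holomorphic isometry `z·ℂ* ↦ (A z)·ℂ*` of `CH²₁(-4)` that a unitary map `A` induces. -/
def HermUnitary.congruence (A : HermUnitary) : CH21 → CH21 :=
  Quotient.map (fun z : H52 => (⟨A.1 z, (A.2 z z).trans z.2⟩ : H52))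
    (by
      rintro z w ⟨c, hc, h⟩
      exact ⟨c, hc, by simp [h]⟩)

/-- The `ℂ³`-valued map `L̃` with parameter `a`. -/
def tildeLVec (a x y : ℝ) : Fin 3 → ℂ :=
  ((1 / √3 : ℝ) : ℂ) •
    ![((√2 : ℝ) : ℂ) * Complex.exp (-(Complex.I / (2 * a)) * (x + a ^ 2 * y)) *
        (Real.cosh (√3 / (2 * a) * (x - a ^ 2 * y)) : ℂ),
      Complex.exp (Complex.I * (a * y + x / a)),
      ((√2 : ℝ) : ℂ) * Complex.exp (-(Complex.I / (2 * a)) * (x + a ^ 2 * y)) *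
        (Real.sinh (√3 / (2 * a) * (x - a ^ 2 * y)) : ℂ)]

theorem tildeLVec_mem (a x y : ℝ) : tildeLVec a x y ∈ H52 := by
  have e1 : -(Complex.I / (2 * a)) * (x + a ^ 2 * y)
      = ((-(1 / (2 * a)) * (x + a ^ 2 * y) : ℝ) : ℂ) * Complex.I := by push_cast; ring
  have e2 : Complex.I * (a * y + x / a) = ((a * y + x / a : ℝ) : ℂ) * Complex.I := by
    push_cast; ring
  have hexp : ∀ t : ℝ, conj (Complex.exp (t * Complex.I)) * Complex.exp (t * Complex.I) = 1 := by
    intro t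
    rw [Complex.conj_mul', Complex.norm_exp_ofReal_mul_I]; simp
  have h2 : ((√2 : ℝ) : ℂ) * ((√2 : ℝ) : ℂ) = 2 := by
    rw [← Complex.ofReal_mul, Real.mul_self_sqrt (by norm_num)]; norm_num
  have h3 : ((1 / √3 : ℝ) : ℂ) * ((1 / √3 : ℝ) : ℂ) = 1 / 3 := by
    rw [← Complex.ofReal_mul, div_mul_div_comm, Real.mul_self_sqrt (by norm_num)]; norm_num
  have hcs : (Real.cosh (√3 / (2 * a) * (x - a ^ 2 * y)) : ℂ) ^ 2
      - (Real.sinh (√3 / (2 * a) * (x - a ^ 2 * y)) : ℂ) ^ 2 = 1 := by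
    exact_mod_cast Real.cosh_sq_sub_sinh_sq _
  show hermForm _ _ = -1
  rw [tildeLVec, hermForm_smul_smul, Complex.conj_ofReal, h3, e1, e2]
  have p1 := hexp (-(1 / (2 * a)) * (x + a ^ 2 * y))
  have p2 := hexp (a * y + x / a)
  generalize Complex.exp (((-(1 / (2 * a)) * (x + a ^ 2 * y) : ℝ) : ℂ) * Complex.I) = E at *
  generalize Complex.exp (((a * y + x / a : ℝ) : ℂ) * Complex.I) = F at *
  generalize Real.cosh (√3 / (2 * a) * (x - a ^ 2 * y)) = C at *
  generalize Real.sinh (√3 / (2 * a) * (x - a ^ 2 * y)) = S at *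
  simp only [hermForm, Matrix.cons_val_zero, Matrix.cons_val_one, Matrix.cons_val, map_mul,
    Complex.conj_ofReal]
  linear_combination (-(1 / 3 : ℂ)) * p2 - (1 / 3) * (C ^ 2 - S ^ 2) * (conj E * E) * h2
    - (2 / 3) * (C ^ 2 - S ^ 2) * p1 - (2 / 3) * hcs

/-- The explicit map `L̃` into `H⁵₂(-1)`. -/
def tildeL (a x y : ℝ) : H52 := ⟨tildeLVec a x y, tildeLVec_mem a x y⟩

end

open scoped ContDiff Manifold ComplexConjugate

noncomputable section

/-! ### Algebra of the Hermitian form -/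

/-! In an affine chart the surface lifts to a map Z into the negative cone of ℂ³. Adding the
connection form ω = -b(Z,dZ)/b(Z,Z) to the derivative gives a covariant derivative ∇ for which ∇Z is
the horizontal lift of tangent vectors and which preserves ⟨,⟩, the form b divided by -b(Z,Z). As ℂ³
is flat, the curvature of ∇ is the scalar form dω (`cov_cov_sub`), so this one Ricci identity
replaces the curvature tensor of the ambient plane.

Take a null frame n₁, n₂ with lifts E₁, E₂ and ⟨E₁,E₂⟩ = -(1+is), s constant. Minimality leaves as
unknowns two real connection coefficients ω₁, ω₂ and two cubic coefficients v, w: ∇₁E₁ = ω₁E₁ + vE₂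
and ∇₁E₂ = -(1+is)Z - ω₁E₂, and likewise with the indices exchanged, s replaced by -s and v by w.
Nullness makes v(1+is) and w(1-is) imaginary, hence vw real. In the Ricci identity for E₁ the
imaginary part of the coefficient of E₁ is then 3s, so s = 0 and the surface is Lagrangian
(`NullFrame.compat`). The coefficient of E₂ gives n₂(v) = -3ω₂v.

Now v and w are imaginary, and flatness turns the equation of Gauss into vw = -1
(`NullFrame.frameCubic_mul_eq`). A boost of the frame multiplies v by the cube of its factor, so v =
w = i can be arranged. Then ω₁ = ω₂ = 0, and the dual coframe and ω are closed. The Poincaré lemma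
yields coordinates X, Y and a factor ρ such that F = ρZ satisfies F_XX = iF_Y, F_XY = -F, F_YY =
iF_X. The exponential solutions of this system have exponents with μ³ = -i, ν = -1/μ. The explicit
surface with a = 1 solves it too, with a frame of the same Gram matrix, so the unitary map that
matches the frames at one point matches the surfaces nearby (`FrameSystem.exists_unitary`).

It remains to use a single unitary map. Where two explicit charts overlap, they differ by a
translation, up to exchanging the coordinates (`tildeVec_rigid`), so the unitary map of one chart
serves the other after a change of coordinates, and connectedness finishes the proof. -/

theorem hermForm_add_left (x y z : Fin 3 → ℂ) :
    hermForm (x + y) z = hermForm x z + hermForm y z := by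
  simp only [hermForm, Pi.add_apply, map_add]; ring

theorem hermForm_add_right (x y z : Fin 3 → ℂ) :
    hermForm x (y + z) = hermForm x y + hermForm x z := by
  simp only [hermForm, Pi.add_apply]; ring

theorem hermForm_smul_left (c : ℂ) (x y : Fin 3 → ℂ) :
    hermForm (c • x) y = conj c * hermForm x y := by
  simp only [hermForm, Pi.smul_apply, smul_eq_mul, map_mul]; ring

theorem hermForm_smul_right (c : ℂ) (x y : Fin 3 → ℂ) :
    hermForm x (c • y) = c * hermForm x y := by
  simp only [hermForm, Pi.smul_apply, smul_eq_mul]; ring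

theorem conj_hermForm (x y : Fin 3 → ℂ) : conj (hermForm x y) = hermForm y x := by
  simp only [hermForm, map_add, map_sub, map_neg, map_mul, Complex.conj_conj]; ring

/-- The Hermitian form as a continuous real bilinear map. -/
def hermCLM : (Fin 3 → ℂ) →L[ℝ] (Fin 3 → ℂ) →L[ℝ] ℂ :=
  LinearMap.toContinuousLinearMap <|
    (LinearMap.toContinuousLinearMap (𝕜 := ℝ) (E := Fin 3 → ℂ) (F' := ℂ)).toLinearMap ∘ₗ
      LinearMap.mk₂ ℝ hermForm hermForm_add_left
        (fun r x y => by
          simpa [Complex.real_smul] using hermForm_smul_left (r : ℂ) x y)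
        hermForm_add_right
        (fun r x y => by
          simpa [Complex.real_smul] using hermForm_smul_right (r : ℂ) x y)

@[simp] theorem hermCLM_apply (x y : Fin 3 → ℂ) : hermCLM x y = hermForm x y := rfl

/-- The Hermitian form, normalized so that `Z` gets the value `-1`. -/
def normForm (Z x y : Fin 3 → ℂ) : ℂ := (((-(hermForm Z Z).re)⁻¹ : ℝ) : ℂ) * hermForm x y

section normForm
variable (Z x y z : Fin 3 → ℂ) (c : ℂ)

theorem normForm_add_left : normForm Z (x + y) z = normForm Z x z + normForm Z y z := by
  simp only [normForm, hermForm_add_left]; ring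

theorem normForm_add_right : normForm Z x (y + z) = normForm Z x y + normForm Z x z := by
  simp only [normForm, hermForm_add_right]; ring

theorem normForm_smul_left : normForm Z (c • x) y = conj c * normForm Z x y := by
  simp only [normForm, hermForm_smul_left]; ring

theorem normForm_smul_right : normForm Z x (c • y) = c * normForm Z x y := by
  simp only [normForm, hermForm_smul_right]; ring

theorem normForm_neg_left : normForm Z (-x) y = -normForm Z x y := by
  simpa using normForm_smul_left Z x y (-1)

theorem normForm_sub_left : normForm Z (x - y) z = normForm Z x z - normForm Z y z := by
  rw [sub_eq_add_neg, normForm_add_left, normForm_neg_left, sub_eq_add_neg]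

theorem conj_normForm : conj (normForm Z x y) = normForm Z y x := by
  simp only [normForm, map_mul, Complex.conj_ofReal, conj_hermForm]

theorem normForm_zero_left : normForm Z 0 y = 0 := by
  simpa using normForm_smul_left Z 0 y 0

theorem normForm_zero_right : normForm Z x 0 = 0 := by
  simpa using normForm_smul_right Z x 0 0

theorem normForm_self_im : (normForm Z x x).im = 0 := by
  simp [normForm, hermForm_self_im]

theorem normForm_re_comm : (normForm Z x y).re = (normForm Z y x).re := by
  rw [← conj_normForm, Complex.conj_re]

theorem normForm_im_comm : (normForm Z x y).im = -(normForm Z y x).im := by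
  rw [← conj_normForm, Complex.conj_im]

variable {Z}

theorem normForm_self (hZ : (hermForm Z Z).re < 0) : normForm Z Z Z = -1 := by
  rw [normForm, hermForm_self_eq Z, ← Complex.ofReal_mul, Complex.ofReal_re]
  rw [inv_neg, neg_mul, inv_mul_cancel₀ hZ.ne]; simp

theorem normForm_eq_zero_iff (hZ : (hermForm Z Z).re < 0) :
    normForm Z x y = 0 ↔ hermForm x y = 0 := by
  have : (((-(hermForm Z Z).re)⁻¹ : ℝ) : ℂ) ≠ 0 :=
    Complex.ofReal_ne_zero.2 (inv_ne_zero (neg_ne_zero.2 hZ.ne))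
  simp only [normForm, mul_eq_zero, this, false_or]

end normForm

/-- A basis `Z, e₁, e₂` of `ℂ³` in which the normalized form has the Gram matrix
`-1 ⊕ (0, -c; -c̄, 0)`. -/
structure IsNullBasis (Z e₁ e₂ : Fin 3 → ℂ) (c : ℂ) : Prop where
  neg : (hermForm Z Z).re < 0
  ne : c ≠ 0
  orth₁ : normForm Z Z e₁ = 0
  orth₂ : normForm Z Z e₂ = 0
  null₁ : normForm Z e₁ e₁ = 0
  null₂ : normForm Z e₂ e₂ = 0
  pair : normForm Z e₁ e₂ = -c

namespace IsNullBasis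
variable {Z e₁ e₂ : Fin 3 → ℂ} {c : ℂ} (h : IsNullBasis Z e₁ e₂ c)
include h

theorem self : normForm Z Z Z = -1 := normForm_self h.neg

theorem orth₁' : normForm Z e₁ Z = 0 := by rw [← conj_normForm, h.orth₁, map_zero]

theorem orth₂' : normForm Z e₂ Z = 0 := by rw [← conj_normForm, h.orth₂, map_zero]

theorem pair' : normForm Z e₂ e₁ = -conj c := by rw [← conj_normForm, h.pair, map_neg]

theorem ne' : conj c ≠ 0 := (map_ne_zero _).2 h.ne

/-- Each of the three pairings isolates one coefficient. Since e₁ and e₂ are null, e₁ detects the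
coefficient of e₂ and conversely. -/
theorem normForm_comb₀ (a b d : ℂ) : normForm Z Z (a • Z + b • e₁ + d • e₂) = -a := by
  simp [normForm_add_right, normForm_smul_right, h.self, h.orth₁, h.orth₂]

theorem normForm_comb₁ (a b d : ℂ) : normForm Z e₁ (a • Z + b • e₁ + d • e₂) = -(d * c) := by
  simp [normForm_add_right, normForm_smul_right, h.orth₁', h.null₁, h.pair]

theorem normForm_comb₂ (a b d : ℂ) :
    normForm Z e₂ (a • Z + b • e₁ + d • e₂) = -(b * conj c) := by
  simp [normForm_add_right, normForm_smul_right, h.orth₂', h.null₂, h.pair']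

theorem linearIndependent : LinearIndependent ℂ ![Z, e₁, e₂] := by
  rw [Fintype.linearIndependent_iff]
  intro g hg
  have hg' : g 0 • Z + g 1 • e₁ + g 2 • e₂ = 0 := by simpa [Fin.sum_univ_three] using hg
  have h0 := h.normForm_comb₀ (g 0) (g 1) (g 2)
  have h1 := h.normForm_comb₁ (g 0) (g 1) (g 2)
  have h2 := h.normForm_comb₂ (g 0) (g 1) (g 2)
  rw [hg', normForm_zero_right] at h0 h1 h2
  have h1' : g 2 = 0 := by simpa [h.ne] using h1.symm
  have h2' : g 1 = 0 := by simpa [h.ne] using h2.symm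
  have h0' : g 0 = 0 := by simpa using h0.symm
  intro i
  fin_cases i <;> assumption

/-- The basis of `ℂ³` formed by the three vectors. -/
def basis : Module.Basis (Fin 3) ℂ (Fin 3 → ℂ) :=
  basisOfLinearIndependentOfCardEqFinrank h.linearIndependent (by simp)

theorem basis_apply (k : Fin 3) : h.basis k = ![Z, e₁, e₂] k := by
  simp [basis]

theorem exists_comb (x : Fin 3 → ℂ) : ∃ a b d : ℂ, x = a • Z + b • e₁ + d • e₂ := by
  refine ⟨h.basis.repr x 0, h.basis.repr x 1, h.basis.repr x 2, ?_⟩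
  conv_lhs => rw [← h.basis.sum_repr x]
  simp [Fin.sum_univ_three, h.basis_apply]

theorem expand (x : Fin 3 → ℂ) : x = (-normForm Z Z x) • Z + (-(normForm Z e₂ x / conj c)) • e₁ +
    (-(normForm Z e₁ x / c)) • e₂ := by
  obtain ⟨a, b, d, rfl⟩ := h.exists_comb x
  rw [h.normForm_comb₀, h.normForm_comb₁, h.normForm_comb₂]
  rw [neg_neg, neg_div, neg_neg, neg_div, neg_neg, mul_div_cancel_right₀ _ h.ne',
    mul_div_cancel_right₀ _ h.ne]

theorem comb_eq_zero {a b d : ℂ} (h0 : a • Z + b • e₁ + d • e₂ = 0) : a = 0 ∧ b = 0 ∧ d = 0 := by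
  have h2 := h.normForm_comb₀ a b d
  have h3 := h.normForm_comb₁ a b d
  have h4 := h.normForm_comb₂ a b d
  rw [h0, normForm_zero_right] at h2 h3 h4
  refine ⟨by simpa using h2.symm, by simpa [h.ne] using h4.symm, by simpa [h.ne] using h3.symm⟩

theorem swap : IsNullBasis Z e₂ e₁ (conj c) :=
  ⟨h.neg, h.ne', h.orth₂, h.orth₁, h.null₂, h.null₁, h.pair'⟩

end IsNullBasis

/-! ### The covariant derivative along a map into the negative cone -/

section cov

variable {E : Type*} [NormedAddCommGroup E] [NormedSpace ℝ E]

/-- The connection form that makes the covariant derivative of `Z` orthogonal to `Z`. -/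
def connForm (Z : E → Fin 3 → ℂ) (x : E) : E →L[ℝ] ℂ :=
  (-(hermForm (Z x) (Z x))⁻¹) • (hermCLM (Z x)).comp (fderiv ℝ Z x)

/-- Scalar multiplication, as a real bilinear map, with the vector as first argument. -/
def smulFlip : (Fin 3 → ℂ) →L[ℝ] ℂ →L[ℝ] (Fin 3 → ℂ) := (ContinuousLinearMap.lsmul ℝ ℂ).flip

@[simp] theorem smulFlip_apply (x : Fin 3 → ℂ) (c : ℂ) : smulFlip x c = c • x := rfl

/-- The covariant derivative of `ξ` along `Z`. -/
def cov (Z ξ : E → Fin 3 → ℂ) (x : E) : E →L[ℝ] (Fin 3 → ℂ) :=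
  fderiv ℝ ξ x + (smulFlip (ξ x)).comp (connForm Z x)

theorem connForm_apply (Z : E → Fin 3 → ℂ) (x u : E) :
    connForm Z x u = -(hermForm (Z x) (fderiv ℝ Z x u) / hermForm (Z x) (Z x)) := by
  simp [connForm, div_eq_inv_mul]

theorem cov_apply (Z ξ : E → Fin 3 → ℂ) (x u : E) :
    cov Z ξ x u = fderiv ℝ ξ x u + connForm Z x u • ξ x := by
  simp [cov]

theorem cov_self_eq_horizontal (Z : E → Fin 3 → ℂ) (x u : E) :
    cov Z Z x u = horizontal (Z x) (fderiv ℝ Z x u) := by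
  rw [cov_apply, connForm_apply, horizontal, neg_smul, sub_eq_add_neg]

variable {Z ξ η : E → Fin 3 → ℂ} {U : Set E} {x : E}

theorem hermForm_self_ne_zero {z : Fin 3 → ℂ} (h : (hermForm z z).re < 0) : hermForm z z ≠ 0 :=
  fun h0 => by simp [h0] at h

theorem normForm_cov_self (h : (hermForm (Z x) (Z x)).re < 0) (u : E) :
    normForm (Z x) (Z x) (cov Z Z x u) = 0 := by
  rw [normForm_eq_zero_iff _ _ h, cov_apply, connForm_apply, hermForm_add_right,
    hermForm_smul_right]
  field_simp [hermForm_self_ne_zero h]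
  ring

theorem HasFDerivAt.hermForm {ξ' η' : E →L[ℝ] (Fin 3 → ℂ)} (hξ : HasFDerivAt ξ ξ' x)
    (hη : HasFDerivAt η η' x) :
    HasFDerivAt (fun y => hermForm (ξ y) (η y))
      (hermCLM.precompR E (ξ x) η' + hermCLM.precompL E ξ' (η x)) x :=
  hermCLM.hasFDerivAt_of_bilinear hξ hη

theorem contDiffOn_hermForm {n : WithTop ℕ∞} (hξ : ContDiffOn ℝ n ξ U) (hη : ContDiffOn ℝ n η U) :
    ContDiffOn ℝ n (fun y => hermForm (ξ y) (η y)) U :=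
  hermCLM.isBoundedBilinearMap.contDiff.comp_contDiffOn (hξ.prodMk hη)

theorem differentiableAt_hermForm (hξ : DifferentiableAt ℝ ξ x) (hη : DifferentiableAt ℝ η x) :
    DifferentiableAt ℝ (fun y => hermForm (ξ y) (η y)) x :=
  (hξ.hasFDerivAt.hermForm hη.hasFDerivAt).differentiableAt

/-- The logarithmic derivative of -1/b(Z,Z) is ω + ω̄. These are exactly the terms that ω
contributes in the two slots of b, which is why ∇ preserves the normalized form. -/
theorem hasFDerivAt_normForm_scale (hZ : DifferentiableAt ℝ Z x)
    (h : (hermForm (Z x) (Z x)).re < 0) :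
    ∃ f' : E →L[ℝ] ℂ, HasFDerivAt
      (fun y => (((-(hermForm (Z y) (Z y)).re)⁻¹ : ℝ) : ℂ)) f' x ∧ ∀ u, f' u =
      (((-(hermForm (Z x) (Z x)).re)⁻¹ : ℝ) : ℂ) * (connForm Z x u + conj (connForm Z x u)) := by
  have h1 := hZ.hasFDerivAt.hermForm hZ.hasFDerivAt
  have h2 := (Complex.reCLM.hasFDerivAt (x := hermForm (Z x) (Z x))).comp x h1
  have h2' := h2.neg
  have h3 := (hasDerivAt_inv (neg_ne_zero.2 h.ne)).comp_hasFDerivAt x h2'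
  have h4 := (Complex.ofRealCLM.hasFDerivAt).comp x h3
  refine ⟨_, h4, fun u => ?_⟩
  have e1 : hermForm (Z x) (Z x) = ((hermForm (Z x) (Z x)).re : ℂ) := hermForm_self_eq _
  have e2 := conj_hermForm (Z x) (fderiv ℝ Z x u)
  have e3 : ((hermForm (Z x) (Z x)).re : ℂ) ≠ 0 := Complex.ofReal_ne_zero.2 h.ne
  have e4 : ((hermForm (fderiv ℝ Z x u) (Z x)).re : ℂ) + (hermForm (Z x) (fderiv ℝ Z x u)).re =
      hermForm (fderiv ℝ Z x u) (Z x) + hermForm (Z x) (fderiv ℝ Z x u) := by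
    rw [← e2]
    apply Complex.ext <;> simp
  rw [connForm_apply, map_neg, map_div₀, conj_hermForm, conj_hermForm]
  simp only [ContinuousLinearMap.comp_apply, smul_apply,
    neg_apply, add_apply, Complex.reCLM_apply,
    Complex.ofRealCLM_apply, smul_eq_mul, ContinuousLinearMap.precompR_apply,
    ContinuousLinearMap.precompL_apply, ContinuousLinearMap.compL_apply, hermCLM_apply,
    Complex.add_re, Complex.ofReal_neg,
    Complex.ofReal_mul, Complex.ofReal_inv, Complex.ofReal_pow, Complex.ofReal_add]
  rw [add_comm] at e4
  rw [e4]
  generalize ((hermForm (Z x) (Z x)).re : ℂ) = r at *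
  rw [e1]
  field_simp
  ring

theorem differentiableAt_normForm (hZ : DifferentiableAt ℝ Z x) (hξ : DifferentiableAt ℝ ξ x)
    (hη : DifferentiableAt ℝ η x) (h : (hermForm (Z x) (Z x)).re < 0) :
    DifferentiableAt ℝ (fun y => normForm (Z y) (ξ y) (η y)) x := by
  obtain ⟨f', h1, -⟩ := hasFDerivAt_normForm_scale hZ h
  exact h1.differentiableAt.mul (differentiableAt_hermForm hξ hη)

/-- The covariant derivative is compatible with the normalized form. -/
theorem fderiv_normForm (hZ : DifferentiableAt ℝ Z x) (hξ : DifferentiableAt ℝ ξ x)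
    (hη : DifferentiableAt ℝ η x) (h : (hermForm (Z x) (Z x)).re < 0) (u : E) :
    fderiv ℝ (fun y => normForm (Z y) (ξ y) (η y)) x u =
      normForm (Z x) (cov Z ξ x u) (η x) + normForm (Z x) (ξ x) (cov Z η x u) := by
  obtain ⟨f', h1, h1'⟩ := hasFDerivAt_normForm_scale hZ h
  have h2 := h1.mul (hξ.hasFDerivAt.hermForm hη.hasFDerivAt)
  have h3 : fderiv ℝ (fun y => normForm (Z y) (ξ y) (η y)) x = _ := h2.fderiv
  rw [h3]
  simp only [add_apply, smul_apply, smul_eq_mul,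
    ContinuousLinearMap.precompR_apply, ContinuousLinearMap.precompL_apply,
    ContinuousLinearMap.compL_apply, ContinuousLinearMap.comp_apply, hermCLM_apply, h1',
    normForm, cov_apply, hermForm_add_left, hermForm_add_right, hermForm_smul_left,
    hermForm_smul_right]
  ring

theorem contDiffOn_normForm (hZ : ContDiffOn ℝ ∞ Z U) (hξ : ContDiffOn ℝ ∞ ξ U)
    (hη : ContDiffOn ℝ ∞ η U) (h : ∀ x ∈ U, (hermForm (Z x) (Z x)).re < 0) :
    ContDiffOn ℝ ∞ (fun y => normForm (Z y) (ξ y) (η y)) U := by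
  refine ContDiffOn.mul ?_ (contDiffOn_hermForm hξ hη)
  refine Complex.ofRealCLM.contDiff.comp_contDiffOn (ContDiffOn.inv ?_ fun x hx =>
    neg_ne_zero.2 (h x hx).ne)
  exact (Complex.reCLM.contDiff.comp_contDiffOn (contDiffOn_hermForm hZ hZ)).neg

theorem contDiffOn_fderiv {F : Type*} [NormedAddCommGroup F] [NormedSpace ℝ F] {f : E → F}
    (hU : IsOpen U) (hf : ContDiffOn ℝ ∞ f U) : ContDiffOn ℝ ∞ (fderiv ℝ f) U :=
  hf.fderiv_of_isOpen hU (by simp)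

theorem contDiffOn_connForm (hU : IsOpen U) (hZ : ContDiffOn ℝ ∞ Z U)
    (h : ∀ x ∈ U, (hermForm (Z x) (Z x)).re < 0) : ContDiffOn ℝ ∞ (connForm Z) U := by
  have h1 : ContDiffOn ℝ ∞ (fun x => -(hermForm (Z x) (Z x))⁻¹) U :=
    ((contDiffOn_hermForm hZ hZ).inv fun x hx => hermForm_self_ne_zero (h x hx)).neg
  have h2 : ContDiffOn ℝ ∞ (fun x => (hermCLM (Z x)).comp (fderiv ℝ Z x)) U :=
    (hermCLM.contDiff.comp_contDiffOn hZ).clm_comp (contDiffOn_fderiv hU hZ)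
  exact h1.smul h2

theorem contDiffOn_cov (hU : IsOpen U) (hZ : ContDiffOn ℝ ∞ Z U) (hξ : ContDiffOn ℝ ∞ ξ U)
    (h : ∀ x ∈ U, (hermForm (Z x) (Z x)).re < 0) : ContDiffOn ℝ ∞ (cov Z ξ) U :=
  by
  have h1 : ContDiffOn ℝ ∞ (fun y => smulFlip (ξ y)) U := smulFlip.contDiff.comp_contDiffOn hξ
  exact (contDiffOn_fderiv hU hξ).add (h1.clm_comp (contDiffOn_connForm hU hZ h))

theorem cov_congr {ξ' : E → Fin 3 → ℂ} (h : ξ =ᶠ[nhds x] ξ') : cov Z ξ x = cov Z ξ' x := by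
  rw [cov, cov, h.fderiv_eq, h.eq_of_nhds]

theorem cov_add (hξ : DifferentiableAt ℝ ξ x) (hη : DifferentiableAt ℝ η x) (u : E) :
    cov Z (fun y => ξ y + η y) x u = cov Z ξ x u + cov Z η x u := by
  simp only [cov_apply]
  rw [fderiv_fun_add hξ hη, add_apply, smul_add]
  abel

theorem cov_smul {f : E → ℂ} (hf : DifferentiableAt ℝ f x) (hξ : DifferentiableAt ℝ ξ x) (u : E) :
    cov Z (fun y => f y • ξ y) x u = fderiv ℝ f x u • ξ x + f x • cov Z ξ x u := by
  simp only [cov_apply]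
  rw [fderiv_fun_smul hf hξ]
  simp only [add_apply, smul_apply,
    ContinuousLinearMap.smulRight_apply, smul_add, smul_smul]
  rw [mul_comm (f x)]
  abel

/-- The Leibniz rule for the covariant derivative of a vector field along `Z`. -/
theorem cov_clm_apply {A : E → E →L[ℝ] (Fin 3 → ℂ)} {Y : E → E} (hA : DifferentiableAt ℝ A x)
    (hY : DifferentiableAt ℝ Y x) (u : E) :
    cov Z (fun y => A y (Y y)) x u = cov Z (fun y => A y (Y x)) x u + A x (fderiv ℝ Y x u) := by
  simp only [cov_apply]
  rw [(hA.hasFDerivAt.clm_apply hY.hasFDerivAt).fderiv,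
    (hA.hasFDerivAt.clm_apply (hasFDerivAt_const (Y x) x)).fderiv]
  simp
  abel

/-- The curvature form of the connection form. -/
def connCurv (Z : E → Fin 3 → ℂ) (x u v : E) : ℂ :=
  fderiv ℝ (connForm Z) x u v - fderiv ℝ (connForm Z) x v u

theorem fderiv_cov_apply (hU : IsOpen U) (hx : x ∈ U) (hZ : ContDiffOn ℝ ∞ Z U)
    (hξ : ContDiffOn ℝ ∞ ξ U) (h : ∀ x ∈ U, (hermForm (Z x) (Z x)).re < 0) (u v : E) :
    fderiv ℝ (fun y => cov Z ξ y v) x u = fderiv ℝ (fderiv ℝ ξ) x u v +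
      (fderiv ℝ (connForm Z) x u v • ξ x + connForm Z x v • fderiv ℝ ξ x u) := by
  have hn := hU.mem_nhds hx
  have d1 : DifferentiableAt ℝ (fderiv ℝ ξ) x :=
    ((contDiffOn_fderiv hU hξ).contDiffAt hn).differentiableAt (by simp)
  have d2 : DifferentiableAt ℝ (connForm Z) x :=
    ((contDiffOn_connForm hU hZ h).contDiffAt hn).differentiableAt (by simp)
  have d3 : DifferentiableAt ℝ ξ x := (hξ.contDiffAt hn).differentiableAt (by simp)
  have e1 := d1.hasFDerivAt.clm_apply (hasFDerivAt_const v x)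
  have e2 := d2.hasFDerivAt.clm_apply (hasFDerivAt_const v x)
  have e3 := e1.add (e2.smul d3.hasFDerivAt)
  have : (fun y => cov Z ξ y v) = (fun y => fderiv ℝ ξ y v) + (fun y => connForm Z y v) • ξ := by
    funext y; simp [cov_apply]
  rw [this, e3.fderiv]
  simp [add_comm]

/-- The Ricci identity. -/
theorem cov_cov_sub (hU : IsOpen U) (hx : x ∈ U) (hZ : ContDiffOn ℝ ∞ Z U)
    (hξ : ContDiffOn ℝ ∞ ξ U) (h : ∀ x ∈ U, (hermForm (Z x) (Z x)).re < 0) (u v : E) :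
    cov Z (fun y => cov Z ξ y v) x u - cov Z (fun y => cov Z ξ y u) x v =
      connCurv Z x u v • ξ x := by
  -- The second derivatives of ξ cancel by symmetry and the products of ω commute, so only dω
  -- survives.
  have hsymm := ((hξ.contDiffAt (hU.mem_nhds hx)).isSymmSndFDerivAt (by
    simpa using WithTop.coe_le_coe.2 (le_top : (2 : ℕ∞) ≤ ⊤))).eq u v
  rw [cov_apply _ (fun y => cov Z ξ y v), cov_apply _ (fun y => cov Z ξ y u),
    fderiv_cov_apply hU hx hZ hξ h, fderiv_cov_apply hU hx hZ hξ h, hsymm, cov_apply, cov_apply,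
    connCurv, sub_smul, smul_add, smul_add, smul_smul, smul_smul,
    mul_comm (connForm Z x u) (connForm Z x v)]
  abel

/-- The Ricci identity for vector fields. -/
theorem cov_cov_sub_field (hU : IsOpen U) (hx : x ∈ U) (hZ : ContDiffOn ℝ ∞ Z U)
    (hξ : ContDiffOn ℝ ∞ ξ U) (h : ∀ x ∈ U, (hermForm (Z x) (Z x)).re < 0) {X Y : E → E}
    (hX : DifferentiableAt ℝ X x) (hY : DifferentiableAt ℝ Y x) :
    cov Z (fun y => cov Z ξ y (Y y)) x (X x) - cov Z (fun y => cov Z ξ y (X y)) x (Y x) =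
      cov Z ξ x (fderiv ℝ Y x (X x) - fderiv ℝ X x (Y x)) + connCurv Z x (X x) (Y x) • ξ x := by
  have hc : DifferentiableAt ℝ (cov Z ξ) x :=
    ((contDiffOn_cov hU hZ hξ h).contDiffAt (hU.mem_nhds hx)).differentiableAt (by simp)
  rw [cov_clm_apply hc hY, cov_clm_apply hc hX, ← cov_cov_sub hU hx hZ hξ h, map_sub]
  abel

end cov

/-! ### Null frames along a minimal slant surface -/

section NullFrame

variable {E : Type*} [NormedAddCommGroup E] [NormedSpace ℝ E]

/-- The horizontal lift along `Z` of the vector field `n`. -/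
def frameLift (Z : E → Fin 3 → ℂ) (n : E → E) (x : E) : Fin 3 → ℂ := cov Z Z x (n x)

/-- A smooth null frame `n₁, n₂` along the lift `Z` of a surface, with `⟨n₁, n₂⟩ = -1`, whose
Kähler angle function `s` is constant, and in which the minimal surface equation holds: the
component of `∇_{n₁} n₂` normal to the surface vanishes. -/
structure NullFrame (Z : E → Fin 3 → ℂ) (U : Set E) (n₁ n₂ : E → E) (s : E → ℝ) : Prop where
  isOpen : IsOpen U
  smooth : ContDiffOn ℝ ∞ Z U
  neg : ∀ x ∈ U, (hermForm (Z x) (Z x)).re < 0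
  smooth₁ : ContDiffOn ℝ ∞ n₁ U
  smooth₂ : ContDiffOn ℝ ∞ n₂ U
  null₁ : ∀ x ∈ U, normForm (Z x) (frameLift Z n₁ x) (frameLift Z n₁ x) = 0
  null₂ : ∀ x ∈ U, normForm (Z x) (frameLift Z n₂ x) (frameLift Z n₂ x) = 0
  pair : ∀ x ∈ U, normForm (Z x) (frameLift Z n₁ x) (frameLift Z n₂ x) = -(1 + s x * Complex.I)
  angle : ∀ x ∈ U, HasFDerivAt s (0 : E →L[ℝ] ℝ) x
  span : ∀ x ∈ U, ∀ u, ∃ a b : ℝ, u = a • n₁ x + b • n₂ x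
  minimal : ∀ x ∈ U, ∃ a b : ℝ, ∃ l : ℂ, cov Z (frameLift Z n₂) x (n₁ x) =
    (l • Z x + (a : ℂ) • frameLift Z n₁ x) + (b : ℂ) • frameLift Z n₂ x

/-- The first connection coefficient of a null frame. -/
def frameConn (Z : E → Fin 3 → ℂ) (n₁ n₂ : E → E) (x : E) : ℝ :=
  (normForm (Z x) (frameLift Z n₁ x) (cov Z (frameLift Z n₂) x (n₁ x))).re

/-- The coefficient of `n₂` in `∇_{n₁} n₁`. -/
def frameCubic (Z : E → Fin 3 → ℂ) (n₁ n₂ : E → E) (x : E) : ℂ :=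
  normForm (Z x) (frameLift Z n₁ x) (cov Z (frameLift Z n₁) x (n₁ x)) /
    normForm (Z x) (frameLift Z n₁ x) (frameLift Z n₂ x)

theorem fderiv_ofReal_im {f : E → ℝ} {x : E} (hf : DifferentiableAt ℝ f x) (u : E) :
    (fderiv ℝ (fun y => (f y : ℂ)) x u).im = 0 := by
  have h1 : fderiv ℝ (fun y => (f y : ℂ)) x = _ :=
    (Complex.ofRealCLM.hasFDerivAt.comp x hf.hasFDerivAt).fderiv
  rw [h1]
  simp

theorem one_add_mul_I_ne_zero (r : ℝ) : (1 + r * Complex.I : ℂ) ≠ 0 := fun h => by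
  simpa using congrArg Complex.re h

theorem conj_one_add_mul_I (r : ℝ) :
    conj (1 + r * Complex.I : ℂ) = 1 + ((-r : ℝ) : ℂ) * Complex.I := by
  simp

namespace NullFrame

variable {Z : E → Fin 3 → ℂ} {U : Set E} {n₁ n₂ : E → E} {s : E → ℝ} {x : E}
  (h : NullFrame Z U n₁ n₂ s)
include h

theorem contDiffOn_frameLift {n : E → E} (hn : ContDiffOn ℝ ∞ n U) :
    ContDiffOn ℝ ∞ (frameLift Z n) U :=
  (contDiffOn_cov h.isOpen h.smooth h.smooth h.neg).clm_apply hn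

theorem contDiffOn_cov_frameLift {n m : E → E} (hn : ContDiffOn ℝ ∞ n U)
    (hm : ContDiffOn ℝ ∞ m U) :
    ContDiffOn ℝ ∞ (fun y => cov Z (frameLift Z n) y (m y)) U :=
  (contDiffOn_cov h.isOpen h.smooth (h.contDiffOn_frameLift hn) h.neg).clm_apply hm

theorem differentiableAt_of_contDiffOn {F : Type*} [NormedAddCommGroup F] [NormedSpace ℝ F]
    {f : E → F} (hf : ContDiffOn ℝ ∞ f U) (hx : x ∈ U) : DifferentiableAt ℝ f x :=
  (hf.contDiffAt (h.isOpen.mem_nhds hx)).differentiableAt (by simp)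

theorem isNullBasis (hx : x ∈ U) :
    IsNullBasis (Z x) (frameLift Z n₁ x) (frameLift Z n₂ x) (1 + s x * Complex.I) where
  neg := h.neg x hx
  ne := one_add_mul_I_ne_zero _
  orth₁ := normForm_cov_self (h.neg x hx) _
  orth₂ := normForm_cov_self (h.neg x hx) _
  null₁ := h.null₁ x hx
  null₂ := h.null₂ x hx
  pair := h.pair x hx

theorem contDiffOn_frameConn : ContDiffOn ℝ ∞ (frameConn Z n₁ n₂) U :=
  Complex.reCLM.contDiff.comp_contDiffOn (contDiffOn_normForm h.smooth
    (h.contDiffOn_frameLift h.smooth₁) (h.contDiffOn_cov_frameLift h.smooth₂ h.smooth₁) h.neg)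

theorem contDiffOn_frameCubic : ContDiffOn ℝ ∞ (frameCubic Z n₁ n₂) U := by
  have h1 := (contDiffOn_normForm h.smooth (h.contDiffOn_frameLift h.smooth₁)
    (h.contDiffOn_frameLift h.smooth₂) h.neg).inv fun x hx => by
      rw [h.pair x hx]
      exact neg_ne_zero.2 (one_add_mul_I_ne_zero _)
  exact (contDiffOn_normForm h.smooth (h.contDiffOn_frameLift h.smooth₁)
    (h.contDiffOn_cov_frameLift h.smooth₁ h.smooth₁) h.neg).mul h1

theorem fderiv_normForm_eq {ξ η : E → Fin 3 → ℂ} (hx : x ∈ U) (hξ : ContDiffOn ℝ ∞ ξ U)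
    (hη : ContDiffOn ℝ ∞ η U) {f : E → ℂ} (hf : ∀ y ∈ U, normForm (Z y) (ξ y) (η y) = f y)
    (hf' : HasFDerivAt f (0 : E →L[ℝ] ℂ) x) (u : E) :
    normForm (Z x) (cov Z ξ x u) (η x) + normForm (Z x) (ξ x) (cov Z η x u) = 0 := by
  rw [← fderiv_normForm (h.differentiableAt_of_contDiffOn h.smooth hx)
    (h.differentiableAt_of_contDiffOn hξ hx) (h.differentiableAt_of_contDiffOn hη hx)
    (h.neg x hx)]
  have : (fun y => normForm (Z y) (ξ y) (η y)) =ᶠ[nhds x] f :=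
    Filter.eventually_of_mem (h.isOpen.mem_nhds hx) hf
  rw [this.fderiv_eq, hf'.fderiv]
  rfl

/-- A Hermitian square is always real, so differentiating its vanishing only controls the real part.
The imaginary part remains free and carries the cubic coefficient. -/
theorem normForm_cov_null {n : E → E} (hx : x ∈ U) (hn : ContDiffOn ℝ ∞ n U)
    (h0 : ∀ y ∈ U, normForm (Z y) (frameLift Z n y) (frameLift Z n y) = 0) (u : E) :
    (normForm (Z x) (frameLift Z n x) (cov Z (frameLift Z n) x u)).re = 0 := by
  have := h.fderiv_normForm_eq hx (h.contDiffOn_frameLift hn) (h.contDiffOn_frameLift hn)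
    (f := fun _ => 0) h0 (hasFDerivAt_const _ _) u
  have h2 := congrArg Complex.re this
  rw [Complex.add_re, normForm_re_comm (Z x) (cov _ _ _ _)] at h2
  simp only [Complex.zero_re] at h2
  linarith

theorem hasFDerivAt_pair (hx : x ∈ U) :
    HasFDerivAt (fun y => -(1 + s y * Complex.I : ℂ)) (0 : E →L[ℝ] ℂ) x := by
  have h1 := Complex.ofRealCLM.hasFDerivAt.comp x (h.angle x hx)
  exact ((h1.mul_const Complex.I).const_add 1).neg.congr_fderiv (by simp)

/-- This is where the constancy of the Kähler angle enters the structure equations. -/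
theorem normForm_cov_pair (hx : x ∈ U) (u : E) :
    normForm (Z x) (cov Z (frameLift Z n₁) x u) (frameLift Z n₂ x) =
      -normForm (Z x) (frameLift Z n₁ x) (cov Z (frameLift Z n₂) x u) :=
  eq_neg_of_add_eq_zero_left (h.fderiv_normForm_eq hx (h.contDiffOn_frameLift h.smooth₁)
    (h.contDiffOn_frameLift h.smooth₂) h.pair (h.hasFDerivAt_pair hx) u)

theorem normForm_cov_orth {n : E → E} (hx : x ∈ U) (hn : ContDiffOn ℝ ∞ n U) (u : E) :
    normForm (Z x) (Z x) (cov Z (frameLift Z n) x u) =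
      -normForm (Z x) (cov Z Z x u) (frameLift Z n x) :=
  eq_neg_of_add_eq_zero_right (h.fderiv_normForm_eq hx h.smooth (h.contDiffOn_frameLift hn)
    (f := fun _ => 0) (fun y hy => normForm_cov_self (h.neg y hy) _) (hasFDerivAt_const _ _) u)

/-- By minimality the coefficients a, b of E₁, E₂ are real. The pairing with E₂ is -a(1-is), whose
real part vanishes by nullness, so a = 0. The pairing with E₁ gives b, and ⟨Z,E₂⟩ = 0 gives the
coefficient of Z. -/
theorem cov₁₂ (hx : x ∈ U) : cov Z (frameLift Z n₂) x (n₁ x) =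
    (-(1 + s x * Complex.I)) • Z x + (-(frameConn Z n₁ n₂ x : ℂ)) • frameLift Z n₂ x := by
  have hb := h.isNullBasis hx
  obtain ⟨a, b, l, e⟩ := h.minimal x hx
  have h0 := hb.normForm_comb₀ l a b
  have h1 := hb.normForm_comb₁ l a b
  have h2 := hb.normForm_comb₂ l a b
  rw [← e] at h0 h1 h2
  have hl : l = -(1 + s x * Complex.I) := by
    rw [h.normForm_cov_orth hx h.smooth₂] at h0
    have hp : normForm (Z x) (cov Z Z x (n₁ x)) (frameLift Z n₂ x) = _ := h.pair x hx
    rw [hp] at h0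
    linear_combination h0
  have ha : a = 0 := by
    have := h.normForm_cov_null hx h.smooth₂ h.null₂ (n₁ x)
    rw [h2] at this
    simpa using this
  have hbb : b = -frameConn Z n₁ n₂ x := by
    rw [frameConn, h1]
    simp
  rw [e, ha, hbb, hl]
  simp

/-- The Ricci identity for the field Z itself. It plays the role of torsion-freeness: modulo Z, the
difference of the mixed derivatives is the lift of the Lie bracket. -/
theorem bracket_aux (hx : x ∈ U) :
    cov Z (frameLift Z n₂) x (n₁ x) - cov Z (frameLift Z n₁) x (n₂ x) =
      cov Z Z x (fderiv ℝ n₂ x (n₁ x) - fderiv ℝ n₁ x (n₂ x)) +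
        connCurv Z x (n₁ x) (n₂ x) • Z x :=
  cov_cov_sub_field h.isOpen hx h.smooth h.smooth h.neg
    (h.differentiableAt_of_contDiffOn h.smooth₁ hx) (h.differentiableAt_of_contDiffOn h.smooth₂ hx)

/-- The minimality condition is symmetric in the two fields because the mixed derivatives differ by
a bracket, which is tangent, and by a multiple of Z. Hence each structure equation also yields its
mirror image. -/
theorem swap : NullFrame Z U n₂ n₁ (-s) where
  isOpen := h.isOpen
  smooth := h.smooth
  neg := h.neg
  smooth₁ := h.smooth₂
  smooth₂ := h.smooth₁
  null₁ := h.null₂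
  null₂ := h.null₁
  pair x hx := by
    rw [← conj_normForm, h.pair x hx, map_neg, conj_one_add_mul_I, Pi.neg_apply]
  angle x hx := by simpa using (h.angle x hx).neg
  span x hx u := by
    obtain ⟨a, b, e⟩ := h.span x hx u
    exact ⟨b, a, by rw [e, add_comm]⟩
  minimal x hx := by
    have e1 := h.bracket_aux hx
    obtain ⟨a, b, e⟩ := h.span x hx (fderiv ℝ n₂ x (n₁ x) - fderiv ℝ n₁ x (n₂ x))
    rw [h.cov₁₂ hx, e, map_add, map_smul, map_smul] at e1
    refine ⟨-(frameConn Z n₁ n₂ x) - b, -a,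
      -(1 + s x * Complex.I) - connCurv Z x (n₁ x) (n₂ x), ?_⟩
    have e2 := sub_eq_iff_eq_add.1 e1
    rw [← sub_eq_iff_eq_add'.2 e2]
    simp only [frameLift, ← Complex.coe_smul]
    push_cast
    module

/-- The second connection coefficient, expressed through the swapped frame. -/
theorem cov₂₁ (hx : x ∈ U) : cov Z (frameLift Z n₁) x (n₂ x) =
    (-conj (1 + s x * Complex.I)) • Z x + (-(frameConn Z n₂ n₁ x : ℂ)) • frameLift Z n₁ x := by
  rw [h.swap.cov₁₂ hx, conj_one_add_mul_I]
  rfl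

/-- There is no Z-component because E₁ is null, and constancy of ⟨E₁,E₂⟩ fixes the coefficient of E₁
from `cov₁₂`. Only the cubic coefficient is new. -/
theorem cov₁₁ (hx : x ∈ U) : cov Z (frameLift Z n₁) x (n₁ x) =
    (frameConn Z n₁ n₂ x : ℂ) • frameLift Z n₁ x + frameCubic Z n₁ n₂ x • frameLift Z n₂ x := by
  have hb := h.isNullBasis hx
  have e0 : _ = -normForm (Z x) (frameLift Z n₁ x) _ := h.normForm_cov_orth hx h.smooth₁ (n₁ x)
  rw [h.null₁ x hx, neg_zero] at e0
  have e2 := h.normForm_cov_pair hx (n₁ x)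
  rw [h.cov₁₂ hx, normForm_add_right, normForm_smul_right, normForm_smul_right, hb.orth₁',
    hb.pair] at e2
  have e3 : normForm (Z x) (frameLift Z n₂ x) (cov Z (frameLift Z n₁) x (n₁ x)) =
      -(frameConn Z n₁ n₂ x * conj (1 + s x * Complex.I)) := by
    have e4 : normForm (Z x) (cov Z (frameLift Z n₁) x (n₁ x)) (frameLift Z n₂ x) =
        -(frameConn Z n₁ n₂ x * (1 + s x * Complex.I)) := by rw [e2]; ring
    rw [← conj_normForm, e4, map_neg, map_mul, Complex.conj_ofReal]
  conv_lhs => rw [hb.expand (cov Z (frameLift Z n₁) x (n₁ x))]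
  rw [e0, e3, frameCubic, hb.pair, neg_zero, zero_smul, zero_add, neg_div, neg_neg,
    mul_div_cancel_right₀ _ hb.ne', div_neg]

theorem cov₂₂ (hx : x ∈ U) : cov Z (frameLift Z n₂) x (n₂ x) =
    (frameConn Z n₂ n₁ x : ℂ) • frameLift Z n₂ x + frameCubic Z n₂ n₁ x • frameLift Z n₁ x :=
  h.swap.cov₁₁ hx

/-- Coefficients are compared in `bracket_aux`. The Z-component of the left side is -(1+is) + (1-is)
= -2is. -/
theorem bracket_eq (hx : x ∈ U) : fderiv ℝ n₂ x (n₁ x) - fderiv ℝ n₁ x (n₂ x) =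
      frameConn Z n₂ n₁ x • n₁ x - frameConn Z n₁ n₂ x • n₂ x ∧
    connCurv Z x (n₁ x) (n₂ x) = -2 * s x * Complex.I := by
  have e1 := h.bracket_aux hx
  obtain ⟨a, b, e⟩ := h.span x hx (fderiv ℝ n₂ x (n₁ x) - fderiv ℝ n₁ x (n₂ x))
  rw [h.cov₁₂ hx, h.cov₂₁ hx, e, (cov Z Z x).map_add, (cov Z Z x).map_smul,
    (cov Z Z x).map_smul] at e1
  have e2 : (connCurv Z x (n₁ x) (n₂ x) - (-2 * s x * Complex.I)) • Z x +
      (a - frameConn Z n₂ n₁ x : ℂ) • frameLift Z n₁ x +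
      (b + frameConn Z n₁ n₂ x : ℂ) • frameLift Z n₂ x = 0 := by
    rw [conj_one_add_mul_I] at e1
    have e3 := sub_eq_zero.2 e1
    simp only [frameLift, ← Complex.coe_smul] at e3 ⊢
    rw [← neg_eq_zero, ← e3]
    push_cast
    module
  obtain ⟨h0, h1, h2⟩ := (h.isNullBasis hx).comb_eq_zero e2
  refine ⟨?_, sub_eq_zero.1 h0⟩
  have h1' : a = frameConn Z n₂ n₁ x := by exact_mod_cast sub_eq_zero.1 h1
  have h2' : b = -frameConn Z n₁ n₂ x := by exact_mod_cast eq_neg_of_add_eq_zero_left h2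
  rw [e, h1', h2']
  module

theorem frameCubic_mul (hx : x ∈ U) :
    (frameCubic Z n₁ n₂ x * (1 + s x * Complex.I)).re = 0 := by
  have hb := h.isNullBasis hx
  rw [frameCubic, hb.pair, div_neg, neg_mul, div_mul_cancel₀ _ hb.ne, Complex.neg_re,
    h.normForm_cov_null hx h.smooth₁ h.null₁, neg_zero]

/-- With v(1+is) and w(1-is) imaginary, their product vw(1+s²) is real. -/
theorem frameCubic_mul_im (hx : x ∈ U) : (frameCubic Z n₁ n₂ x * frameCubic Z n₂ n₁ x).im = 0 := by
  have h1 := h.frameCubic_mul hx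
  have h2 := h.swap.frameCubic_mul hx
  simp at h1 h2
  simp only [Complex.mul_im]
  linear_combination (frameCubic Z n₂ n₁ x).im * h1 + (frameCubic Z n₁ n₂ x).im * h2

/-- The compatibility conditions of the structure equations. -/
theorem compat (hx : x ∈ U) : s x = 0 ∧
    fderiv ℝ (frameCubic Z n₁ n₂) x (n₂ x) =
      -3 * frameConn Z n₂ n₁ x * frameCubic Z n₁ n₂ x := by
  have hn := h.isOpen.mem_nhds hx
  have d1 := h.differentiableAt_of_contDiffOn (h.contDiffOn_frameLift h.smooth₁) hx
  have d2 := h.differentiableAt_of_contDiffOn (h.contDiffOn_frameLift h.smooth₂) hx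
  have dZ := h.differentiableAt_of_contDiffOn h.smooth hx
  have dω1 : DifferentiableAt ℝ (fun y => (frameConn Z n₁ n₂ y : ℂ)) x :=
    Complex.ofRealCLM.differentiableAt.comp x
      (h.differentiableAt_of_contDiffOn h.contDiffOn_frameConn hx)
  have dω2 : DifferentiableAt ℝ (fun y => (-(frameConn Z n₂ n₁ y : ℂ))) x :=
    (Complex.ofRealCLM.differentiableAt.comp x
      (h.differentiableAt_of_contDiffOn h.swap.contDiffOn_frameConn hx)).neg
  have dv := h.differentiableAt_of_contDiffOn h.contDiffOn_frameCubic hx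
  have dc : HasFDerivAt (fun y => -conj (1 + s y * Complex.I : ℂ)) (0 : E →L[ℝ] ℂ) x := by
    have e1 := Complex.conjCLE.toContinuousLinearMap.hasFDerivAt.comp x (h.hasFDerivAt_pair hx)
    have e2 : (fun y => -conj (1 + s y * Complex.I : ℂ)) =
        Complex.conjCLE.toContinuousLinearMap ∘ fun y => -(1 + s y * Complex.I : ℂ) := by
      funext y
      exact (map_neg conj _).symm
    rw [e2]
    exact e1.congr_fderiv (by simp)
  have dcZ : DifferentiableAt ℝ (fun y => -conj (1 + s y * Complex.I : ℂ) • Z y) x :=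
    dc.differentiableAt.smul dZ
  have dωE1 : DifferentiableAt ℝ (fun y => (frameConn Z n₁ n₂ y : ℂ) • frameLift Z n₁ y) x :=
    dω1.smul d1
  have dωE2 : DifferentiableAt ℝ (fun y => (-(frameConn Z n₂ n₁ y : ℂ)) • frameLift Z n₁ y) x :=
    dω2.smul d1
  have dvE : DifferentiableAt ℝ (fun y => frameCubic Z n₁ n₂ y • frameLift Z n₂ y) x := dv.smul d2
  -- The Ricci identity for E₁ in the directions n₁, n₂; next all derivatives are replaced by means
  -- of the structure equations.
  have key := cov_cov_sub_field h.isOpen hx h.smooth (h.contDiffOn_frameLift h.smooth₁) h.neg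
    (h.differentiableAt_of_contDiffOn h.smooth₁ hx) (h.differentiableAt_of_contDiffOn h.smooth₂ hx)
  rw [cov_congr (Filter.eventually_of_mem hn fun y hy => h.cov₂₁ hy),
    cov_congr (Filter.eventually_of_mem hn fun y hy => h.cov₁₁ hy),
    cov_add dcZ dωE2, cov_add dωE1 dvE,
    cov_smul dc.differentiableAt dZ, cov_smul dω2 d1, cov_smul dω1 d1, cov_smul dv d2,
    (h.bracket_eq hx).1, (h.bracket_eq hx).2, map_sub, map_smul, map_smul, h.cov₁₁ hx, h.cov₂₁ hx,
    h.cov₂₂ hx, dc.fderiv] at key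
  have e : cov Z Z x (n₁ x) = frameLift Z n₁ x := rfl
  rw [e] at key
  set A := fderiv ℝ (fun y => (-(frameConn Z n₂ n₁ y : ℂ))) x (n₁ x) with hA
  set B := fderiv ℝ (fun y => (frameConn Z n₁ n₂ y : ℂ)) x (n₂ x) with hB
  have hAim : A.im = 0 := by
    rw [hA, fderiv_fun_neg, neg_apply, Complex.neg_im, fderiv_ofReal_im
      (h.differentiableAt_of_contDiffOn h.swap.contDiffOn_frameConn hx), neg_zero]
  have hBim : B.im = 0 :=
    fderiv_ofReal_im (h.differentiableAt_of_contDiffOn h.contDiffOn_frameConn hx) _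
  have e2 : (0 : ℂ) • Z x + (A - B - conj (1 + s x * Complex.I) -
      frameCubic Z n₁ n₂ x * frameCubic Z n₂ n₁ x - 2 * frameConn Z n₁ n₂ x * frameConn Z n₂ n₁ x
      + 2 * s x * Complex.I) • frameLift Z n₁ x + (-fderiv ℝ (frameCubic Z n₁ n₂) x (n₂ x)
      - 3 * frameConn Z n₂ n₁ x * frameCubic Z n₁ n₂ x) • frameLift Z n₂ x = 0 := by
    have e3 := sub_eq_zero.2 key
    simp only [← Complex.coe_smul, zero_apply] at e3
    rw [← e3]
    module
  obtain ⟨-, h1, h2⟩ := (h.isNullBasis hx).comb_eq_zero e2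
  constructor
  -- Here A, B, ω₁ω₂ and vw are real, so -conj(1+is) contributes s and the curvature term 2s. The
  -- imaginary part is 3s, which forces s = 0.
  · have h3 := congrArg Complex.im h1
    rw [conj_one_add_mul_I] at h3
    simp only [Complex.sub_im, Complex.add_im, hAim, hBim, h.frameCubic_mul_im hx] at h3
    simp at h3
    linarith
  · linear_combination -h2

end NullFrame
end NullFrame

/-! ### The Levi-Civita connection of the metric of a lift, and the equation of Gauss -/

section Gauss

variable {E : Type*} [NormedAddCommGroup E] [NormedSpace ℝ E]

/-- The metric on the domain of `Z` that is induced from the real part of the normalized form on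
horizontal lifts. -/
def liftMetric (Z : E → Fin 3 → ℂ) (x u v : E) : ℝ :=
  (normForm (Z x) (cov Z Z x u) (cov Z Z x v)).re

variable {Z : E → Fin 3 → ℂ} {U : Set E} {x : E} {g : E → E → E → ℝ}

theorem liftMetric_comm (Z : E → Fin 3 → ℂ) (x u v : E) :
    liftMetric Z x u v = liftMetric Z x v u := normForm_re_comm _ _ _

theorem liftMetric_add_left (Z : E → Fin 3 → ℂ) (x u v w : E) :
    liftMetric Z x (u + v) w = liftMetric Z x u w + liftMetric Z x v w := by
  simp [liftMetric, normForm_add_left]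

theorem liftMetric_smul_left (Z : E → Fin 3 → ℂ) (x : E) (r : ℝ) (u w : E) :
    liftMetric Z x (r • u) w = r * liftMetric Z x u w := by
  rw [liftMetric, map_smul, ← Complex.coe_smul, normForm_smul_left]
  simp [liftMetric]

theorem liftMetric_sub_left (Z : E → Fin 3 → ℂ) (x u v w : E) :
    liftMetric Z x (u - v) w = liftMetric Z x u w - liftMetric Z x v w := by
  simp [liftMetric, normForm_sub_left]

theorem liftMetric_zero_left (Z : E → Fin 3 → ℂ) (x w : E) : liftMetric Z x 0 w = 0 := by
  simp [liftMetric, normForm_zero_left]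

theorem liftMetric_add_right (Z : E → Fin 3 → ℂ) (x u v w : E) :
    liftMetric Z x u (v + w) = liftMetric Z x u v + liftMetric Z x u w := by
  rw [liftMetric_comm, liftMetric_add_left, liftMetric_comm, liftMetric_comm Z x w]

theorem liftMetric_smul_right (Z : E → Fin 3 → ℂ) (x : E) (r : ℝ) (u w : E) :
    liftMetric Z x u (r • w) = r * liftMetric Z x u w := by
  rw [liftMetric_comm, liftMetric_smul_left, liftMetric_comm]

theorem fderiv_re_normForm {ξ η : E → Fin 3 → ℂ} (hZ : DifferentiableAt ℝ Z x)
    (hξ : DifferentiableAt ℝ ξ x) (hη : DifferentiableAt ℝ η x)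
    (h : (hermForm (Z x) (Z x)).re < 0) (u : E) :
    fderiv ℝ (fun y => (normForm (Z y) (ξ y) (η y)).re) x u =
      (normForm (Z x) (cov Z ξ x u) (η x)).re + (normForm (Z x) (ξ x) (cov Z η x u)).re := by
  have h1 := Complex.reCLM.hasFDerivAt.comp x (differentiableAt_normForm hZ hξ hη h).hasFDerivAt
  have h2 : fderiv ℝ (fun y => (normForm (Z y) (ξ y) (η y)).re) x = _ := h1.fderiv
  rw [h2, ContinuousLinearMap.comp_apply, fderiv_normForm hZ hξ hη h, Complex.reCLM_apply,
    Complex.add_re]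

variable (hU : IsOpen U) (hZ : ContDiffOn ℝ ∞ Z U)
  (hneg : ∀ x ∈ U, (hermForm (Z x) (Z x)).re < 0)
include hU hZ hneg

theorem differentiableAt_cov_self (hx : x ∈ U) : DifferentiableAt ℝ (cov Z Z) x :=
  ((contDiffOn_cov hU hZ hZ hneg).contDiffAt (hU.mem_nhds hx)).differentiableAt (by simp)

theorem contDiffOn_cov_const (w : E) : ContDiffOn ℝ ∞ (fun y => cov Z Z y w) U :=
  (contDiffOn_cov hU hZ hZ hneg).clm_apply contDiffOn_const

theorem contDiffOn_cov_cov_const (v w : E) :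
    ContDiffOn ℝ ∞ (fun y => cov Z (fun y => cov Z Z y w) y v) U :=
  (contDiffOn_cov hU hZ (contDiffOn_cov_const hU hZ hneg w) hneg).clm_apply contDiffOn_const

theorem fderiv_liftMetric (hx : x ∈ U) (u v w : E) :
    fderiv ℝ (fun y => liftMetric Z y v w) x u =
      (normForm (Z x) (cov Z (fun y => cov Z Z y v) x u) (cov Z Z x w)).re +
      (normForm (Z x) (cov Z (fun y => cov Z Z y w) x u) (cov Z Z x v)).re := by
  have hn := hU.mem_nhds hx
  rw [normForm_re_comm _ (cov Z (fun y => cov Z Z y w) x u)]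
  exact fderiv_re_normForm ((hZ.contDiffAt hn).differentiableAt (by simp))
    (((contDiffOn_cov_const hU hZ hneg v).contDiffAt hn).differentiableAt (by simp))
    (((contDiffOn_cov_const hU hZ hneg w).contDiffAt hn).differentiableAt (by simp)) (hneg x hx) u

/-- The antisymmetric part of ∇∇Z is a multiple of Z, which is orthogonal to horizontal vectors. -/
theorem normForm_cov_cov_symm (hx : x ∈ U) (u v w : E) :
    normForm (Z x) (cov Z (fun y => cov Z Z y v) x u) (cov Z Z x w) =
      normForm (Z x) (cov Z (fun y => cov Z Z y u) x v) (cov Z Z x w) := by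
  have h1 := cov_cov_sub hU hx hZ hZ hneg u v
  rw [sub_eq_iff_eq_add.1 h1, normForm_add_left, normForm_smul_left,
    normForm_cov_self (hneg x hx), mul_zero, zero_add]

/-- Metric compatibility and the symmetry of ∇∇Z modulo Z turn the Koszul expression into twice the
pairing with the tangential part of ∇_u∇_vZ. Nondegeneracy then makes `Classical.epsilon` choose
exactly this vector. -/
theorem christoffel_eq (hg : ∀ y ∈ U, ∀ u v, g y u v = liftMetric Z y u v) (hx : x ∈ U)
    (hnd : ∀ y, (∀ w, liftMetric Z x y w = 0) → y = 0) {u v Γ : E}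
    (hΓ : ∀ w, liftMetric Z x Γ w =
      (normForm (Z x) (cov Z (fun y => cov Z Z y v) x u) (cov Z Z x w)).re) :
    christoffel g x u v = Γ := by
  have hn := hU.mem_nhds hx
  have hd : ∀ a b c : E, fderiv ℝ (fun y => g y b c) x a =
      (normForm (Z x) (cov Z (fun y => cov Z Z y b) x a) (cov Z Z x c)).re +
      (normForm (Z x) (cov Z (fun y => cov Z Z y c) x a) (cov Z Z x b)).re := by
    intro a b c
    rw [← fderiv_liftMetric hU hZ hneg hx]
    have : (fun y => g y b c) =ᶠ[nhds x] fun y => liftMetric Z y b c :=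
      Filter.eventually_of_mem hn fun y hy => hg y hy b c
    rw [this.fderiv_eq]
  have hK : ∀ w, fderiv ℝ (fun y => g y v w) x u + fderiv ℝ (fun y => g y u w) x v
      - fderiv ℝ (fun y => g y u v) x w = 2 * liftMetric Z x Γ w := by
    intro w
    rw [hd, hd, hd, hΓ, normForm_cov_cov_symm hU hZ hneg hx u w,
      normForm_cov_cov_symm hU hZ hneg hx v w, normForm_cov_cov_symm hU hZ hneg hx v u]
    ring
  have hsp : ∃ Γ : E, ∀ w : E, 2 * g x Γ w =
    fderiv ℝ (fun y => g y v w) x u + fderiv ℝ (fun y => g y u w) x v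
      - fderiv ℝ (fun y => g y u v) x w := ⟨Γ, fun w => by rw [hK, hg x hx]⟩
  have h1 := Classical.epsilon_spec hsp
  refine sub_eq_zero.1 (hnd _ fun w => ?_)
  have h2 := h1 w
  rw [hK, hg x hx] at h2
  rw [liftMetric_sub_left]
  have h3 : liftMetric Z x (christoffel g x u v) w = liftMetric Z x Γ w :=
    mul_left_cancel₀ two_ne_zero h2
  rw [h3, sub_self]

/-- The equation of Gauss. -/
theorem gauss_equation (hx : x ∈ U)
    (hΓ : ∀ u v, ∀ y ∈ U, ∀ w, liftMetric Z y (christoffel g y u v) w =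
      (normForm (Z y) (cov Z (fun y => cov Z Z y v) y u) (cov Z Z y w)).re)
    (hΓd : ∀ u v, DifferentiableAt ℝ (fun y => christoffel g y u v) x) (u v w k : E) :
    liftMetric Z x (curvature g x u v w) k =
      (normForm (Z x) (connCurv Z x u v • cov Z Z x w) (cov Z Z x k)).re +
      (normForm (Z x) (cov Z (fun y => cov Z Z y w) x v - cov Z Z x (christoffel g x v w))
        (cov Z (fun y => cov Z Z y k) x u)).re -
      (normForm (Z x) (cov Z (fun y => cov Z Z y w) x u - cov Z Z x (christoffel g x u w))
        (cov Z (fun y => cov Z Z y k) x v)).re := by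
  have hn := hU.mem_nhds hx
  have dZ : DifferentiableAt ℝ Z x := (hZ.contDiffAt hn).differentiableAt (by simp)
  have dC := differentiableAt_cov_self hU hZ hneg hx
  have dk : DifferentiableAt ℝ (fun y => cov Z Z y k) x :=
    ((contDiffOn_cov_const hU hZ hneg k).contDiffAt hn).differentiableAt (by simp)
  -- The derivative along u of the fact that the normal part of ∇_v∇_wZ is orthogonal to the tangent
  -- vector k.
  have key : ∀ u v : E,
      (normForm (Z x) (cov Z (fun y => cov Z (fun y => cov Z Z y w) y v) x u) (cov Z Z x k)).re -
        liftMetric Z x (christoffel g x u (christoffel g x v w)) k -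
        liftMetric Z x (fderiv ℝ (fun y => christoffel g y v w) x u) k +
        (normForm (Z x) (cov Z (fun y => cov Z Z y w) x v - cov Z Z x (christoffel g x v w))
          (cov Z (fun y => cov Z Z y k) x u)).re = 0 := by
    intro u v
    have d1 : DifferentiableAt ℝ (fun y => cov Z (fun y => cov Z Z y w) y v) x :=
      ((contDiffOn_cov_cov_const hU hZ hneg v w).contDiffAt hn).differentiableAt (by simp)
    have d2 : DifferentiableAt ℝ (fun y => cov Z Z y (christoffel g y v w)) x :=
      dC.clm_apply (hΓd v w)
    have d3 : DifferentiableAt ℝ (fun y => (-1 : ℂ) • cov Z Z y (christoffel g y v w)) x :=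
      d2.const_smul (-1 : ℂ)
    have hz : (fun y => (normForm (Z y) (cov Z (fun y => cov Z Z y w) y v +
        (-1 : ℂ) • cov Z Z y (christoffel g y v w)) (cov Z Z y k)).re) =ᶠ[nhds x] fun _ => 0 := by
      refine Filter.eventually_of_mem hn fun y hy => ?_
      have := hΓ v w y hy k
      rw [liftMetric] at this
      simp only [normForm_add_left, normForm_smul_left, Complex.add_re, this.symm]
      simp
    have dQ : DifferentiableAt ℝ (fun y => cov Z (fun y => cov Z Z y w) y v +
        (-1 : ℂ) • cov Z Z y (christoffel g y v w)) x := d1.add d3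
    have h1 := fderiv_re_normForm dZ dQ dk (hneg x hx) u
    rw [hz.fderiv_eq] at h1
    have h2 : cov Z (fun y => cov Z (fun y => cov Z Z y w) y v +
        (-1 : ℂ) • cov Z Z y (christoffel g y v w)) x u =
        cov Z (fun y => cov Z (fun y => cov Z Z y w) y v) x u -
        (cov Z (fun y => cov Z Z y (christoffel g x v w)) x u +
          cov Z Z x (fderiv ℝ (fun y => christoffel g y v w) x u)) := by
      have e1 := cov_add (Z := Z) d1 d3 u
      have e2 := cov_smul (Z := Z) (f := fun _ => (-1 : ℂ)) (differentiableAt_const _) d2 u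
      have e3 := cov_clm_apply (Z := Z) dC (hΓd v w) u
      rw [← e3]
      refine e1.trans ?_
      rw [e2]
      simp [sub_eq_add_neg]
    rw [h2] at h1
    simp only [fderiv_fun_const, Pi.zero_apply, zero_apply, normForm_sub_left, normForm_add_left,
      Complex.sub_re, Complex.add_re, ← hΓ u _ x hx k, normForm_smul_left] at h1
    simp only [normForm_sub_left, Complex.sub_re]
    rw [liftMetric, liftMetric] at *
    simp at h1
    linarith
  have k1 := key u v
  have k2 := key v u
  -- Antisymmetrizing in u, v leaves dω from the iterated covariant derivatives and the curvature
  -- from the Christoffel terms.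
  have h1 := cov_cov_sub hU hx hZ (contDiffOn_cov_const hU hZ hneg w) hneg u v
  rw [← h1, normForm_sub_left, Complex.sub_re, curvature, liftMetric_sub_left,
    liftMetric_add_left, liftMetric_add_left]
  linarith

end Gauss

namespace NullFrame

variable {E : Type*} [NormedAddCommGroup E] [NormedSpace ℝ E]
variable {Z : E → Fin 3 → ℂ} {U : Set E} {n₁ n₂ : E → E} {s : E → ℝ} {x : E}
  {g : E → E → E → ℝ} (h : NullFrame Z U n₁ n₂ s)
include h

theorem liftMetric₁₁ (hx : x ∈ U) : liftMetric Z x (n₁ x) (n₁ x) = 0 := by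
  have := h.null₁ x hx
  rw [frameLift] at this
  rw [liftMetric, this, Complex.zero_re]

theorem liftMetric₁₂ (hx : x ∈ U) : liftMetric Z x (n₁ x) (n₂ x) = -1 := by
  have := h.pair x hx
  rw [frameLift, frameLift] at this
  rw [liftMetric, this]
  simp

theorem liftMetric₂₁ (hx : x ∈ U) : liftMetric Z x (n₂ x) (n₁ x) = -1 := by
  rw [liftMetric_comm, h.liftMetric₁₂ hx]

theorem nondegenerate (hx : x ∈ U) {y : E} (hy : ∀ w, liftMetric Z x y w = 0) : y = 0 := by
  obtain ⟨a, b, rfl⟩ := h.span x hx y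
  have h1 := hy (n₁ x)
  have h2 := hy (n₂ x)
  rw [liftMetric_add_left, liftMetric_smul_left, liftMetric_smul_left] at h1 h2
  rw [h.liftMetric₁₁ hx, h.liftMetric₂₁ hx] at h1
  rw [h.liftMetric₁₂ hx, h.swap.liftMetric₁₁ hx] at h2
  have ha : a = 0 := by linarith
  have hb : b = 0 := by linarith
  simp [ha, hb]

/-- The Christoffel symbols in terms of a null frame. -/
theorem liftMetric_frame (hx : x ∈ U) (ξ : Fin 3 → ℂ) (w : E) :
    liftMetric Z x ((-(normForm (Z x) (frameLift Z n₂ x) ξ).re) • n₁ x +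
      (-(normForm (Z x) (frameLift Z n₁ x) ξ).re) • n₂ x) w =
    (normForm (Z x) ξ (cov Z Z x w)).re := by
  obtain ⟨a, b, rfl⟩ := h.span x hx w
  rw [normForm_re_comm _ ξ]
  simp only [liftMetric_add_left, liftMetric_smul_left, liftMetric_add_right,
    liftMetric_smul_right, h.liftMetric₁₁ hx, h.swap.liftMetric₁₁ hx, h.liftMetric₁₂ hx,
    h.liftMetric₂₁ hx, map_add, map_smul, ← Complex.coe_smul, normForm_add_left,
    normForm_smul_left, Complex.add_re, Complex.conj_ofReal, Complex.re_ofReal_mul, frameLift]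
  ring

theorem christoffel_eq (hg : ∀ y ∈ U, ∀ u v, g y u v = liftMetric Z y u v) (hx : x ∈ U) (u v : E) :
    christoffel g x u v =
      (-(normForm (Z x) (frameLift Z n₂ x) (cov Z (fun y => cov Z Z y v) x u)).re) • n₁ x +
      (-(normForm (Z x) (frameLift Z n₁ x) (cov Z (fun y => cov Z Z y v) x u)).re) • n₂ x :=
  _root_.christoffel_eq h.isOpen h.smooth h.neg hg hx (fun _ hy => h.nondegenerate hx hy)
    (h.liftMetric_frame hx _)

/-- `Classical.epsilon` carries no regularity by itself; the formula in the null frame supplies it.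
-/
theorem differentiableAt_christoffel (hg : ∀ y ∈ U, ∀ u v, g y u v = liftMetric Z y u v)
    (hx : x ∈ U) (u v : E) : DifferentiableAt ℝ (fun y => christoffel g y u v) x := by
  have he : (fun y => christoffel g y u v) =ᶠ[nhds x] _ :=
    Filter.eventually_of_mem (h.isOpen.mem_nhds hx) fun y hy => h.christoffel_eq hg hy u v
  refine DifferentiableAt.congr_of_eventuallyEq ?_ he
  have hc := contDiffOn_cov_cov_const h.isOpen h.smooth h.neg u v
  have d := fun (n : E → E) (hn : ContDiffOn ℝ ∞ n U) => Complex.reCLM.differentiableAt.comp x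
    (h.differentiableAt_of_contDiffOn (contDiffOn_normForm h.smooth (h.contDiffOn_frameLift hn) hc
      h.neg) hx)
  exact ((d n₂ h.smooth₂).neg.smul (h.differentiableAt_of_contDiffOn h.smooth₁ hx)).add
    ((d n₁ h.smooth₁).neg.smul (h.differentiableAt_of_contDiffOn h.smooth₂ hx))

/-- The normal part of the covariant derivative is determined modulo tangent vectors. -/
theorem normal_unique (hx : x ∈ U) {ξ η : Fin 3 → ℂ} {r : E} (e : ξ = η + cov Z Z x r)
    (hξ : ∀ w, (normForm (Z x) ξ (cov Z Z x w)).re = 0)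
    (hη : ∀ w, (normForm (Z x) η (cov Z Z x w)).re = 0) : ξ = η := by
  have : r = 0 := h.nondegenerate hx fun w => by
    have := hξ w
    rwa [e, normForm_add_left, Complex.add_re, hη, zero_add] at this
  rw [e, this, map_zero, add_zero]

theorem normal_smul (hx : x ∈ U) {ξ : Fin 3 → ℂ} (h1 : (normForm (Z x) ξ (frameLift Z n₁ x)).re = 0)
    (h2 : (normForm (Z x) ξ (frameLift Z n₂ x)).re = 0) (w : E) :
    (normForm (Z x) ξ (cov Z Z x w)).re = 0 := by
  obtain ⟨a, b, rfl⟩ := h.span x hx w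
  simp only [map_add, map_smul, ← Complex.coe_smul, normForm_add_right, normForm_smul_right,
    Complex.add_re, Complex.re_ofReal_mul]
  rw [frameLift] at h1 h2
  rw [h1, h2]
  simp

/-- In a flat minimal surface the cubic coefficients of a null frame are inverse to each other, up
to sign. -/
theorem frameCubic_mul_eq (hg : ∀ y ∈ U, ∀ u v, g y u v = liftMetric Z y u v) (hx : x ∈ U)
    (hR : ∀ u v w, curvature g x u v w = 0) :
    frameCubic Z n₁ n₂ x * frameCubic Z n₂ n₁ x = -1 := by
  have hs := (h.compat hx).1
  have hb := h.isNullBasis hx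
  have hΓ : ∀ u v, ∀ y ∈ U, ∀ w, liftMetric Z y (christoffel g y u v) w =
      (normForm (Z y) (cov Z (fun y => cov Z Z y v) y u) (cov Z Z y w)).re := by
    intro u v y hy w
    rw [h.christoffel_eq hg hy, h.liftMetric_frame hy]
  -- The equation of Gauss is stated for constant fields, so the frame vectors are frozen at x. The
  -- ambient term vanishes because s = 0.
  have hG := gauss_equation h.isOpen h.smooth h.neg hx hΓ
    (h.differentiableAt_christoffel hg hx) (n₁ x) (n₂ x) (n₁ x) (n₂ x)
  rw [hR, liftMetric_zero_left, (h.bracket_eq hx).2, hs] at hG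
  have hN : ∀ u v w, (normForm (Z x) (cov Z (fun y => cov Z Z y v) x u -
      cov Z Z x (christoffel g x u v)) (cov Z Z x w)).re = 0 := by
    intro u v w
    rw [normForm_sub_left, Complex.sub_re, ← hΓ u v x hx w, liftMetric, sub_self]
  -- Freezing the field n at x changes its covariant derivative only by a tangent vector.
  have hC : ∀ (n m : E → E), DifferentiableAt ℝ n x → cov Z (fun y => cov Z Z y (n x)) x (m x) =
      cov Z (frameLift Z n) x (m x) + cov Z Z x (-fderiv ℝ n x (m x)) := by
    intro n m hn
    have := cov_clm_apply (Z := Z) (differentiableAt_cov_self h.isOpen h.smooth h.neg hx) hn (m x)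
    rw [show frameLift Z n = fun y => cov Z Z y (n y) from rfl, this, map_neg]
    abel
  have d1 := h.differentiableAt_of_contDiffOn h.smooth₁ hx
  have d2 := h.differentiableAt_of_contDiffOn h.smooth₂ hx
  have c1 := h.frameCubic_mul hx
  have c2 := h.swap.frameCubic_mul hx
  simp only [hs, Pi.neg_apply] at c1 c2 hb
  simp at c1 c2 hb
  set v := frameCubic Z n₁ n₂ x
  set w := frameCubic Z n₂ n₁ x
  -- The normal part of ∇₁n₁. Since v is imaginary, vE₂ is orthogonal to the surface for the real
  -- metric.
  have q11 : cov Z (fun y => cov Z Z y (n₁ x)) x (n₁ x) -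
      cov Z Z x (christoffel g x (n₁ x) (n₁ x)) =
      v • frameLift Z n₂ x := by
    refine h.normal_unique hx (r := frameConn Z n₁ n₂ x • n₁ x - fderiv ℝ n₁ x (n₁ x) -
      christoffel g x (n₁ x) (n₁ x)) ?_ (hN _ _) (h.normal_smul hx ?_ ?_)
    · rw [hC n₁ n₁ d1, h.cov₁₁ hx]
      simp only [map_sub, map_smul, map_neg, ← Complex.coe_smul, frameLift, v]
      abel
    · simp [normForm_smul_left, hb.pair', c1]
    · simp [normForm_smul_left, hb.null₂]
  -- The mixed derivative has no normal part in the ambient plane, by minimality; what remains is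
  -- the radial vector -Z.
  have q12 : cov Z (fun y => cov Z Z y (n₁ x)) x (n₂ x) -
      cov Z Z x (christoffel g x (n₂ x) (n₁ x)) =
      (-1 : ℂ) • Z x := by
    refine h.normal_unique hx (r := -(frameConn Z n₂ n₁ x) • n₁ x - fderiv ℝ n₁ x (n₂ x) -
      christoffel g x (n₂ x) (n₁ x)) ?_ (hN _ _) (h.normal_smul hx ?_ ?_)
    · rw [hC n₁ n₂ d1, h.cov₂₁ hx, hs]
      simp only [map_sub, map_smul, map_neg, ← Complex.coe_smul, frameLift]
      simp
      abel
    · rw [normForm_smul_left, hb.orth₁, mul_zero, Complex.zero_re]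
    · rw [normForm_smul_left, hb.orth₂, mul_zero, Complex.zero_re]
  rw [q11, q12, hC n₂ n₁ d2, hC n₂ n₂ d2, h.cov₁₂ hx, h.cov₂₂ hx, hs] at hG
  have t1 : (normForm (Z x) (v • frameLift Z n₂ x)
      (cov Z Z x (-fderiv ℝ n₂ x (n₂ x)))).re = 0 := by
    rw [← q11]
    exact hN _ _ _
  rw [normForm_add_right _ _ _ (cov Z Z x (-fderiv ℝ n₂ x (n₂ x))), Complex.add_re, t1] at hG
  simp only [normForm_add_right, normForm_smul_right, normForm_smul_left, hb.self, hb.orth₂,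
    hb.null₂, hb.pair', normForm_cov_self (h.neg x hx)] at hG
  simp at hG
  rw [show frameCubic Z n₂ n₁ x = w from rfl, c1] at hG
  -- The equation of Gauss has become Re(v̄w) = 1, where the 1 comes from ⟨Z,Z⟩ = -1. As v and w are
  -- imaginary, vw = -1.
  apply Complex.ext
  · rw [Complex.mul_re, c1, c2]
    simp
    linarith
  · simp [h.frameCubic_mul_im hx, v, w]

end NullFrame

/-! ### Normalized null frames -/

namespace NullFrame

variable {E : Type*} [NormedAddCommGroup E] [NormedSpace ℝ E]
variable {Z : E → Fin 3 → ℂ} {U : Set E} {n₁ n₂ : E → E} {s : E → ℝ} {x : E}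
  {g : E → E → E → ℝ} (h : NullFrame Z U n₁ n₂ s)

theorem mono {V : Set E} (h : NullFrame Z U n₁ n₂ s) (hV : IsOpen V) (hVU : V ⊆ U) :
    NullFrame Z V n₁ n₂ s where
  isOpen := hV
  smooth := h.smooth.mono hVU
  neg x hx := h.neg x (hVU hx)
  smooth₁ := h.smooth₁.mono hVU
  smooth₂ := h.smooth₂.mono hVU
  null₁ x hx := h.null₁ x (hVU hx)
  null₂ x hx := h.null₂ x (hVU hx)
  pair x hx := h.pair x (hVU hx)
  angle x hx := h.angle x (hVU hx)
  span x hx := h.span x (hVU hx)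
  minimal x hx := h.minimal x (hVU hx)

theorem frameLift_smul (Z : E → Fin 3 → ℂ) (t : E → ℝ) (n : E → E) :
    frameLift Z (fun y => t y • n y) = fun y => (t y : ℂ) • frameLift Z n y := by
  funext y
  rw [frameLift, map_smul, Complex.coe_smul, frameLift]

include h

theorem cov_frameLift_smul {t : E → ℝ} {n : E → E} (hn : ContDiffOn ℝ ∞ n U)
    (ht : ContDiffOn ℝ ∞ t U) (hx : x ∈ U) (u : E) :
    cov Z (frameLift Z (fun y => t y • n y)) x u =
      fderiv ℝ (fun y => (t y : ℂ)) x u • frameLift Z n x +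
        (t x : ℂ) • cov Z (frameLift Z n) x u := by
  rw [frameLift_smul]
  exact cov_smul (Complex.ofRealCLM.differentiableAt.comp x
    (h.differentiableAt_of_contDiffOn ht hx))
    (h.differentiableAt_of_contDiffOn (h.contDiffOn_frameLift hn) hx) u

/-- A boost with factors t and 1/t preserves all pairings. The derivative of 1/t adds only a real
multiple of E₂ to ∇₁E₂, which the minimality condition allows. -/
theorem rescale {t : E → ℝ} (ht : ContDiffOn ℝ ∞ t U) (h0 : ∀ x ∈ U, t x ≠ 0) :
    NullFrame Z U (fun y => t y • n₁ y) (fun y => (t y)⁻¹ • n₂ y) s where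
  isOpen := h.isOpen
  smooth := h.smooth
  neg := h.neg
  smooth₁ := ht.smul h.smooth₁
  smooth₂ := (ht.inv h0).smul h.smooth₂
  null₁ x hx := by
    rw [frameLift_smul, normForm_smul_left,
    normForm_smul_right, h.null₁ x hx, mul_zero, mul_zero]
  null₂ x hx := by
    rw [frameLift_smul Z (fun y => (t y)⁻¹), normForm_smul_left, normForm_smul_right,
      h.null₂ x hx, mul_zero, mul_zero]
  pair x hx := by
    have : (t x : ℂ) ≠ 0 := Complex.ofReal_ne_zero.2 (h0 x hx)
    rw [frameLift_smul, frameLift_smul Z (fun y => (t y)⁻¹), normForm_smul_left,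
      normForm_smul_right, h.pair x hx, Complex.conj_ofReal, Complex.ofReal_inv,
      mul_inv_cancel_left₀ this]
  angle := h.angle
  span x hx u := by
    obtain ⟨a, b, e⟩ := h.span x hx u
    refine ⟨a * (t x)⁻¹, b * t x, ?_⟩
    rw [smul_smul, smul_smul, mul_assoc, mul_assoc, inv_mul_cancel₀ (h0 x hx),
      mul_inv_cancel₀ (h0 x hx), mul_one, mul_one, e]
  minimal x hx := by
    have hd : DifferentiableAt ℝ (fun y => (t y)⁻¹) x :=
      h.differentiableAt_of_contDiffOn (ht.inv h0) hx
    have e0 : (((t x)⁻¹ : ℝ) : ℂ) ≠ 0 := Complex.ofReal_ne_zero.2 (inv_ne_zero (h0 x hx))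
    have e1 : (t x : ℂ) ≠ 0 := Complex.ofReal_ne_zero.2 (h0 x hx)
    obtain ⟨a, b, l, e⟩ := h.minimal x hx
    have e2 : ∃ c : ℝ, fderiv ℝ (fun y => (((t y)⁻¹ : ℝ) : ℂ)) x (t x • n₁ x) = c :=
      ⟨_, Complex.ext rfl (by rw [fderiv_ofReal_im hd, Complex.ofReal_im])⟩
    obtain ⟨c, hc⟩ := e2
    refine ⟨a * (t x)⁻¹, c * t x + b * t x, l, ?_⟩
    rw [h.cov_frameLift_smul (t := fun y => (t y)⁻¹) h.smooth₂ (ht.inv h0) hx, hc, map_smul, e,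
      frameLift_smul, frameLift_smul Z (fun y => (t y)⁻¹), ← Complex.coe_smul]
    simp only [smul_add, smul_smul]
    push_cast
    have e3 : (t x : ℂ)⁻¹ * t x = 1 := inv_mul_cancel₀ e1
    have e4 : ((t x : ℂ)⁻¹ * (t x * l)) = l := by rw [← mul_assoc, e3, one_mul]
    have e5 : ((t x : ℂ)⁻¹ * (t x * a)) = a * (t x : ℂ)⁻¹ * t x := by
      rw [← mul_assoc, e3, mul_assoc, e3, one_mul, mul_one]
    have e6 : ((t x : ℂ)⁻¹ * (t x * b)) = b * (t x : ℂ) * (t x : ℂ)⁻¹ := by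
      field_simp
    have e7 : (c : ℂ) = c * (t x : ℂ) * (t x : ℂ)⁻¹ := by field_simp
    rw [e4, e5, e6, add_mul, ← e7]
    module

/-- The derivative of t contributes a multiple of E₁ alone, and this is invisible because E₁ is
null. So the coefficient transforms as a cubic form. -/
theorem frameCubic_rescale {t : E → ℝ} (ht : ContDiffOn ℝ ∞ t U) (h0 : ∀ x ∈ U, t x ≠ 0)
    (hx : x ∈ U) : frameCubic Z (fun y => t y • n₁ y) (fun y => (t y)⁻¹ • n₂ y) x =
      (t x : ℂ) ^ 3 * frameCubic Z n₁ n₂ x := by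
  have e1 : (t x : ℂ) ≠ 0 := Complex.ofReal_ne_zero.2 (h0 x hx)
  rw [frameCubic, frameCubic, h.cov_frameLift_smul h.smooth₁ ht hx, frameLift_smul,
    frameLift_smul Z (fun y => (t y)⁻¹)]
  simp only [map_smul, ← Complex.coe_smul, normForm_add_right, normForm_smul_left,
    normForm_smul_right, h.null₁ x hx,
    Complex.conj_ofReal, Complex.ofReal_inv]
  rw [inv_mul_cancel_left₀ e1]
  ring

/-- Around every point of a flat minimal surface there is a null frame whose cubic coefficients
are normalized. -/
theorem exists_normalized (hg : ∀ y ∈ U, ∀ u v, g y u v = liftMetric Z y u v)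
    (hR : ∀ x ∈ U, ∀ u v w, curvature g x u v w = 0) (hx : x ∈ U) :
    ∃ (V : Set E) (m₁ m₂ : E → E), V ⊆ U ∧ x ∈ V ∧ NullFrame Z V m₁ m₂ s ∧
      ∀ y ∈ V, frameCubic Z m₁ m₂ y = Complex.I := by
  have hre : ∀ y ∈ U, frameCubic Z n₁ n₂ y = (frameCubic Z n₁ n₂ y).im * Complex.I := by
    intro y hy
    have := h.frameCubic_mul hy
    rw [(h.compat hy).1] at this
    simp at this
    conv_lhs => rw [← Complex.re_add_im (frameCubic Z n₁ n₂ y), this]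
    simp
  -- The cubic coefficient vanishes nowhere because its product with the other one is -1.
  have hne : (frameCubic Z n₁ n₂ x).im ≠ 0 := by
    intro h0
    have := h.frameCubic_mul_eq hg hx (hR x hx)
    rw [hre x hx, h0] at this
    simp at this
  set β : E → ℝ := fun y => (frameCubic Z n₁ n₂ y).im with hβ
  have hβs : ContDiffOn ℝ ∞ β U := Complex.imCLM.contDiff.comp_contDiffOn h.contDiffOn_frameCubic
  -- The sign σ = ±1 makes σβ positive at x, hence on a neighbourhood.
  obtain ⟨σ, hσ, hσx⟩ : ∃ σ : ℝ, σ ^ 2 = 1 ∧ 0 < σ * β x := by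
    rcases lt_or_gt_of_ne hne with h1 | h1
    · exact ⟨-1, by norm_num, by simpa using h1⟩
    · exact ⟨1, by norm_num, by simpa using h1⟩
  have hσ0 : σ ≠ 0 := by rintro rfl; simp at hσ
  have hσβ : ContDiffOn ℝ ∞ (fun y => σ * β y) U := contDiffOn_const.mul hβs
  have hV : IsOpen (U ∩ (fun y => σ * β y) ⁻¹' Set.Ioi 0) :=
    hσβ.continuousOn.isOpen_inter_preimage h.isOpen isOpen_Ioi
  set V := U ∩ (fun y => σ * β y) ⁻¹' Set.Ioi 0
  have hVU : V ⊆ U := Set.inter_subset_left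
  have hpos : ∀ y ∈ V, 0 < σ * β y := fun y hy => hy.2
  -- The real cube root of 1/β, written through the logarithm of σβ so that it is visibly smooth.
  set t : E → ℝ := fun y => σ * Real.exp (-Real.log (σ * β y) / 3) with ht
  have hts : ContDiffOn ℝ ∞ t V := contDiffOn_const.mul
    ((((hσβ.mono hVU).log fun y hy => (hpos y hy).ne').neg.div_const 3).exp)
  have ht0 : ∀ y ∈ V, t y ≠ 0 := fun y _ => mul_ne_zero hσ0 (Real.exp_ne_zero _)
  have h' := h.mono hV hVU
  refine ⟨V, _, _, hVU, ⟨hx, hσx⟩, h'.rescale hts ht0, fun y hy => ?_⟩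
  rw [h'.frameCubic_rescale hts ht0 hy, hre y (hVU hy), ← Complex.ofReal_pow, ← mul_assoc,
    ← Complex.ofReal_mul]
  have : t y ^ 3 * β y = 1 := by
    have e1 : Real.exp (-Real.log (σ * β y) / 3) ^ 3 = (σ * β y)⁻¹ := by
      rw [← Real.exp_nat_mul]
      push_cast
      rw [mul_div_cancel₀ _ (three_ne_zero), Real.exp_neg, Real.exp_log (hpos y hy)]
    rw [ht]
    simp only [mul_pow, e1]
    have := (hpos y hy).ne'
    have hb : β y ≠ 0 := right_ne_zero_of_mul this
    field_simp
    rw [hσ]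
  rw [this]
  simp

end NullFrame

/-! ### The linear system of a flat minimal Lagrangian surface -/

section FrameSystem

variable {E : Type*} [NormedAddCommGroup E] [NormedSpace ℝ E]

/-- The linear system `F_X = F₁`, `F_Y = F₂`, `(F₁)_X = iF₂`, `(F₁)_Y = (F₂)_X = -F`, `(F₂)_Y = iF₁`
satisfied by a horizontal lift `F` of a flat minimal Lagrangian surface in normalized null
coordinates `X`, `Y`. -/
structure FrameSystem (K : Set E) (X Y : E → ℝ) (F F₁ F₂ : E → Fin 3 → ℂ) : Prop where
  diff : ∀ x ∈ K, DifferentiableAt ℝ F x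
  diff₁ : ∀ x ∈ K, DifferentiableAt ℝ F₁ x
  diff₂ : ∀ x ∈ K, DifferentiableAt ℝ F₂ x
  eq : ∀ x ∈ K, ∀ u, fderiv ℝ F x u =
    (fderiv ℝ X x u : ℂ) • F₁ x + (fderiv ℝ Y x u : ℂ) • F₂ x
  eq₁ : ∀ x ∈ K, ∀ u, fderiv ℝ F₁ x u =
    (fderiv ℝ X x u * Complex.I) • F₂ x - (fderiv ℝ Y x u : ℂ) • F x
  eq₂ : ∀ x ∈ K, ∀ u, fderiv ℝ F₂ x u =
    (fderiv ℝ Y x u * Complex.I) • F₁ x - (fderiv ℝ X x u : ℂ) • F x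

/-- The exponents of the solutions of the linear system. -/
structure IsFrameExponent (μ ν : ℂ) : Prop where
  mul : μ * ν = -1
  sq_left : μ ^ 2 = Complex.I * ν
  sq_right : ν ^ 2 = Complex.I * μ

theorem sqrt_three_half_sq : ((√3 / 2 : ℝ) : ℂ) ^ 2 = 3 / 4 := by
  rw [← Complex.ofReal_pow, div_pow, Real.sq_sqrt (by norm_num)]
  norm_num

/-- The relations amount to μ³ = -i and ν = -1/μ. The three cube roots of -i are i and -i/2 ± √3/2,
and μ ↦ ν fixes the first and exchanges the other two. -/
theorem isFrameExponent_I : IsFrameExponent Complex.I Complex.I :=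
  ⟨by simp, by ring, by ring⟩

theorem isFrameExponent_sqrt :
    IsFrameExponent (-(Complex.I / 2) + (√3 / 2 : ℝ)) (-(Complex.I / 2) - (√3 / 2 : ℝ)) := by
  have h1 := sqrt_three_half_sq
  have h2 := Complex.I_sq
  refine ⟨?_, ?_, ?_⟩
  · linear_combination (1 / 4) * h2 - h1
  · linear_combination (3 / 4) * h2 + h1
  · linear_combination (3 / 4) * h2 + h1

theorem IsFrameExponent.symm {μ ν : ℂ} (h : IsFrameExponent μ ν) : IsFrameExponent ν μ :=
  ⟨by rw [mul_comm, h.mul], h.sq_right, h.sq_left⟩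

namespace FrameSystem

variable {K : Set E} {X Y : E → ℝ} {F F₁ F₂ G G₁ G₂ : E → Fin 3 → ℂ}

theorem add (h : FrameSystem K X Y F F₁ F₂) (h' : FrameSystem K X Y G G₁ G₂) :
    FrameSystem K X Y (F + G) (F₁ + G₁) (F₂ + G₂) where
  diff x hx := (h.diff x hx).add (h'.diff x hx)
  diff₁ x hx := (h.diff₁ x hx).add (h'.diff₁ x hx)
  diff₂ x hx := (h.diff₂ x hx).add (h'.diff₂ x hx)
  eq x hx u := by
    rw [fderiv_add (h.diff x hx) (h'.diff x hx), add_apply, h.eq x hx, h'.eq x hx]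
    simp only [Pi.add_apply]
    module
  eq₁ x hx u := by
    rw [fderiv_add (h.diff₁ x hx) (h'.diff₁ x hx), add_apply, h.eq₁ x hx, h'.eq₁ x hx]
    simp only [Pi.add_apply]
    module
  eq₂ x hx u := by
    rw [fderiv_add (h.diff₂ x hx) (h'.diff₂ x hx), add_apply, h.eq₂ x hx, h'.eq₂ x hx]
    simp only [Pi.add_apply]
    module

theorem fderiv_linearMap_comp (A : (Fin 3 → ℂ) →ₗ[ℂ] (Fin 3 → ℂ)) {x : E}
    (h : DifferentiableAt ℝ F x) : DifferentiableAt ℝ (fun y => A (F y)) x ∧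
      ∀ u, fderiv ℝ (fun y => A (F y)) x u = A (fderiv ℝ F x u) := by
  set B := LinearMap.toContinuousLinearMap (A.restrictScalars ℝ)
  have h1 := B.hasFDerivAt.comp x h.hasFDerivAt
  have h2 : HasFDerivAt (fun y => A (F y)) _ x := h1
  exact ⟨h2.differentiableAt, fun u => by rw [h2.fderiv]; rfl⟩

/-- The image of a solution under a complex linear map. -/
theorem map (h : FrameSystem K X Y F F₁ F₂) (A : (Fin 3 → ℂ) →ₗ[ℂ] (Fin 3 → ℂ)) :
    FrameSystem K X Y (fun y => A (F y)) (fun y => A (F₁ y)) (fun y => A (F₂ y)) where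
  diff x hx := (fderiv_linearMap_comp A (h.diff x hx)).1
  diff₁ x hx := (fderiv_linearMap_comp A (h.diff₁ x hx)).1
  diff₂ x hx := (fderiv_linearMap_comp A (h.diff₂ x hx)).1
  eq x hx u := by
    rw [(fderiv_linearMap_comp A (h.diff x hx)).2, h.eq x hx, map_add, map_smul, map_smul]
  eq₁ x hx u := by
    rw [(fderiv_linearMap_comp A (h.diff₁ x hx)).2, h.eq₁ x hx, map_sub, map_smul, map_smul]
  eq₂ x hx u := by
    rw [(fderiv_linearMap_comp A (h.diff₂ x hx)).2, h.eq₂ x hx, map_sub, map_smul, map_smul]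

/-- The system only depends on the differentials of the coordinates. -/
theorem congr_coord {X' Y' : E → ℝ} (h : FrameSystem K X Y F F₁ F₂)
    (hX : ∀ x ∈ K, fderiv ℝ X' x = fderiv ℝ X x) (hY : ∀ x ∈ K, fderiv ℝ Y' x = fderiv ℝ Y x) :
    FrameSystem K X' Y' F F₁ F₂ where
  diff := h.diff
  diff₁ := h.diff₁
  diff₂ := h.diff₂
  eq x hx u := by rw [hX x hx, hY x hx, h.eq x hx]
  eq₁ x hx u := by rw [hX x hx, hY x hx, h.eq₁ x hx]
  eq₂ x hx u := by rw [hX x hx, hY x hx, h.eq₂ x hx]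

theorem swap (h : FrameSystem K X Y F F₁ F₂) : FrameSystem K Y X F F₂ F₁ :=
  ⟨h.diff, h.diff₂, h.diff₁, fun x hx u => by rw [h.eq x hx, add_comm], h.eq₂, h.eq₁⟩

theorem hasFDerivAt_exp {μ ν : ℂ} {x : E} (hX : DifferentiableAt ℝ X x)
    (hY : DifferentiableAt ℝ Y x) : HasFDerivAt (fun y => Complex.exp (μ * X y + ν * Y y))
      (Complex.exp (μ * X x + ν * Y x) • (μ • Complex.ofRealCLM.comp (fderiv ℝ X x) +
        ν • Complex.ofRealCLM.comp (fderiv ℝ Y x))) x := by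
  have h1 := ((Complex.ofRealCLM.hasFDerivAt.comp x hX.hasFDerivAt).const_mul μ).add
    ((Complex.ofRealCLM.hasFDerivAt.comp x hY.hasFDerivAt).const_mul ν)
  exact h1.cexp

theorem exp {μ ν : ℂ} (h : IsFrameExponent μ ν) (hX : ∀ x ∈ K, DifferentiableAt ℝ X x)
    (hY : ∀ x ∈ K, DifferentiableAt ℝ Y x) (v : Fin 3 → ℂ) :
    FrameSystem K X Y (fun y => Complex.exp (μ * X y + ν * Y y) • v)
      (fun y => Complex.exp (μ * X y + ν * Y y) • μ • v)
      (fun y => Complex.exp (μ * X y + ν * Y y) • ν • v) := by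
  have hd : ∀ x ∈ K, ∀ w : Fin 3 → ℂ,
      DifferentiableAt ℝ (fun y => Complex.exp (μ * X y + ν * Y y) • w) x ∧
      ∀ u, fderiv ℝ (fun y => Complex.exp (μ * X y + ν * Y y) • w) x u =
        (Complex.exp (μ * X x + ν * Y x) * (μ * fderiv ℝ X x u + ν * fderiv ℝ Y x u)) • w := by
    intro x hx w
    have h1 := (hasFDerivAt_exp (μ := μ) (ν := ν) (hX x hx) (hY x hx)).smul_const w
    refine ⟨h1.differentiableAt, fun u => ?_⟩
    rw [h1.fderiv]
    simp [mul_add]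
  refine ⟨fun x hx => (hd x hx _).1, fun x hx => (hd x hx _).1, fun x hx => (hd x hx _).1,
    fun x hx u => ?_, fun x hx u => ?_, fun x hx u => ?_⟩
  · rw [(hd x hx _).2]
    module
  · rw [(hd x hx _).2]
    simp only [smul_smul, ← sub_smul]
    congr 1
    linear_combination (Complex.exp (μ * X x + ν * Y x)) *
      ((fderiv ℝ X x u : ℂ) * h.sq_left + (fderiv ℝ Y x u : ℂ) * h.mul)
  · rw [(hd x hx _).2]
    simp only [smul_smul, ← sub_smul]
    congr 1
    linear_combination (Complex.exp (μ * X x + ν * Y x)) *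
      ((fderiv ℝ Y x u : ℂ) * h.sq_right + (fderiv ℝ X x u : ℂ) * h.mul)

/-- A linear combination of the components of a solution that evolves exponentially. -/
theorem component_eq_zero (h : FrameSystem K X Y F F₁ F₂) (hK : IsOpen K) (hc : Convex ℝ K)
    (hX : ∀ x ∈ K, DifferentiableAt ℝ X x) (hY : ∀ x ∈ K, DifferentiableAt ℝ Y x)
    {μ ν : ℂ} (hμ : IsFrameExponent μ ν) {x₀ x : E} (hx₀ : x₀ ∈ K) (hx : x ∈ K)
    (h0 : F x₀ = 0) (h1 : F₁ x₀ = 0) (h2 : F₂ x₀ = 0) : F x - ν • F₁ x - μ • F₂ x = 0 := by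
  -- The combination G = F - νF₁ - μF₂ satisfies dG = (μ dX + ν dY)G, so the inverse exponential
  -- makes it constant.
  set S : E → Fin 3 → ℂ := fun y =>
    Complex.exp (-μ * X y + -ν * Y y) • (F y - ν • F₁ y - μ • F₂ y) with hS
  have hd : ∀ y ∈ K, HasFDerivAt S (0 : E →L[ℝ] (Fin 3 → ℂ)) y := by
    intro y hy
    have e1 := hasFDerivAt_exp (μ := -μ) (ν := -ν) (hX y hy) (hY y hy)
    have d1 : HasFDerivAt (fun y => ν • F₁ y) (ν • fderiv ℝ F₁ y) y :=
      (h.diff₁ y hy).hasFDerivAt.const_smul ν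
    have d2 : HasFDerivAt (fun y => μ • F₂ y) (μ • fderiv ℝ F₂ y) y :=
      (h.diff₂ y hy).hasFDerivAt.const_smul μ
    have e2 : HasFDerivAt (fun y => F y - ν • F₁ y - μ • F₂ y) _ y :=
      ((h.diff y hy).hasFDerivAt.sub d1).sub d2
    have e3 : HasFDerivAt S _ y := e1.smul e2
    refine e3.congr_fderiv ?_
    ext1 u
    simp only [add_apply, sub_apply, smul_apply, ContinuousLinearMap.smulRight_apply, h.eq y hy,
      h.eq₁ y hy, h.eq₂ y hy, ContinuousLinearMap.comp_apply, Complex.ofRealCLM_apply, zero_apply]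
    rw [smul_assoc, ← smul_add]
    refine smul_eq_zero_of_right _ ?_
    have m1 := hμ.mul
    have m2 := hμ.sq_left
    have m3 := hμ.sq_right
    funext k
    simp only [Pi.add_apply, Pi.sub_apply, Pi.smul_apply, smul_eq_mul, Pi.zero_apply]
    generalize (fderiv ℝ X y u : ℂ) = a
    generalize (fderiv ℝ Y y u : ℂ) = b
    linear_combination (a * F₁ y k + b * F₂ y k) * m1 + (a * F₂ y k) * m2 + (b * F₁ y k) * m3
  obtain hcst := hK.is_const_of_fderiv_eq_zero hc.isPreconnected
    (fun y hy => (hd y hy).differentiableAt.differentiableWithinAt)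
    (fun y hy => (hd y hy).fderiv) hx hx₀
  rw [hS] at hcst
  simp only [h0, h1, h2, smul_zero, sub_zero, smul_eq_zero, Complex.exp_ne_zero, false_or] at hcst
  exact hcst

/-- The three values of μ sum to zero, and so do the three values of ν. Adding the three vanishing
combinations of `component_eq_zero` therefore leaves 3F. -/
theorem eq_zero (h : FrameSystem K X Y F F₁ F₂) (hK : IsOpen K) (hc : Convex ℝ K)
    (hX : ∀ x ∈ K, DifferentiableAt ℝ X x) (hY : ∀ x ∈ K, DifferentiableAt ℝ Y x)
    {x₀ x : E} (hx₀ : x₀ ∈ K) (hx : x ∈ K)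
    (h0 : F x₀ = 0) (h1 : F₁ x₀ = 0) (h2 : F₂ x₀ = 0) : F x = 0 := by
  have e1 := h.component_eq_zero hK hc hX hY isFrameExponent_I hx₀ hx h0 h1 h2
  have e2 := h.component_eq_zero hK hc hX hY isFrameExponent_sqrt hx₀ hx h0 h1 h2
  have e3 := h.component_eq_zero hK hc hX hY isFrameExponent_sqrt.symm hx₀ hx h0 h1 h2
  have e4 : (3 : ℂ) • F x = 0 := by
    have := congrArg₂ (· + ·) (congrArg₂ (· + ·) e1 e2) e3
    simp only [add_zero] at this
    rw [← this]
    module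
  exact (smul_eq_zero.1 e4).resolve_left three_ne_zero

/-- Uniqueness of solutions with given initial values. -/
theorem unique (h : FrameSystem K X Y F F₁ F₂) (h' : FrameSystem K X Y G G₁ G₂) (hK : IsOpen K)
    (hc : Convex ℝ K) (hX : ∀ x ∈ K, DifferentiableAt ℝ X x)
    (hY : ∀ x ∈ K, DifferentiableAt ℝ Y x) {x₀ x : E} (hx₀ : x₀ ∈ K) (hx : x ∈ K)
    (h0 : F x₀ = G x₀) (h1 : F₁ x₀ = G₁ x₀) (h2 : F₂ x₀ = G₂ x₀) : F x = G x := by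
  have e := (h.add (h'.map (-1 : (Fin 3 → ℂ) →ₗ[ℂ] (Fin 3 → ℂ)))).eq_zero hK hc hX hY hx₀ hx
    (by simp [h0]) (by simp [h1]) (by simp [h2])
  simpa [← sub_eq_add_neg, sub_eq_zero] using e

end FrameSystem
end FrameSystem

/-! ### Unitary maps between null bases -/

/-- Two null bases with the same Gram matrix are related by a unitary map. -/
theorem IsNullBasis.exists_unitary {Z e₁ e₂ Z' e₁' e₂' : Fin 3 → ℂ} {c : ℂ}
    (h : IsNullBasis Z e₁ e₂ c) (h' : IsNullBasis Z' e₁' e₂' c) (hZ : hermForm Z Z = -1)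
    (hZ' : hermForm Z' Z' = -1) :
    ∃ A : HermUnitary, A.1 Z = Z' ∧ A.1 e₁ = e₁' ∧ A.1 e₂ = e₂' := by
  set A := h.basis.equiv h'.basis (Equiv.refl _)
  have hA : ∀ k, A (![Z, e₁, e₂] k) = ![Z', e₁', e₂'] k := by
    intro k
    rw [← h.basis_apply, ← h'.basis_apply]
    simp [A]
  have h0 : A Z = Z' := hA 0
  have h1 : A e₁ = e₁' := hA 1
  have h2 : A e₂ = e₂' := hA 2
  have hn : ∀ {Z : Fin 3 → ℂ}, hermForm Z Z = -1 → ∀ x y, normForm Z x y = hermForm x y := by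
    intro Z hZ x y
    simp [normForm, hZ]
  refine ⟨⟨A, fun z w => ?_⟩, h0, h1, h2⟩
  obtain ⟨a, b, d, rfl⟩ := h.exists_comb z
  obtain ⟨a', b', d', rfl⟩ := h.exists_comb w
  simp only [map_add, map_smul, h0, h1, h2, ← hn hZ]
  rw [hn hZ, ← hn hZ']
  simp only [normForm_add_left, normForm_smul_left, h.normForm_comb₀, h.normForm_comb₁,
    h.normForm_comb₂, h'.normForm_comb₀, h'.normForm_comb₁, h'.normForm_comb₂]

/-! ### The explicit surface -/

/-- The first exponent of the explicit surface. -/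
def tildeExp₁ : ℂ := -(Complex.I / 2) + (√3 / 2 : ℝ)

/-- The second exponent of the explicit surface. -/
def tildeExp₂ : ℂ := -(Complex.I / 2) - (√3 / 2 : ℝ)

/-- The vectors obtained from the exponential components of `tildeLVec 1` by multiplying them
by constants. -/
def tildeVec (α β γ : ℂ) (x y : ℝ) : Fin 3 → ℂ :=
  ((1 / √3 : ℝ) : ℂ) •
    ![((√2 : ℝ) : ℂ) * ((α * Complex.exp (tildeExp₁ * x + tildeExp₂ * y) +
        β * Complex.exp (tildeExp₂ * x + tildeExp₁ * y)) / 2),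
      γ * Complex.exp (Complex.I * x + Complex.I * y),
      ((√2 : ℝ) : ℂ) * ((α * Complex.exp (tildeExp₁ * x + tildeExp₂ * y) -
        β * Complex.exp (tildeExp₂ * x + tildeExp₁ * y)) / 2)]

/-- Writing cosh and sinh through exponentials exhibits the three exponential solutions of the
linear system, with x, y as the normalized null coordinates. -/
theorem tildeLVec_one (x y : ℝ) : tildeLVec 1 x y = tildeVec 1 1 1 x y := by
  have e1 : Complex.exp (tildeExp₁ * x + tildeExp₂ * y) =
      Complex.exp (-(Complex.I / (2 * (1 : ℝ))) * (x + (1 : ℝ) ^ 2 * y)) *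
        Complex.exp ((√3 / (2 * 1) * (x - 1 ^ 2 * y) : ℝ)) := by
    rw [← Complex.exp_add]
    congr 1
    simp only [tildeExp₁, tildeExp₂]
    push_cast
    ring
  have e2 : Complex.exp (tildeExp₂ * x + tildeExp₁ * y) =
      Complex.exp (-(Complex.I / (2 * (1 : ℝ))) * (x + (1 : ℝ) ^ 2 * y)) *
        Complex.exp (-(√3 / (2 * 1) * (x - 1 ^ 2 * y) : ℝ)) := by
    rw [← Complex.exp_add]
    congr 1
    simp only [tildeExp₁, tildeExp₂]
    push_cast
    ring
  have e3 : Complex.I * ((1 : ℝ) * y + x / (1 : ℝ)) = Complex.I * x + Complex.I * y := by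
    push_cast
    ring
  rw [tildeLVec, tildeVec, e1, e2, e3, Complex.ofReal_cosh, Complex.ofReal_sinh, Complex.cosh,
    Complex.sinh]
  congr 1
  funext k
  fin_cases k
  · simp
    ring
  · simp
  · simp
    ring

theorem conj_tildeExp₁ : conj tildeExp₁ = -tildeExp₂ := by
  simp only [tildeExp₁, tildeExp₂, map_add, map_neg, map_div₀, Complex.conj_I,
    Complex.conj_ofReal, map_ofNat]
  ring

theorem conj_tildeExp₂ : conj tildeExp₂ = -tildeExp₁ := by
  rw [← neg_eq_iff_eq_neg, ← map_neg, ← conj_tildeExp₁, Complex.conj_conj]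

/-- Conjugation sends each of the two exponents with nonzero real part to the negative of the other,
and i to -i. In b the two real exponentials only meet crosswise, so all dependence on x, y cancels.
-/
theorem hermForm_tildeVec (α β γ α' β' γ' : ℂ) (x y : ℝ) :
    hermForm (tildeVec α β γ x y) (tildeVec α' β' γ' x y) =
      -(conj α * β' + conj β * α' + conj γ * γ') / 3 := by
  have h2 : ((√2 : ℝ) : ℂ) * ((√2 : ℝ) : ℂ) = 2 := by
    rw [← Complex.ofReal_mul, Real.mul_self_sqrt (by norm_num)]; norm_num
  have h3 : ((1 / √3 : ℝ) : ℂ) * ((1 / √3 : ℝ) : ℂ) = 1 / 3 := by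
    rw [← Complex.ofReal_mul, div_mul_div_comm, Real.mul_self_sqrt (by norm_num)]; norm_num
  have f1 : conj (Complex.exp (tildeExp₁ * x + tildeExp₂ * y)) *
      Complex.exp (tildeExp₂ * x + tildeExp₁ * y) = 1 := by
    rw [← Complex.exp_conj, ← Complex.exp_add]
    simp only [map_add, map_mul, conj_tildeExp₁, conj_tildeExp₂, Complex.conj_ofReal]
    rw [← Complex.exp_zero]
    ring_nf
  have f2 : conj (Complex.exp (tildeExp₂ * x + tildeExp₁ * y)) *
      Complex.exp (tildeExp₁ * x + tildeExp₂ * y) = 1 := by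
    rw [← Complex.exp_conj, ← Complex.exp_add]
    simp only [map_add, map_mul, conj_tildeExp₁, conj_tildeExp₂, Complex.conj_ofReal]
    rw [← Complex.exp_zero]
    ring_nf
  have f3 : conj (Complex.exp (Complex.I * x + Complex.I * y)) *
      Complex.exp (Complex.I * x + Complex.I * y) = 1 := by
    rw [← Complex.exp_conj, ← Complex.exp_add]
    simp only [map_add, map_mul, Complex.conj_I, Complex.conj_ofReal]
    rw [← Complex.exp_zero]
    ring_nf
  rw [tildeVec, tildeVec, hermForm_smul_smul, Complex.conj_ofReal, h3]
  generalize Complex.exp (tildeExp₁ * x + tildeExp₂ * y) = a at *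
  generalize Complex.exp (tildeExp₂ * x + tildeExp₁ * y) = b at *
  generalize Complex.exp (Complex.I * x + Complex.I * y) = c at *
  simp only [hermForm, Matrix.cons_val_zero, Matrix.cons_val_one, Matrix.cons_val, map_mul,
    Complex.conj_ofReal, map_add, map_sub, map_div₀, map_ofNat]
  linear_combination (-(1 / 3 : ℂ)) * (conj α * β' * f1 + conj β * α' * f2 + conj γ * γ' * f3) -
    (1 / 6) * (conj α * β' * (conj a * b) + conj β * α' * (conj b * a)) * h2

theorem isFrameExponent_tilde : IsFrameExponent tildeExp₁ tildeExp₂ := isFrameExponent_sqrt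

theorem tildeExp_add : tildeExp₁ + tildeExp₂ = -Complex.I := by
  simp only [tildeExp₁, tildeExp₂]
  ring

theorem hermForm_tildeVec_one (x y : ℝ) :
    hermForm (tildeVec 1 1 1 x y) (tildeVec 1 1 1 x y) = -1 := by
  rw [hermForm_tildeVec]
  norm_num

/-- The frame of the explicit surface. -/
theorem isNullBasis_tildeVec (x y : ℝ) : IsNullBasis (tildeVec 1 1 1 x y)
    (tildeVec tildeExp₁ tildeExp₂ Complex.I x y)
    (tildeVec tildeExp₂ tildeExp₁ Complex.I x y) 1 := by
  have hn : ∀ z w, normForm (tildeVec 1 1 1 x y) z w = hermForm z w := by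
    intro z w
    simp [normForm, hermForm_tildeVec_one]
  have m1 := isFrameExponent_tilde.mul
  have m2 := isFrameExponent_tilde.sq_left
  have m3 := isFrameExponent_tilde.sq_right
  have m4 := tildeExp_add
  have m5 := Complex.I_sq
  refine ⟨by simp [hermForm_tildeVec_one], one_ne_zero, ?_, ?_, ?_, ?_, ?_⟩ <;>
  rw [hn, hermForm_tildeVec] <;>
  simp only [conj_tildeExp₁, conj_tildeExp₂, map_one, Complex.conj_I]
  · linear_combination (-1 / 3) * m4
  · linear_combination (-1 / 3) * m4
  · linear_combination (1 / 3) * m2 + (1 / 3) * m3 + (1 / 3) * Complex.I * m4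
  · linear_combination (1 / 3) * m2 + (1 / 3) * m3 + (1 / 3) * Complex.I * m4
  · linear_combination (2 / 3) * m1 + (1 / 3) * m5

section system
variable {E : Type*} [NormedAddCommGroup E] [NormedSpace ℝ E]

/-- The explicit surface solves the linear system. -/
theorem frameSystem_tildeVec {K : Set E} {X Y : E → ℝ} (hX : ∀ x ∈ K, DifferentiableAt ℝ X x)
    (hY : ∀ x ∈ K, DifferentiableAt ℝ Y x) :
    FrameSystem K X Y (fun x => tildeVec 1 1 1 (X x) (Y x))
      (fun x => tildeVec tildeExp₁ tildeExp₂ Complex.I (X x) (Y x))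
      (fun x => tildeVec tildeExp₂ tildeExp₁ Complex.I (X x) (Y x)) := by
  -- One constant vector for each exponent. The two real exponentials have equal coefficients in the
  -- cosh entry and opposite ones in the sinh entry.
  have h1 := FrameSystem.exp isFrameExponent_tilde hX hY
    (((1 / √3 : ℝ) : ℂ) • ![((√2 : ℝ) : ℂ) / 2, 0, ((√2 : ℝ) : ℂ) / 2])
  have h2 := FrameSystem.exp isFrameExponent_tilde.symm hX hY
    (((1 / √3 : ℝ) : ℂ) • ![((√2 : ℝ) : ℂ) / 2, 0, -(((√2 : ℝ) : ℂ) / 2)])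
  have h3 := FrameSystem.exp isFrameExponent_I hX hY
    (((1 / √3 : ℝ) : ℂ) • ![0, 1, 0])
  convert (h1.add h2).add h3 using 1 <;>
  · funext x k
    fin_cases k <;> simp [tildeVec] <;> ring

/-- A solution of the linear system is congruent to the explicit surface. -/
theorem FrameSystem.exists_unitary {K : Set E} {X Y : E → ℝ} {F F₁ F₂ : E → Fin 3 → ℂ}
    (h : FrameSystem K X Y F F₁ F₂) (hK : IsOpen K) (hc : Convex ℝ K)
    (hX : ∀ x ∈ K, DifferentiableAt ℝ X x) (hY : ∀ x ∈ K, DifferentiableAt ℝ Y x) {x₀ : E}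
    (hx₀ : x₀ ∈ K) (hF : hermForm (F x₀) (F x₀) = -1)
    (hb : IsNullBasis (F x₀) (F₁ x₀) (F₂ x₀) 1) :
    ∃ A : HermUnitary, ∀ x ∈ K, A.1 (F x) = tildeLVec 1 (X x) (Y x) := by
  obtain ⟨A, h0, h1, h2⟩ := hb.exists_unitary (isNullBasis_tildeVec (X x₀) (Y x₀)) hF
    (hermForm_tildeVec_one _ _)
  refine ⟨A, fun x hx => ?_⟩
  rw [tildeLVec_one]
  exact (h.map A.1.toLinearMap).unique (frameSystem_tildeVec hX hY) hK hc hX hY hx₀ hx h0 h1 h2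

end system

/-! ### Rigidity of the explicit surface -/

section rigidity

theorem hasFDerivAt_coord (k : Fin 2) (s : EuclideanSpace ℝ (Fin 2)) :
    HasFDerivAt (fun s : EuclideanSpace ℝ (Fin 2) => s k)
      (EuclideanSpace.proj k : EuclideanSpace ℝ (Fin 2) →L[ℝ] ℝ) s :=
  (EuclideanSpace.proj k : EuclideanSpace ℝ (Fin 2) →L[ℝ] ℝ).hasFDerivAt

theorem fderiv_coord (k : Fin 2) (s u : EuclideanSpace ℝ (Fin 2)) :
    fderiv ℝ (fun s : EuclideanSpace ℝ (Fin 2) => s k) s u = u k := by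
  rw [(hasFDerivAt_coord k s).fderiv]
  rfl

theorem HermUnitary.hermForm_smul (B : HermUnitary) (c : ℂ) (z w : Fin 3 → ℂ) :
    hermForm (c • B.1 z) (c • B.1 w) = conj c * c * hermForm z w := by
  rw [hermForm_smul_smul, B.2]

variable {U : Set (EuclideanSpace ℝ (Fin 2))} {p q : EuclideanSpace ℝ (Fin 2) → ℝ}
  {B : HermUnitary}

/-- The factor between two horizontal lifts of the same surface is constant. -/
theorem exists_const_factor (hU : IsOpen U) (hc : Convex ℝ U) (hp : ContDiffOn ℝ ∞ p U)
    (hq : ContDiffOn ℝ ∞ q U)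
    (hB : ∀ s ∈ U, ∃ c : ℂ, tildeVec 1 1 1 (p s) (q s) = c • B.1 (tildeVec 1 1 1 (s 0) (s 1))) :
    ∃ c : ℂ, ∀ s ∈ U, tildeVec 1 1 1 (p s) (q s) = c • B.1 (tildeVec 1 1 1 (s 0) (s 1)) := by
  rcases U.eq_empty_or_nonempty with rfl | ⟨s₀, hs₀⟩
  · exact ⟨0, fun s hs => absurd hs (Set.notMem_empty s)⟩
  have dp : ∀ s ∈ U, DifferentiableAt ℝ p s := fun s hs =>
    (hp.contDiffAt (hU.mem_nhds hs)).differentiableAt (by simp)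
  have dq : ∀ s ∈ U, DifferentiableAt ℝ q s := fun s hs =>
    (hq.contDiffAt (hU.mem_nhds hs)).differentiableAt (by simp)
  have S1 := frameSystem_tildeVec dp dq
  have S2 := (frameSystem_tildeVec (K := U) (fun s _ => (hasFDerivAt_coord 0 s).differentiableAt)
    (fun s _ => (hasFDerivAt_coord 1 s).differentiableAt)).map B.1.toLinearMap
  -- The factor, expressed through the pairing of the two lifts, which makes it differentiable; the
  -- sign comes from b = -1 on the lift.
  set c : EuclideanSpace ℝ (Fin 2) → ℂ := fun s =>
    -hermForm (B.1 (tildeVec 1 1 1 (s 0) (s 1))) (tildeVec 1 1 1 (p s) (q s)) with hcdef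
  have hcB : ∀ s ∈ U, tildeVec 1 1 1 (p s) (q s) = c s • B.1 (tildeVec 1 1 1 (s 0) (s 1)) := by
    intro s hs
    obtain ⟨c', hc'⟩ := hB s hs
    have : c s = c' := by
      rw [hcdef]
      simp only [hc', hermForm_smul_right, B.2, hermForm_tildeVec_one]
      ring
    rw [this, hc']
  have hd : ∀ s ∈ U, DifferentiableAt ℝ c s := fun s hs =>
    (differentiableAt_hermForm (S2.diff s hs) (S1.diff s hs)).neg
  have hc0 : ∀ s ∈ U, fderiv ℝ c s = 0 := by
    intro s hs
    ext u
    have e1 : fderiv ℝ (fun s => tildeVec 1 1 1 (p s) (q s)) s u =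
        fderiv ℝ (fun s => c s • B.1 (tildeVec 1 1 1 (s 0) (s 1))) s u := by
      have : (fun s => tildeVec 1 1 1 (p s) (q s)) =ᶠ[nhds s]
          fun s => c s • B.1 (tildeVec 1 1 1 (s 0) (s 1)) :=
        Filter.eventually_of_mem (hU.mem_nhds hs) hcB
      rw [this.fderiv_eq]
    have e2 := fderiv_fun_smul (hd s hs) (S2.diff s hs)
    have b1 := isNullBasis_tildeVec (p s) (q s)
    have b2 := isNullBasis_tildeVec (s 0) (s 1)
    have e3 := S2.eq s hs u
    have e4 := S1.eq s hs u
    simp only [LinearEquiv.coe_coe] at e2 e3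
    rw [e2, e4] at e1
    simp only [add_apply, smul_apply, ContinuousLinearMap.smulRight_apply] at e1
    rw [e3] at e1
    have hn : ∀ (x y : ℝ) z w, normForm (tildeVec 1 1 1 x y) z w = hermForm z w := by
      intro x y z w
      simp [normForm, hermForm_tildeVec_one]
    have o1 := b1.orth₁
    have o2 := b1.orth₂
    have o3 := b2.orth₁
    have o4 := b2.orth₂
    rw [hn] at o1 o2 o3 o4
    -- Both lifts are horizontal, so pairing with the position vector kills their derivatives and
    -- leaves only the derivative of c.
    have e5 := congrArg (hermForm (tildeVec 1 1 1 (p s) (q s))) e1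
    rw [hermForm_add_right, hermForm_smul_right, hermForm_smul_right, o1, o2] at e5
    rw [hcB s hs] at e5
    simp only [hermForm_add_right, hermForm_smul_right, hermForm_smul_left, B.2, o3, o4,
      hermForm_tildeVec_one] at e5
    have hne : c s ≠ 0 := by
      intro h0
      have := hermForm_tildeVec_one (p s) (q s)
      rw [hcB s hs, h0] at this
      simp [hermForm] at this
    have hne' : conj (c s) ≠ 0 := (map_ne_zero _).2 hne
    simpa [hne'] using e5
  refine ⟨c s₀, fun s hs => ?_⟩
  rw [hcB s hs, hU.is_const_of_fderiv_eq_zero hc.isPreconnected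
    (fun s hs => (hd s hs).differentiableWithinAt) hc0 hs hs₀]

/-- Comparing imaginary parts of the coefficients discards a and b, which will be second derivatives
of the coordinate change, and keeps the quadratic terms a', b' in its first derivatives. -/
theorem eq_of_real_comb {Z e₁ e₂ : Fin 3 → ℂ} {c : ℂ} (h : IsNullBasis Z e₁ e₂ c)
    {l a b a' b' r t : ℝ}
    (e : Complex.I • ((r : ℂ) • e₁ + (t : ℂ) • e₂) = (l : ℂ) • Z +
      ((a : ℂ) + a' * Complex.I) • e₁ + ((b : ℂ) + b' * Complex.I) • e₂) : r = a' ∧ t = b' := by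
  have h0 : (l : ℂ) • Z + ((a : ℂ) + a' * Complex.I - r * Complex.I) • e₁ +
      ((b : ℂ) + b' * Complex.I - t * Complex.I) • e₂ = 0 := by
    rw [← sub_eq_zero.2 e.symm]
    module
  obtain ⟨-, h1, h2⟩ := h.comb_eq_zero h0
  have h3 := congrArg Complex.im h1
  have h4 := congrArg Complex.im h2
  simp at h3 h4
  constructor <;> linarith

/-- Two normalized coordinate systems on the same surface differ by a translation and possibly an
exchange of the coordinates. -/
theorem tildeVec_frame_eq (hU : IsOpen U) (hp : ContDiffOn ℝ ∞ p U) (hq : ContDiffOn ℝ ∞ q U)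
    {c : ℂ}
    (hB : ∀ s ∈ U, tildeVec 1 1 1 (p s) (q s) = c • B.1 (tildeVec 1 1 1 (s 0) (s 1)))
    {s : EuclideanSpace ℝ (Fin 2)} (hs : s ∈ U) :
    (c • B.1 (tildeVec tildeExp₁ tildeExp₂ Complex.I (s 0) (s 1)) =
        tildeVec tildeExp₁ tildeExp₂ Complex.I (p s) (q s) ∧
      c • B.1 (tildeVec tildeExp₂ tildeExp₁ Complex.I (s 0) (s 1)) =
        tildeVec tildeExp₂ tildeExp₁ Complex.I (p s) (q s)) ∨
    (c • B.1 (tildeVec tildeExp₁ tildeExp₂ Complex.I (s 0) (s 1)) =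
        tildeVec tildeExp₂ tildeExp₁ Complex.I (p s) (q s) ∧
      c • B.1 (tildeVec tildeExp₂ tildeExp₁ Complex.I (s 0) (s 1)) =
        tildeVec tildeExp₁ tildeExp₂ Complex.I (p s) (q s)) := by
  have hn := hU.mem_nhds hs
  have dp : ∀ s ∈ U, DifferentiableAt ℝ p s := fun s hs =>
    (hp.contDiffAt (hU.mem_nhds hs)).differentiableAt (by simp)
  have dq : ∀ s ∈ U, DifferentiableAt ℝ q s := fun s hs =>
    (hq.contDiffAt (hU.mem_nhds hs)).differentiableAt (by simp)
  have S1 := frameSystem_tildeVec dp dq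
  have S2 := (frameSystem_tildeVec (K := U) (fun s _ => (hasFDerivAt_coord 0 s).differentiableAt)
    (fun s _ => (hasFDerivAt_coord 1 s).differentiableAt)).map (c • B.1.toLinearMap)
  set e₀ : EuclideanSpace ℝ (Fin 2) := EuclideanSpace.single 0 1
  set e₁ : EuclideanSpace ℝ (Fin 2) := EuclideanSpace.single 1 1
  have first : ∀ s ∈ U, ∀ u,
      (u 0 : ℂ) • c • B.1 (tildeVec tildeExp₁ tildeExp₂ Complex.I (s 0) (s 1))
      + (u 1 : ℂ) • c • B.1 (tildeVec tildeExp₂ tildeExp₁ Complex.I (s 0) (s 1)) =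
      (fderiv ℝ p s u : ℂ) • tildeVec tildeExp₁ tildeExp₂ Complex.I (p s) (q s) +
      (fderiv ℝ q s u : ℂ) • tildeVec tildeExp₂ tildeExp₁ Complex.I (p s) (q s) := by
    intro s hs u
    have h1 := S1.eq s hs u
    have h2 := S2.eq s hs u
    rw [fderiv_coord, fderiv_coord] at h2
    have : (fun s => tildeVec 1 1 1 (p s) (q s)) =ᶠ[nhds s]
        fun s => (c • B.1.toLinearMap) (tildeVec 1 1 1 (s 0) (s 1)) :=
      Filter.eventually_of_mem (hU.mem_nhds hs) hB
    rw [this.fderiv_eq, h2] at h1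
    exact h1
  have f0 : ∀ s ∈ U, c • B.1 (tildeVec tildeExp₁ tildeExp₂ Complex.I (s 0) (s 1)) =
      (fderiv ℝ p s e₀ : ℂ) • tildeVec tildeExp₁ tildeExp₂ Complex.I (p s) (q s) +
      (fderiv ℝ q s e₀ : ℂ) • tildeVec tildeExp₂ tildeExp₁ Complex.I (p s) (q s) := by
    intro s hs
    simpa [e₀] using first s hs e₀
  have f1 : c • B.1 (tildeVec tildeExp₂ tildeExp₁ Complex.I (s 0) (s 1)) =
      (fderiv ℝ p s e₁ : ℂ) • tildeVec tildeExp₁ tildeExp₂ Complex.I (p s) (q s) +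
      (fderiv ℝ q s e₁ : ℂ) • tildeVec tildeExp₂ tildeExp₁ Complex.I (p s) (q s) := by
    simpa [e₁] using first s hs e₁
  have dP : DifferentiableAt ℝ (fun s => (fderiv ℝ p s e₀ : ℂ)) s :=
    Complex.ofRealCLM.differentiableAt.comp s
      ((((contDiffOn_fderiv hU hp).contDiffAt hn).differentiableAt (by simp)).clm_apply
        (differentiableAt_const _))
  have dQ : DifferentiableAt ℝ (fun s => (fderiv ℝ q s e₀ : ℂ)) s :=
    Complex.ofRealCLM.differentiableAt.comp s
      ((((contDiffOn_fderiv hU hq).contDiffAt hn).differentiableAt (by simp)).clm_apply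
        (differentiableAt_const _))
  -- The second derivatives of p and q only matter through being real.
  have dP' : ∃ r : ℝ, fderiv ℝ (fun s => (fderiv ℝ p s e₀ : ℂ)) s e₀ = r :=
    ⟨_, Complex.ext rfl (fderiv_ofReal_im
      ((((contDiffOn_fderiv hU hp).contDiffAt hn).differentiableAt (by simp)).clm_apply
        (differentiableAt_const _)) _)⟩
  have dQ' : ∃ r : ℝ, fderiv ℝ (fun s => (fderiv ℝ q s e₀ : ℂ)) s e₀ = r :=
    ⟨_, Complex.ext rfl (fderiv_ofReal_im
      ((((contDiffOn_fderiv hU hq).contDiffAt hn).differentiableAt (by simp)).clm_apply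
        (differentiableAt_const _)) _)⟩
  obtain ⟨P', hP'⟩ := dP'
  obtain ⟨Q', hQ'⟩ := dQ'
  have second := S2.eq₁ s hs e₀
  have he : (fun s => (c • B.1.toLinearMap) (tildeVec tildeExp₁ tildeExp₂ Complex.I (s 0) (s 1)))
      =ᶠ[nhds s] fun s => (fderiv ℝ p s e₀ : ℂ) • tildeVec tildeExp₁ tildeExp₂ Complex.I (p s) (q s)
        + (fderiv ℝ q s e₀ : ℂ) • tildeVec tildeExp₂ tildeExp₁ Complex.I (p s) (q s) :=
    Filter.eventually_of_mem hn f0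
  have d1 : DifferentiableAt ℝ (fun s => (fderiv ℝ p s e₀ : ℂ) •
      tildeVec tildeExp₁ tildeExp₂ Complex.I (p s) (q s)) s := dP.smul (S1.diff₁ s hs)
  have d2 : DifferentiableAt ℝ (fun s => (fderiv ℝ q s e₀ : ℂ) •
      tildeVec tildeExp₂ tildeExp₁ Complex.I (p s) (q s)) s := dQ.smul (S1.diff₂ s hs)
  have g0 : e₀ 0 = 1 := by simp [e₀]
  have g1 : e₀ 1 = 0 := by simp [e₀]
  rw [fderiv_coord, fderiv_coord, he.fderiv_eq, fderiv_fun_add d1 d2,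
    fderiv_fun_smul dP (S1.diff₁ s hs), fderiv_fun_smul dQ (S1.diff₂ s hs), g0, g1] at second
  simp only [add_apply, smul_apply, ContinuousLinearMap.smulRight_apply, hP', hQ', S1.eq₁ s hs,
    S1.eq₂ s hs, LinearMap.smul_apply, LinearEquiv.coe_coe, f1] at second
  have hb := isNullBasis_tildeVec (p s) (q s)
  have hb0 := isNullBasis_tildeVec (s 0) (s 1)
  have f0s := f0 s hs
  generalize fderiv ℝ p s e₀ = a at *
  generalize fderiv ℝ q s e₀ = b at *
  generalize fderiv ℝ p s e₁ = r at *
  generalize fderiv ℝ q s e₁ = t at *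
  -- Differentiating B E₁ = aE₁ + bE₂ along the first coordinate must give i(rE₁ + tE₂). Its
  -- imaginary parts are b² on E₁ and a² on E₂.
  have k1 := eq_of_real_comb hb (l := -2 * a * b) (a := P') (b := Q') (a' := b ^ 2) (b' := a ^ 2)
    (r := r) (t := t) (by
      simp only [Complex.ofReal_one, Complex.ofReal_zero, one_mul, zero_smul, sub_zero] at second
      rw [← second]
      push_cast
      module)
  have hN : ∀ (x y : ℝ) z w, normForm (tildeVec 1 1 1 x y) z w = hermForm z w := by
    intro x y z w
    simp [normForm, hermForm_tildeVec_one]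
  have hcc : conj c * c = 1 := by
    have := hermForm_tildeVec_one (p s) (q s)
    rw [hB s hs, B.hermForm_smul, hermForm_tildeVec_one] at this
    linear_combination -this
  have n1 := hb.null₁
  have n2 := hb.null₂
  have n3 := hb.pair
  have n4 := hb.pair'
  have m1 := hb0.null₁
  have m2 := hb0.pair
  rw [hN] at n1 n2 n3 n4 m1 m2
  have q1 := B.hermForm_smul c (tildeVec tildeExp₁ tildeExp₂ Complex.I (s 0) (s 1))
    (tildeVec tildeExp₁ tildeExp₂ Complex.I (s 0) (s 1))
  have q2 := B.hermForm_smul c (tildeVec tildeExp₁ tildeExp₂ Complex.I (s 0) (s 1))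
    (tildeVec tildeExp₂ tildeExp₁ Complex.I (s 0) (s 1))
  rw [f0s, m1] at q1
  rw [f0s, f1, m2, hcc] at q2
  simp only [hermForm_add_left, hermForm_add_right, hermForm_smul_left, hermForm_smul_right,
    n1, n2, n3, n4, Complex.conj_ofReal, map_one] at q1 q2
  -- The map preserves null vectors and their pairing: ab = 0 and at + br = 1. With t = a², r = b²
  -- the latter is a³ + b³ = 1, so (a,b) is (1,0) or (0,1).
  have q1' : a * b = 0 := by
    have h1 : ((a * b : ℝ) : ℂ) = 0 := by
      push_cast
      linear_combination (-1 / 2) * q1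
    exact_mod_cast h1
  have q2' : a * t + b * r = 1 := by
    have h1 : ((a * t + b * r : ℝ) : ℂ) = 1 := by
      push_cast
      linear_combination -q2
    exact_mod_cast h1
  obtain ⟨k1, k2⟩ := k1
  rw [k1, k2] at q2'
  rw [f1, f0s, k1, k2]
  have cube : ∀ z : ℝ, z ^ 3 = 1 → z = 1 := fun z hz => by
    nlinarith [sq_nonneg (z + 1), sq_nonneg z]
  rcases mul_eq_zero.1 q1' with h0 | h0
  · right
    have hb1 : b = 1 := cube b (by rw [h0] at q2'; linarith)
    simp [h0, hb1]
  · left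
    have ha1 : a = 1 := cube a (by rw [h0] at q2'; linarith)
    simp [h0, ha1]

/-- The frames are matched at one point of U, either directly or crosswise. Translated coordinates
satisfy the same linear system, so uniqueness spreads the relation over the whole plane. That range
is needed to change a chart on its entire source. -/
theorem tildeVec_rigid (hU : IsOpen U) (hc : Convex ℝ U) (hne : U.Nonempty)
    (hp : ContDiffOn ℝ ∞ p U) (hq : ContDiffOn ℝ ∞ q U)
    (hB : ∀ s ∈ U, ∃ c : ℂ, tildeLVec 1 (p s) (q s) = c • B.1 (tildeLVec 1 (s 0) (s 1))) :
    ∃ a b : ℝ, ∃ c : ℂ,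
      (∀ s : EuclideanSpace ℝ (Fin 2),
        tildeLVec 1 (s 0 + a) (s 1 + b) = c • B.1 (tildeLVec 1 (s 0) (s 1))) ∨
      (∀ s : EuclideanSpace ℝ (Fin 2),
        tildeLVec 1 (s 1 + b) (s 0 + a) = c • B.1 (tildeLVec 1 (s 0) (s 1))) := by
  simp only [tildeLVec_one] at hB ⊢
  obtain ⟨c, hcB⟩ := exists_const_factor hU hc hp hq hB
  obtain ⟨s₀, hs₀⟩ := hne
  have c0 : ∀ s ∈ (Set.univ : Set (EuclideanSpace ℝ (Fin 2))), DifferentiableAt ℝ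
      (fun s : EuclideanSpace ℝ (Fin 2) => s 0) s :=
    fun s _ => (hasFDerivAt_coord 0 s).differentiableAt
  have c1 : ∀ s ∈ (Set.univ : Set (EuclideanSpace ℝ (Fin 2))), DifferentiableAt ℝ
      (fun s : EuclideanSpace ℝ (Fin 2) => s 1) s :=
    fun s _ => (hasFDerivAt_coord 1 s).differentiableAt
  have S2 := (frameSystem_tildeVec c0 c1).map (c • B.1.toLinearMap)
  rcases tildeVec_frame_eq hU hp hq hcB hs₀ with ⟨e1, e2⟩ | ⟨e1, e2⟩
  · refine ⟨p s₀ - s₀ 0, q s₀ - s₀ 1, c, Or.inl fun s => ?_⟩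
    have S1 := (frameSystem_tildeVec (fun s hs => (c0 s hs).add_const (p s₀ - s₀ 0))
      (fun s hs => (c1 s hs).add_const (q s₀ - s₀ 1))).congr_coord (X' := fun s => s 0)
      (Y' := fun s => s 1) (fun s _ => by rw [fderiv_add_const])
      (fun s _ => by rw [fderiv_add_const])
    refine S1.unique S2 isOpen_univ convex_univ c0 c1 (Set.mem_univ s₀) (Set.mem_univ s) ?_ ?_ ?_
    · simp only [add_sub_cancel]
      exact hcB s₀ hs₀
    · simp only [add_sub_cancel]
      exact e1.symm
    · simp only [add_sub_cancel]
      exact e2.symm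
  · refine ⟨q s₀ - s₀ 0, p s₀ - s₀ 1, c, Or.inr fun s => ?_⟩
    have S1 := ((frameSystem_tildeVec (fun s hs => (c1 s hs).add_const (p s₀ - s₀ 1))
      (fun s hs => (c0 s hs).add_const (q s₀ - s₀ 0))).swap).congr_coord (X' := fun s => s 0)
      (Y' := fun s => s 1) (fun s _ => by rw [fderiv_add_const])
      (fun s _ => by rw [fderiv_add_const])
    refine S1.unique S2 isOpen_univ convex_univ c0 c1 (Set.mem_univ s₀) (Set.mem_univ s) ?_ ?_ ?_
    · simp only [add_sub_cancel]
      exact hcB s₀ hs₀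
    · simp only [add_sub_cancel]
      exact e1.symm
    · simp only [add_sub_cancel]
      exact e2.symm

end rigidity

/-! ### Flat null frames: closed coframes, null coordinates and horizontal lifts -/

section FlatFrame

variable {E : Type*} [NormedAddCommGroup E] [NormedSpace ℝ E]

/-- A null frame with the structure equations of a flat minimal Lagrangian surface. -/
structure FlatFrame (Z : E → Fin 3 → ℂ) (U : Set E) (n₁ n₂ : E → E) : Prop where
  isOpen : IsOpen U
  smooth : ContDiffOn ℝ ∞ Z U
  smooth₁ : ContDiffOn ℝ ∞ n₁ U
  smooth₂ : ContDiffOn ℝ ∞ n₂ U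
  basis : ∀ x ∈ U, IsNullBasis (Z x) (frameLift Z n₁ x) (frameLift Z n₂ x) 1
  span : ∀ x ∈ U, ∀ u, ∃ a b : ℝ, u = a • n₁ x + b • n₂ x
  cov₁₁ : ∀ x ∈ U, cov Z (frameLift Z n₁) x (n₁ x) = Complex.I • frameLift Z n₂ x
  cov₂₁ : ∀ x ∈ U, cov Z (frameLift Z n₁) x (n₂ x) = -Z x
  cov₁₂ : ∀ x ∈ U, cov Z (frameLift Z n₂) x (n₁ x) = -Z x
  cov₂₂ : ∀ x ∈ U, cov Z (frameLift Z n₂) x (n₂ x) = Complex.I • frameLift Z n₁ x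
  curv : ∀ x ∈ U, connCurv Z x (n₁ x) (n₂ x) = 0

/-- With v constant and nonzero, n₂(v) = -3ω₂v forces ω₂ = 0, and by symmetry ω₁ = 0. -/
theorem NullFrame.flatFrame {Z : E → Fin 3 → ℂ} {U : Set E} {n₁ n₂ : E → E} {s : E → ℝ}
    (h : NullFrame Z U n₁ n₂ s) (h₁ : ∀ x ∈ U, frameCubic Z n₁ n₂ x = Complex.I)
    (h₂ : ∀ x ∈ U, frameCubic Z n₂ n₁ x = Complex.I) : FlatFrame Z U n₁ n₂ := by
  have conn : ∀ {n₁ n₂ : E → E} {s : E → ℝ}, NullFrame Z U n₁ n₂ s →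
      (∀ x ∈ U, frameCubic Z n₁ n₂ x = Complex.I) → ∀ x ∈ U, frameConn Z n₂ n₁ x = 0 := by
    intro n₁ n₂ s h h₁ x hx
    have h0 := (h.compat hx).2
    have h1 : frameCubic Z n₁ n₂ =ᶠ[nhds x] fun _ => Complex.I :=
      Filter.eventually_of_mem (h.isOpen.mem_nhds hx) h₁
    rw [h1.fderiv_eq, h₁ x hx, fderiv_fun_const] at h0
    simpa using h0
  have c₂ := conn h h₁
  have c₁ := conn h.swap h₂
  have s0 : ∀ x ∈ U, s x = 0 := fun x hx => (h.compat hx).1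
  exact
  { isOpen := h.isOpen
    smooth := h.smooth
    smooth₁ := h.smooth₁
    smooth₂ := h.smooth₂
    basis := fun x hx => by simpa [s0 x hx] using h.isNullBasis hx
    span := h.span
    cov₁₁ := fun x hx => by rw [h.cov₁₁ hx, c₁ x hx, h₁ x hx]; simp
    cov₂₁ := fun x hx => by rw [h.cov₂₁ hx, c₂ x hx, s0 x hx]; simp
    cov₁₂ := fun x hx => by rw [h.cov₁₂ hx, c₁ x hx, s0 x hx]; simp
    cov₂₂ := fun x hx => by rw [h.cov₂₂ hx, c₂ x hx, h₂ x hx]; simp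
    curv := fun x hx => by rw [(h.bracket_eq hx).2, s0 x hx]; simp }

/-- A flat minimal surface with a null frame has a flat null frame around every point. -/
theorem NullFrame.exists_flatFrame {Z : E → Fin 3 → ℂ} {U : Set E} {n₁ n₂ : E → E} {s : E → ℝ}
    {g : E → E → E → ℝ} {x : E} (h : NullFrame Z U n₁ n₂ s)
    (hg : ∀ y ∈ U, ∀ u v, g y u v = liftMetric Z y u v)
    (hR : ∀ x ∈ U, ∀ u v w, curvature g x u v w = 0) (hx : x ∈ U) :
    ∃ (V : Set E) (m₁ m₂ : E → E), V ⊆ U ∧ x ∈ V ∧ FlatFrame Z V m₁ m₂ := by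
  obtain ⟨V, m₁, m₂, hVU, hxV, h', h₁⟩ := h.exists_normalized hg hR hx
  refine ⟨V, m₁, m₂, hVU, hxV, h'.flatFrame h₁ fun y hy => ?_⟩
  have := h'.frameCubic_mul_eq (fun y hy => hg y (hVU hy)) hy (hR y (hVU hy))
  rw [h₁ y hy] at this
  have h2 := congrArg (Complex.I * ·) this
  simp only [← mul_assoc, Complex.I_mul_I] at h2
  linear_combination -h2

/-- The differential form dual to `m` in a null frame `m, n`. -/
def frameCoform (Z : E → Fin 3 → ℂ) (n : E → E) (x : E) : E →L[ℝ] ℝ :=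
  (hermForm (Z x) (Z x)).re⁻¹ •
    Complex.reCLM.comp ((hermCLM (frameLift Z n x)).comp (cov Z Z x))

theorem frameCoform_apply (Z : E → Fin 3 → ℂ) (n : E → E) (x u : E) :
    frameCoform Z n x u = -(normForm (Z x) (frameLift Z n x) (cov Z Z x u)).re := by
  simp only [frameCoform, normForm, smul_apply, ContinuousLinearMap.comp_apply, hermCLM_apply,
    Complex.reCLM_apply, smul_eq_mul, Complex.re_ofReal_mul, inv_neg, neg_mul, neg_neg]

namespace FlatFrame

variable {Z : E → Fin 3 → ℂ} {U : Set E} {n₁ n₂ : E → E} {x : E} (h : FlatFrame Z U n₁ n₂)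

theorem mono {V : Set E} (h : FlatFrame Z U n₁ n₂) (hV : IsOpen V) (hVU : V ⊆ U) :
    FlatFrame Z V n₁ n₂ where
  isOpen := hV
  smooth := h.smooth.mono hVU
  smooth₁ := h.smooth₁.mono hVU
  smooth₂ := h.smooth₂.mono hVU
  basis x hx := h.basis x (hVU hx)
  span x hx := h.span x (hVU hx)
  cov₁₁ x hx := h.cov₁₁ x (hVU hx)
  cov₂₁ x hx := h.cov₂₁ x (hVU hx)
  cov₁₂ x hx := h.cov₁₂ x (hVU hx)
  cov₂₂ x hx := h.cov₂₂ x (hVU hx)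
  curv x hx := h.curv x (hVU hx)

include h

theorem neg (hx : x ∈ U) : (hermForm (Z x) (Z x)).re < 0 := (h.basis x hx).neg

theorem swap : FlatFrame Z U n₂ n₁ where
  isOpen := h.isOpen
  smooth := h.smooth
  smooth₁ := h.smooth₂
  smooth₂ := h.smooth₁
  basis x hx := by simpa using (h.basis x hx).swap
  span x hx u := by
    obtain ⟨a, b, e⟩ := h.span x hx u
    exact ⟨b, a, by rw [e, add_comm]⟩
  cov₁₁ := h.cov₂₂
  cov₂₁ := h.cov₁₂
  cov₁₂ := h.cov₂₁
  cov₂₂ := h.cov₁₁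
  curv x hx := by
    have := h.curv x hx
    rw [connCurv] at this ⊢
    rw [← neg_sub, this, neg_zero]

theorem contDiffOn_frameLift : ContDiffOn ℝ ∞ (frameLift Z n₁) U :=
  (contDiffOn_cov h.isOpen h.smooth h.smooth fun _ => h.neg).clm_apply h.smooth₁

theorem contDiffOn_frameCoform : ContDiffOn ℝ ∞ (frameCoform Z n₁) U := by
  have h1 : ContDiffOn ℝ ∞ (fun x => (hermForm (Z x) (Z x)).re⁻¹) U :=
    (Complex.reCLM.contDiff.comp_contDiffOn (contDiffOn_hermForm h.smooth h.smooth)).inv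
      fun x hx => (h.neg hx).ne
  have h2 : ContDiffOn ℝ ∞ (fun x => (hermCLM (frameLift Z n₁ x)).comp (cov Z Z x)) U :=
    (hermCLM.contDiff.comp_contDiffOn h.contDiffOn_frameLift).clm_comp
      (contDiffOn_cov h.isOpen h.smooth h.smooth fun _ => h.neg)
  exact h1.smul (contDiffOn_const.clm_comp h2)

/-- The indices cross because pairing with E₂ reads off the coefficient of n₁. -/
theorem frameCoform_eq (hx : x ∈ U) (u : E) :
    u = frameCoform Z n₂ x u • n₁ x + frameCoform Z n₁ x u • n₂ x := by
  obtain ⟨a, b, e⟩ := h.span x hx u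
  have hb := h.basis x hx
  have h0 : cov Z Z x u = (0 : ℂ) • Z x + (a : ℂ) • frameLift Z n₁ x +
      (b : ℂ) • frameLift Z n₂ x := by
    rw [e, map_add, map_smul, map_smul]
    simp [frameLift]
  rw [frameCoform_apply, frameCoform_apply, h0, hb.normForm_comb₁, hb.normForm_comb₂]
  simpa using e

theorem cov_eq (hx : x ∈ U) (u : E) : cov Z (frameLift Z n₁) x u =
    (frameCoform Z n₂ x u * Complex.I) • frameLift Z n₂ x -
      (frameCoform Z n₁ x u : ℂ) • Z x := by
  conv_lhs => rw [h.frameCoform_eq hx u, map_add, map_smul, map_smul, h.cov₁₁ x hx, h.cov₂₁ x hx]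
  simp only [← Complex.coe_smul]
  module

/-- In the differential of θ = -Re⟨E₁,∇Z⟩ the term with ∇E₁ drops out, because ∇E₁ has no tangential
part, and the term with ∇∇Z is symmetric. Thus θ is closed and integrates to a coordinate. -/
theorem fderiv_frameCoform_symm (hx : x ∈ U) (u v : E) :
    fderiv ℝ (frameCoform Z n₁) x u v = fderiv ℝ (frameCoform Z n₁) x v u := by
  have hn := h.isOpen.mem_nhds hx
  have dθ : DifferentiableAt ℝ (frameCoform Z n₁) x :=
    (h.contDiffOn_frameCoform.contDiffAt hn).differentiableAt (by simp)
  have dZ : DifferentiableAt ℝ Z x := (h.smooth.contDiffAt hn).differentiableAt (by simp)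
  have dE : DifferentiableAt ℝ (frameLift Z n₁) x :=
    (h.contDiffOn_frameLift.contDiffAt hn).differentiableAt (by simp)
  have hb := h.basis x hx
  have key : ∀ u v, fderiv ℝ (frameCoform Z n₁) x u v =
      -((normForm (Z x) (cov Z (frameLift Z n₁) x u) (cov Z Z x v)).re +
        (normForm (Z x) (cov Z (fun y => cov Z Z y v) x u) (frameLift Z n₁ x)).re) := by
    intro u v
    have d2 : DifferentiableAt ℝ (fun y => cov Z Z y v) x :=
      ((contDiffOn_cov_const h.isOpen h.smooth (fun _ => h.neg) v).contDiffAt hn).differentiableAt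
        (by simp)
    have e1 := (dθ.hasFDerivAt.clm_apply (hasFDerivAt_const v x)).fderiv
    have e2 := congrArg (· u) e1
    simp only [add_apply, ContinuousLinearMap.comp_apply, zero_apply, map_zero,
      ContinuousLinearMap.flip_apply] at e2
    rw [zero_add] at e2
    rw [← e2]
    simp only [frameCoform_apply]
    rw [fderiv_fun_neg, neg_apply, fderiv_re_normForm dZ dE d2 (h.neg hx),
      normForm_re_comm _ (frameLift Z n₁ x)]
  have zero : ∀ u v, (normForm (Z x) (cov Z (frameLift Z n₁) x u) (cov Z Z x v)).re = 0 := by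
    intro u v
    rw [h.cov_eq hx, normForm_sub_left, normForm_smul_left, normForm_smul_left,
      normForm_cov_self (h.neg hx), mul_zero, sub_zero, h.frameCoform_eq hx v, map_add, map_smul,
      map_smul, ← Complex.coe_smul, ← Complex.coe_smul, normForm_add_right, normForm_smul_right,
      normForm_smul_right]
    have e1 : normForm (Z x) (frameLift Z n₂ x) (cov Z Z x (n₁ x)) = _ := hb.pair'
    have e2 : normForm (Z x) (frameLift Z n₂ x) (cov Z Z x (n₂ x)) = _ := hb.null₂
    rw [e1, e2]
    simp
  rw [key, key, zero, zero, frameLift, normForm_cov_cov_symm h.isOpen h.smooth (fun _ => h.neg) hx]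

/-- An alternating form in two dimensions is determined by its value on the frame. Closedness of ω
makes a horizontal lift possible. -/
theorem fderiv_connForm_symm (hx : x ∈ U) (u v : E) :
    fderiv ℝ (connForm Z) x u v = fderiv ℝ (connForm Z) x v u := by
  have h0 := sub_eq_zero.1 (h.curv x hx)
  rw [h.frameCoform_eq hx u, h.frameCoform_eq hx v]
  simp only [map_add, map_smul, add_apply, smul_apply, h0]
  module

/-- Around every point, a surface with a flat null frame has coordinates and a lift that satisfy
the linear system of the explicit surface. -/
theorem exists_frameSystem [CompleteSpace E] (hx : x ∈ U) : ∃ r > 0, Metric.ball x r ⊆ U ∧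
    ∃ (X Y : E → ℝ) (ρ : E → ℂ),
      ContDiffOn ℝ ∞ X (Metric.ball x r) ∧ ContDiffOn ℝ ∞ Y (Metric.ball x r) ∧
      (∀ y ∈ Metric.ball x r, ∀ u, u = fderiv ℝ X y u • n₁ y + fderiv ℝ Y y u • n₂ y) ∧
      (∀ y, ρ y ≠ 0) ∧
      FrameSystem (Metric.ball x r) X Y (fun y => ρ y • Z y) (fun y => ρ y • frameLift Z n₁ y)
        (fun y => ρ y • frameLift Z n₂ y) ∧
      hermForm (ρ x • Z x) (ρ x • Z x) = -1 ∧
      IsNullBasis (ρ x • Z x) (ρ x • frameLift Z n₁ x) (ρ x • frameLift Z n₂ x) 1 := by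
  obtain ⟨r, hr, hrU⟩ := Metric.isOpen_iff.1 h.isOpen x hx
  refine ⟨r, hr, hrU, ?_⟩
  have hK := Metric.isOpen_ball (x := x) (ε := r)
  have hc := convex_ball x r
  have h' := h.mono hK hrU
  have hxK := Metric.mem_ball_self hr (x := x)
  generalize Metric.ball x r = K at *
  -- The Poincaré lemma on the ball, for the two coframe forms and for the connection form.
  obtain ⟨X, hX⟩ := hc.exists_forall_hasFDerivAt_of_fderiv_symmetric hK
    (h'.swap.contDiffOn_frameCoform.differentiableOn (by simp))
    (fun a ha => h'.swap.fderiv_frameCoform_symm ha)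
  obtain ⟨Y, hY⟩ := hc.exists_forall_hasFDerivAt_of_fderiv_symmetric hK
    (h'.contDiffOn_frameCoform.differentiableOn (by simp))
    (fun a ha => h'.fderiv_frameCoform_symm ha)
  obtain ⟨φ, hφ⟩ := hc.exists_forall_hasFDerivAt_of_fderiv_symmetric hK
    ((contDiffOn_connForm hK h'.smooth fun _ => h'.neg).differentiableOn (by simp))
    (fun a ha => h'.fderiv_connForm_symm ha)
  have hXs : ContDiffOn ℝ ∞ X K := (contDiffOn_infty_iff_fderiv_of_isOpen hK).2
    ⟨fun y hy => (hX y hy).differentiableAt.differentiableWithinAt,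
      h'.swap.contDiffOn_frameCoform.congr fun y hy => (hX y hy).fderiv⟩
  have hYs : ContDiffOn ℝ ∞ Y K := (contDiffOn_infty_iff_fderiv_of_isOpen hK).2
    ⟨fun y hy => (hY y hy).differentiableAt.differentiableWithinAt,
      h'.contDiffOn_frameCoform.congr fun y hy => (hY y hy).fderiv⟩
  have hneg := h.neg hx
  set κ : ℂ := (((√(-(hermForm (Z x) (Z x)).re))⁻¹ : ℝ) : ℂ) with hκ
  have hκ0 : κ ≠ 0 := normalizeVec_factor_ne hneg
  -- The factor solves dρ = ρω, so d(ρξ) = ρ∇ξ: after rescaling, ∇ is the ordinary derivative. The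
  -- constant κ puts the lift on `H52` at x.
  set ρ : E → ℂ := fun y => κ * Complex.exp (φ y - φ x) with hρ
  have hρd : ∀ y ∈ K, HasFDerivAt ρ (ρ y • connForm Z y) y := by
    intro y hy
    have := (((hφ y hy).sub_const (φ x)).cexp).const_mul κ
    refine this.congr_fderiv ?_
    rw [hρ, smul_smul]
  have hρx : ρ x = κ := by simp [hρ]
  have cond : ∀ {ξ : E → Fin 3 → ℂ}, ContDiffOn ℝ ∞ ξ K → ∀ y ∈ K,
      DifferentiableAt ℝ (fun y => ρ y • ξ y) y ∧
      ∀ u, fderiv ℝ (fun y => ρ y • ξ y) y u = ρ y • cov Z ξ y u := by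
    intro ξ hξ y hy
    have d : DifferentiableAt ℝ ξ y :=
      (hξ.contDiffAt (hK.mem_nhds hy)).differentiableAt (by simp)
    have h1 : HasFDerivAt (fun y => ρ y • ξ y) _ y := (hρd y hy).smul d.hasFDerivAt
    refine ⟨h1.differentiableAt, fun u => ?_⟩
    rw [h1.fderiv, cov_apply]
    simp [smul_smul, add_comm]
  have hself : hermForm (κ • Z x) (κ • Z x) = -1 := normalizeVec_mem hneg
  refine ⟨X, Y, ρ, hXs, hYs, fun y hy u => ?_, fun y => mul_ne_zero hκ0 (Complex.exp_ne_zero _),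
    ?_, by rwa [hρx], ?_⟩
  · rw [(hX y hy).fderiv, (hY y hy).fderiv]
    exact h'.frameCoform_eq hy u
  · have e1 := h'.contDiffOn_frameLift
    have e2 := h'.swap.contDiffOn_frameLift
    refine ⟨fun y hy => (cond h'.smooth y hy).1, fun y hy => (cond e1 y hy).1,
      fun y hy => (cond e2 y hy).1, fun y hy u => ?_, fun y hy u => ?_, fun y hy u => ?_⟩
    · rw [(cond h'.smooth y hy).2, (hX y hy).fderiv, (hY y hy).fderiv]
      conv_lhs => rw [h'.frameCoform_eq hy u, map_add, map_smul, map_smul]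
      simp only [frameLift, ← Complex.coe_smul]
      module
    · rw [(cond e1 y hy).2, (hX y hy).fderiv, (hY y hy).fderiv, h'.cov_eq hy]
      module
    · rw [(cond e2 y hy).2, (hX y hy).fderiv, (hY y hy).fderiv, h'.swap.cov_eq hy]
      module
  · have hb := h.basis x hx
    rw [hρx]
    have hn : ∀ ξ η, normForm (κ • Z x) (κ • ξ) (κ • η) = normForm (Z x) ξ η := by
      intro ξ η
      have e1 : hermForm (Z x) (Z x) ≠ 0 := hermForm_self_ne_zero hneg
      rw [normForm, normForm, hself, hermForm_smul_smul]
      rw [hermForm_smul_smul, hermForm_self_eq (Z x)] at hself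
      have e2 : conj κ * κ = (((-(hermForm (Z x) (Z x)).re)⁻¹ : ℝ) : ℂ) := by
        have e3 : ((hermForm (Z x) (Z x)).re : ℂ) ≠ 0 := Complex.ofReal_ne_zero.2 hneg.ne
        push_cast
        rw [inv_neg]
        field_simp
        linear_combination hself
      rw [e2]
      simp
    exact ⟨by rw [hself]; simp, one_ne_zero, by rw [hn, hb.orth₁], by rw [hn, hb.orth₂],
      by rw [hn, hb.null₁], by rw [hn, hb.null₂], by rw [hn, hb.pair]⟩

/-- Around every point, a surface with a flat null frame is congruent to the explicit surface. -/
theorem exists_unitary [CompleteSpace E] (hx : x ∈ U) : ∃ r > 0, Metric.ball x r ⊆ U ∧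
    ∃ (X Y : E → ℝ) (ρ : E → ℂ) (A : HermUnitary),
      ContDiffOn ℝ ∞ X (Metric.ball x r) ∧ ContDiffOn ℝ ∞ Y (Metric.ball x r) ∧
      (∀ y ∈ Metric.ball x r, ∀ u, u = fderiv ℝ X y u • n₁ y + fderiv ℝ Y y u • n₂ y) ∧
      ∀ y ∈ Metric.ball x r, ρ y ≠ 0 ∧ A.1 (ρ y • Z y) = tildeLVec 1 (X y) (Y y) := by
  obtain ⟨r, hr, hrU, X, Y, ρ, hX, hY, hXY, hρ, hF, hs, hb⟩ := h.exists_frameSystem hx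
  have hd : ∀ {f : E → ℝ}, ContDiffOn ℝ ∞ f (Metric.ball x r) → ∀ y ∈ Metric.ball x r,
      DifferentiableAt ℝ f y := fun hf y hy =>
    (hf.contDiffAt (Metric.isOpen_ball.mem_nhds hy)).differentiableAt (by simp)
  obtain ⟨A, hA⟩ := hF.exists_unitary Metric.isOpen_ball (convex_ball x r) (hd hX) (hd hY)
    (Metric.mem_ball_self hr) hs hb
  exact ⟨r, hr, hrU, X, Y, ρ, A, hX, hY, hXY, fun y hy => ⟨hρ y, hA y hy⟩⟩

end FlatFrame
end FlatFrame

/-! ### Surfaces in affine coordinates -/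

section affine

theorem affineTan_add (i : Fin 3) (u v : Fin 2 → ℂ) :
    affineTan i (u + v) = affineTan i u + affineTan i v := by
  funext k
  refine Fin.succAboveCases i ?_ (fun j => ?_) k <;> simp [affineTan]

theorem affineTan_smul (i : Fin 3) (c : ℂ) (u : Fin 2 → ℂ) :
    affineTan i (c • u) = c • affineTan i u := by
  funext k
  refine Fin.succAboveCases i ?_ (fun j => ?_) k <;> simp [affineTan]

/-- `affineTan i` as a continuous linear map. -/
def affineTanCLM (i : Fin 3) : (Fin 2 → ℂ) →L[ℂ] (Fin 3 → ℂ) :=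
  LinearMap.toContinuousLinearMap
    { toFun := affineTan i
      map_add' := affineTan_add i
      map_smul' := affineTan_smul i }

@[simp] theorem affineTanCLM_apply (i : Fin 3) (u : Fin 2 → ℂ) :
    affineTanCLM i u = affineTan i u := rfl

theorem affineVec_eq (i : Fin 3) (w : Fin 2 → ℂ) :
    affineVec i w = Pi.single i 1 + affineTan i w := by
  funext k
  refine Fin.succAboveCases i ?_ (fun j => ?_) k <;> simp [affineTan, affineVec]

theorem affineTan_injective (i : Fin 3) {u : Fin 2 → ℂ} (h : affineTan i u = 0) : u = 0 := by
  funext j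
  simpa [affineTan] using congrFun h (i.succAbove j)

theorem eq_affineVec_add_affineTan (i : Fin 3) (w : Fin 2 → ℂ) (z : Fin 3 → ℂ) :
    ∃ u, z = z i • affineVec i w + affineTan i u := by
  refine ⟨fun j => z (i.succAbove j) - z i * w j, ?_⟩
  funext k
  refine Fin.succAboveCases i ?_ (fun j => ?_) k <;> simp [affineTan, affineVec]

theorem hermForm_nondegenerate {z : Fin 3 → ℂ} (h : ∀ w, hermForm z w = 0) : z = 0 := by
  have e : ∀ k, conj (z k) = 0 := by
    intro k
    have := h (Pi.single k 1)
    fin_cases k <;> simpa [hermForm] using this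
  funext k
  simpa using e k

variable {E : Type*} [NormedAddCommGroup E] [NormedSpace ℝ E] {i : Fin 3}
  {f : E → Fin 2 → ℂ} {U : Set E} {x : E}

theorem hasFDerivAt_affineVec_comp (hf : DifferentiableAt ℝ f x) :
    HasFDerivAt (fun y => affineVec i (f y))
      (((affineTanCLM i).restrictScalars ℝ).comp (fderiv ℝ f x)) x := by
  have h1 := (((affineTanCLM i).restrictScalars ℝ).hasFDerivAt (x := f x)).comp x hf.hasFDerivAt
  have h2 : (fun y => affineVec i (f y)) =
      fun y => Pi.single i 1 + (((affineTanCLM i).restrictScalars ℝ) ∘ f) y := by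
    funext y
    simp [affineVec_eq i (f y)]
  rw [h2]
  exact h1.const_add _

theorem fderiv_affineVec_comp (hf : DifferentiableAt ℝ f x) (u : E) :
    fderiv ℝ (fun y => affineVec i (f y)) x u = affineTan i (fderiv ℝ f x u) := by
  rw [(hasFDerivAt_affineVec_comp hf).fderiv]
  rfl

theorem fderiv_affineVec (w u : Fin 2 → ℂ) : fderiv ℝ (affineVec i) w u = affineTan i u := by
  have := fderiv_affineVec_comp (i := i) (f := id) (x := w) differentiableAt_id u
  simpa using this

theorem cov_affineVec (w u : Fin 2 → ℂ) : cov (affineVec i) (affineVec i) w u =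
    affineTan i u + connForm (affineVec i) w u • affineVec i w := by
  rw [cov_apply, fderiv_affineVec]

theorem connForm_affineVec_smul (w u : Fin 2 → ℂ) (c : ℂ) :
    connForm (affineVec i) w (c • u) = c * connForm (affineVec i) w u := by
  simp only [connForm_apply, fderiv_affineVec, affineTan_smul, hermForm_smul_right]
  ring

/-- Horizontal lifting is complex linear, so the complex structure in the chart is multiplication by
i in ℂ³. -/
theorem cov_affineVec_smul (w u : Fin 2 → ℂ) (c : ℂ) :
    cov (affineVec i) (affineVec i) w (c • u) = c • cov (affineVec i) (affineVec i) w u := by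
  rw [cov_affineVec, cov_affineVec, connForm_affineVec_smul, affineTan_smul]
  module

theorem liftMetric_affineVec (w u v : Fin 2 → ℂ) :
    liftMetric (affineVec i) w u v = chMetric i w u v := by
  rw [liftMetric, cov_self_eq_horizontal, cov_self_eq_horizontal, fderiv_affineVec,
    fderiv_affineVec, chMetric, normForm, Complex.re_ofReal_mul, div_eq_inv_mul]

theorem connForm_affineVec_comp (hf : DifferentiableAt ℝ f x) (u : E) :
    connForm (fun y => affineVec i (f y)) x u = connForm (affineVec i) (f x) (fderiv ℝ f x u) := by
  rw [connForm_apply, connForm_apply, fderiv_affineVec, fderiv_affineVec_comp hf]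

theorem cov_affineVec_comp (hf : DifferentiableAt ℝ f x) (u : E) :
    cov (fun y => affineVec i (f y)) (fun y => affineVec i (f y)) x u =
      cov (affineVec i) (affineVec i) (f x) (fderiv ℝ f x u) := by
  rw [cov_apply, cov_affineVec, fderiv_affineVec_comp hf, connForm_affineVec_comp hf]

theorem inducedMetric_eq_liftMetric (hf : DifferentiableAt ℝ f x) (u v : E) :
    inducedMetric (chMetric i) f x u v = liftMetric (fun y => affineVec i (f y)) x u v := by
  rw [inducedMetric, ← liftMetric_affineVec, liftMetric, liftMetric, cov_affineVec_comp hf,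
    cov_affineVec_comp hf]

/-- The metric paired with the complex structure is the imaginary part of the Hermitian form. -/
theorem chMetric_I_smul (hf : DifferentiableAt ℝ f x) (u v : E) :
    chMetric i (f x) (Complex.I • fderiv ℝ f x u) (fderiv ℝ f x v) =
      (normForm (affineVec i (f x))
        (cov (fun y => affineVec i (f y)) (fun y => affineVec i (f y)) x u)
        (cov (fun y => affineVec i (f y)) (fun y => affineVec i (f y)) x v)).im := by
  rw [← liftMetric_affineVec, liftMetric, cov_affineVec_smul, normForm_smul_left,
    cov_affineVec_comp hf, cov_affineVec_comp hf]
  simp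

/-- The horizontal part of the second covariant derivative of the lift. -/
theorem exists_cov_cov_affineVec (hU : IsOpen U) (hf : ContDiffOn ℝ ∞ f U)
    (hneg : ∀ y ∈ U, (hermForm (affineVec i (f y)) (affineVec i (f y))).re < 0) (hx : x ∈ U)
    (u v : E) : ∃ l : ℂ,
      cov (fun y => affineVec i (f y))
        (fun y => cov (fun y => affineVec i (f y)) (fun y => affineVec i (f y)) y v) x u =
      l • affineVec i (f x) + affineTan i (fderiv ℝ (fun y => fderiv ℝ f y v) x u +
        (connForm (affineVec i) (f x) (fderiv ℝ f x u) • fderiv ℝ f x v +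
        connForm (affineVec i) (f x) (fderiv ℝ f x v) • fderiv ℝ f x u)) := by
  have hn := hU.mem_nhds hx
  have hfd : ∀ y ∈ U, DifferentiableAt ℝ f y := fun y hy =>
    (hf.contDiffAt (hU.mem_nhds hy)).differentiableAt (by simp)
  have hZ : ContDiffOn ℝ ∞ (fun y => affineVec i (f y)) U :=
    (contDiff_affineVec i).comp_contDiffOn hf
  have d2 : DifferentiableAt ℝ (fun y => fderiv ℝ f y v) x :=
    (((contDiffOn_fderiv hU hf).contDiffAt hn).differentiableAt (by simp)).clm_apply
      (differentiableAt_const _)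
  have d3 : DifferentiableAt ℝ (fun y => affineTan i (fderiv ℝ f y v)) x :=
    ((affineTanCLM i).restrictScalars ℝ).differentiableAt.comp x d2
  have e3 : fderiv ℝ (fun y => affineTan i (fderiv ℝ f y v)) x u =
      affineTan i (fderiv ℝ (fun y => fderiv ℝ f y v) x u) := by
    have h1 : fderiv ℝ (fun y => affineTan i (fderiv ℝ f y v)) x = _ :=
      ((((affineTanCLM i).restrictScalars ℝ).hasFDerivAt).comp x d2.hasFDerivAt).fderiv
    rw [h1]
    rfl
  have d4 : DifferentiableAt ℝ (fun y => connForm (fun y => affineVec i (f y)) y v) x :=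
    (((contDiffOn_connForm hU hZ hneg).contDiffAt hn).differentiableAt (by simp)).clm_apply
      (differentiableAt_const _)
  have d5 : DifferentiableAt ℝ (fun y => affineVec i (f y)) x :=
    (hasFDerivAt_affineVec_comp (hfd x hx)).differentiableAt
  have d6 : DifferentiableAt ℝ (fun y => connForm (fun y => affineVec i (f y)) y v •
      affineVec i (f y)) x := d4.smul d5
  have e4 : (fun y => cov (fun y => affineVec i (f y)) (fun y => affineVec i (f y)) y v) =ᶠ[nhds x]
      fun y => affineTan i (fderiv ℝ f y v) +
        connForm (fun y => affineVec i (f y)) y v • affineVec i (f y) :=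
    Filter.eventually_of_mem hn fun y hy => by
      simp only [cov_apply, fderiv_affineVec_comp (hfd y hy)]
  rw [cov_congr e4, cov_add d3 d6, cov_smul d4 d5, cov_apply _ (fun y => affineTan i _), e3,
    cov_affineVec_comp (hfd x hx), cov_affineVec, connForm_affineVec_comp (hfd x hx),
    connForm_affineVec_comp (hfd x hx), affineTan_add, affineTan_add, affineTan_smul,
    affineTan_smul]
  refine ⟨fderiv ℝ (fun y => connForm (fun y => affineVec i (f y)) y v) x u +
    connForm (affineVec i) (f x) (fderiv ℝ f x v) * connForm (affineVec i) (f x) (fderiv ℝ f x u),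
    ?_⟩
  module

/-- Testing against v and iv upgrades real to Hermitian orthogonality. Horizontal lifts together
with the position vector fill ℂ³, where b is nondegenerate. -/
theorem chMetric_nondegenerate {w : Fin 2 → ℂ}
    (hw : (hermForm (affineVec i w) (affineVec i w)).re < 0) {u : Fin 2 → ℂ}
    (hu : ∀ v, liftMetric (affineVec i) w u v = 0) : u = 0 := by
  have h1 : ∀ v, normForm (affineVec i w) (cov (affineVec i) (affineVec i) w u)
      (cov (affineVec i) (affineVec i) w v) = 0 := by
    intro v
    have e1 := hu v
    have e2 := hu (Complex.I • v)
    rw [liftMetric, cov_affineVec_smul, normForm_smul_right] at e2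
    exact Complex.ext e1 (by simpa using e2)
  have h2 : normForm (affineVec i w) (cov (affineVec i) (affineVec i) w u) (affineVec i w) = 0 := by
    rw [← conj_normForm, normForm_cov_self hw, map_zero]
  have h3 : cov (affineVec i) (affineVec i) w u = 0 := by
    refine hermForm_nondegenerate fun z => ?_
    rw [← normForm_eq_zero_iff _ _ hw]
    obtain ⟨v, hv⟩ := eq_affineVec_add_affineTan i w z
    have h4 := h1 v
    rw [cov_affineVec _ v, normForm_add_right, normForm_smul_right, h2, mul_zero, add_zero] at h4
    rw [hv, normForm_add_right, normForm_smul_right, h2, h4]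
    simp
  rw [cov_affineVec] at h3
  have h5 := congrFun h3 i
  have h6 : connForm (affineVec i) w u = 0 := by simpa [affineTan, affineVec] using h5
  rw [h6, zero_smul, add_zero] at h3
  exact affineTan_injective i h3

/-- The Christoffel symbols of `CH²₁(-4)`. -/
theorem christoffel_chMetric {w : Fin 2 → ℂ}
    (hw : (hermForm (affineVec i w) (affineVec i w)).re < 0) (u v : Fin 2 → ℂ) :
    christoffel (chMetric i) w u v =
      connForm (affineVec i) w u • v + connForm (affineVec i) w v • u := by
  have ho : IsOpen {w : Fin 2 → ℂ | (hermForm (affineVec i w) (affineVec i w)).re < 0} :=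
    (CH21.chart i).open_target
  refine christoffel_eq (Z := affineVec i) ho (contDiff_affineVec i).contDiffOn (fun _ h => h)
    (fun y _ u v => (liftMetric_affineVec y u v).symm) hw (fun y => chMetric_nondegenerate hw) ?_
  intro t
  -- For the identity map the second derivative vanishes, and only the connection form terms remain.
  obtain ⟨l, hl⟩ := exists_cov_cov_affineVec (f := fun y => y) (i := i) ho contDiffOn_id
    (fun _ h => h) hw u v
  simp only [fderiv_fun_id, ContinuousLinearMap.id_apply, fderiv_fun_const, Pi.zero_apply,
    zero_apply, zero_add] at hl
  have e0 : normForm (affineVec i w) (affineVec i w) (cov (affineVec i) (affineVec i) w t) = 0 :=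
    normForm_cov_self hw t
  have hl' : cov (affineVec i) (fun y => cov (affineVec i) (affineVec i) y v) w u = _ := hl
  rw [liftMetric, hl', cov_affineVec _ (_ + _), normForm_add_left, normForm_add_left,
    normForm_smul_left, normForm_smul_left, e0]
  simp

end affine

/-! ### Null pairs in a tangent plane and their Kähler angle -/

section slant

variable {E : Type*} [NormedAddCommGroup E] [NormedSpace ℝ E] {Z : E → Fin 3 → ℂ} {x : E}

/-- In dimension two, vectors are determined by their products with a null pair. -/
theorem liftMetric_expand (hE : Module.finrank ℝ E = 2) {e₁ e₂ : E}
    (h₁ : liftMetric Z x e₁ e₁ = 0) (h₂ : liftMetric Z x e₂ e₂ = 0)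
    (h₁₂ : liftMetric Z x e₁ e₂ = -1) (u : E) :
    u = (-liftMetric Z x e₂ u) • e₁ + (-liftMetric Z x e₁ u) • e₂ := by
  have h₂₁ : liftMetric Z x e₂ e₁ = -1 := by rw [liftMetric_comm, h₁₂]
  have g1 : ∀ a b : ℝ, liftMetric Z x e₁ (a • e₁ + b • e₂) = -b := fun a b => by
    rw [liftMetric_add_right, liftMetric_smul_right, liftMetric_smul_right, h₁, h₁₂]; ring
  have g2 : ∀ a b : ℝ, liftMetric Z x e₂ (a • e₁ + b • e₂) = -a := fun a b => by
    rw [liftMetric_add_right, liftMetric_smul_right, liftMetric_smul_right, h₂, h₂₁]; ring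
  have hli : LinearIndependent ℝ ![e₁, e₂] := by
    rw [LinearIndependent.pair_iff]
    intro a b hab
    have q1 := g1 a b
    have q2 := g2 a b
    rw [hab, liftMetric_comm, liftMetric_zero_left] at q1 q2
    exact ⟨by linarith, by linarith⟩
  have hsp := hli.span_eq_top_of_card_eq_finrank (by simp [hE])
  have hu : u ∈ Submodule.span ℝ (Set.range ![e₁, e₂]) := hsp ▸ Submodule.mem_top
  rw [Matrix.range_cons_cons_empty, Submodule.mem_span_pair] at hu
  obtain ⟨a, b, rfl⟩ := hu
  rw [g1, g2, neg_neg, neg_neg]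

/-- The Kähler angle of a null pair is determined up to sign. -/
theorem normForm_im_sq (hE : Module.finrank ℝ E = 2) {e₁ e₂ m₁ m₂ : E}
    (h₁ : liftMetric Z x e₁ e₁ = 0) (h₂ : liftMetric Z x e₂ e₂ = 0)
    (h₁₂ : liftMetric Z x e₁ e₂ = -1) (k₁ : liftMetric Z x m₁ m₁ = 0)
    (k₂ : liftMetric Z x m₂ m₂ = 0) (k₁₂ : liftMetric Z x m₁ m₂ = -1) :
    (normForm (Z x) (cov Z Z x m₁) (cov Z Z x m₂)).im ^ 2 =
      (normForm (Z x) (cov Z Z x e₁) (cov Z Z x e₂)).im ^ 2 := by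
  have h₂₁ : liftMetric Z x e₂ e₁ = -1 := by rw [liftMetric_comm, h₁₂]
  have x1 := liftMetric_expand hE h₁ h₂ h₁₂ m₁
  have x2 := liftMetric_expand hE h₁ h₂ h₁₂ m₂
  generalize -liftMetric Z x e₂ m₁ = a at x1
  generalize -liftMetric Z x e₁ m₁ = b at x1
  generalize -liftMetric Z x e₂ m₂ = c at x2
  generalize -liftMetric Z x e₁ m₂ = d at x2
  -- The imaginary part is an alternating real form, so it is multiplied by the determinant.
  have im : ∀ a b c d : ℝ, (normForm (Z x) (cov Z Z x (a • e₁ + b • e₂))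
      (cov Z Z x (c • e₁ + d • e₂))).im =
      (a * d - b * c) * (normForm (Z x) (cov Z Z x e₁) (cov Z Z x e₂)).im := by
    intro a b c d
    have i1 := normForm_im_comm (Z x) (cov Z Z x e₂) (cov Z Z x e₁)
    simp only [map_add, map_smul, ← Complex.coe_smul, normForm_add_left, normForm_add_right,
      normForm_smul_left, normForm_smul_right, Complex.conj_ofReal, Complex.add_im,
      Complex.im_ofReal_mul, normForm_self_im, i1]
    ring
  subst x1 x2
  rw [im]
  simp only [liftMetric_add_left, liftMetric_add_right, liftMetric_smul_left,
    liftMetric_smul_right, h₁, h₂, h₁₂, h₂₁] at k₁ k₂ k₁₂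
  have e1 : a * b = 0 := by linarith
  have e2 : c * d = 0 := by linarith
  have e3 : a * d + b * c = 1 := by linarith
  -- The squared determinant is (ad+bc)² - 4abcd, where ab = 0.
  have e4 : (a * d - b * c) ^ 2 = 1 := by
    linear_combination (a * d + b * c + 1) * e3 - 4 * c * d * e1
  rw [mul_pow, e4, one_mul]

/-- The Kähler angle is only known up to sign, that is, through its square. If s(x) = 0 the square
vanishes nearby; otherwise 2s ds = 0 can be divided by s. -/
theorem hasFDerivAt_zero_of_sq {s : E → ℝ} {c : ℝ} (hs : DifferentiableAt ℝ s x)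
    (h : ∀ᶠ y in nhds x, s y ^ 2 = c) : HasFDerivAt s (0 : E →L[ℝ] ℝ) x := by
  have hx := h.self_of_nhds
  by_cases h0 : s x = 0
  · have : s =ᶠ[nhds x] fun _ => 0 := by
      filter_upwards [h] with y hy
      rw [← hx, h0] at hy
      simpa using hy
    exact (hasFDerivAt_const (0 : ℝ) x).congr_of_eventuallyEq this
  · have h1 : HasFDerivAt (fun y => s y ^ 2) _ x := hs.hasFDerivAt.pow 2
    have h2 : HasFDerivAt (fun y => s y ^ 2) (0 : E →L[ℝ] ℝ) x :=
      (hasFDerivAt_const c x).congr_of_eventuallyEq h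
    have h3 := h1.unique h2
    have h4 : fderiv ℝ s x = 0 := by
      ext u
      have := congrArg (· u) h3
      simpa [h0] using this
    exact h4 ▸ hs.hasFDerivAt

end slant

/-! ### Minimality in terms of a null pair -/

section minimal

variable {i : Fin 3} {f : EuclideanSpace ℝ (Fin 2) → Fin 2 → ℂ} {U : Set (EuclideanSpace ℝ (Fin 2))}
  {x : EuclideanSpace ℝ (Fin 2)}

theorem eq_sum_coordVec (u : EuclideanSpace ℝ (Fin 2)) :
    u = u 0 • coordVec 0 + u 1 • coordVec 1 := by
  ext k
  fin_cases k <;> simp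

/-- The inverse of the matrix of the metric in terms of a null pair. -/
theorem inv_metric_eq {Z : EuclideanSpace ℝ (Fin 2) → Fin 3 → ℂ} {m₁ m₂ : EuclideanSpace ℝ (Fin 2)}
    (k₁ : liftMetric Z x m₁ m₁ = 0) (k₂ : liftMetric Z x m₂ m₂ = 0)
    (k₁₂ : liftMetric Z x m₁ m₂ = -1) :
    (Matrix.of fun m n => liftMetric Z x (coordVec m) (coordVec n))⁻¹ =
      Matrix.of fun k l => -(m₁ k * m₂ l + m₂ k * m₁ l) := by
  refine Matrix.inv_eq_right_inv ?_
  ext m l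
  -- The expansion of a coordinate vector in the null pair is, entry by entry, the identity to be
  -- shown.
  have h1 := congrArg (· l) (liftMetric_expand (Z := Z) (x := x) (by simp) k₁ k₂ k₁₂ (coordVec m))
  have g : ∀ n : EuclideanSpace ℝ (Fin 2), liftMetric Z x n (coordVec m) =
      n 0 * liftMetric Z x (coordVec m) (coordVec 0) +
      n 1 * liftMetric Z x (coordVec m) (coordVec 1) := by
    intro n
    conv_lhs => rw [liftMetric_comm, eq_sum_coordVec n, liftMetric_add_right,
      liftMetric_smul_right, liftMetric_smul_right]
  simp only [g, PiLp.add_apply, PiLp.smul_apply, smul_eq_mul] at h1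
  rw [Matrix.mul_apply, Fin.sum_univ_two]
  simp only [Matrix.of_apply]
  have h2 : (1 : Matrix (Fin 2) (Fin 2) ℝ) m l = coordVec m l := by
    simp [Matrix.one_apply, eq_comm]
  rw [h2, h1]
  ring

/-- In a minimal surface, the derivative of a null vector in the direction of the other null vector
is tangent modulo the position vector. -/
theorem exists_cov_cov_eq_of_minimal (hU : IsOpen U) (hf : ContDiffOn ℝ ∞ f U)
    (hneg : ∀ y ∈ U, (hermForm (affineVec i (f y)) (affineVec i (f y))).re < 0) (hx : x ∈ U)
    (hmin : meanCurvature (chMetric i) f x = 0) {m₁ m₂ : EuclideanSpace ℝ (Fin 2)}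
    (k₁ : liftMetric (fun y => affineVec i (f y)) x m₁ m₁ = 0)
    (k₂ : liftMetric (fun y => affineVec i (f y)) x m₂ m₂ = 0)
    (k₁₂ : liftMetric (fun y => affineVec i (f y)) x m₁ m₂ = -1) :
    ∃ (l : ℂ) (w : EuclideanSpace ℝ (Fin 2)),
      cov (fun y => affineVec i (f y))
        (fun y => cov (fun y => affineVec i (f y)) (fun y => affineVec i (f y)) y m₂) x m₁ =
      l • affineVec i (f x) +
        cov (fun y => affineVec i (f y)) (fun y => affineVec i (f y)) x w := by
  have hn := hU.mem_nhds hx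
  have hd : DifferentiableAt ℝ f x := (hf.contDiffAt hn).differentiableAt (by simp)
  have hsymm := ((hf.contDiffAt hn).isSymmSndFDerivAt (by
    simpa using WithTop.coe_le_coe.2 (le_top : (2 : ℕ∞) ≤ ⊤))).eq
  have d2 : DifferentiableAt ℝ (fderiv ℝ f) x :=
    ((contDiffOn_fderiv hU hf).contDiffAt hn).differentiableAt (by simp)
  have hff : ∀ u v, fderiv ℝ (fun y => fderiv ℝ f y v) x u = fderiv ℝ (fderiv ℝ f) x u v := by
    intro u v
    rw [(d2.hasFDerivAt.clm_apply (hasFDerivAt_const v x)).fderiv]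
    simp
  obtain ⟨l, hl⟩ := exists_cov_cov_affineVec (i := i) hU hf hneg hx m₁ m₂
  rw [hff] at hl
  set κ := connForm (affineVec i) (f x)
  -- The second derivative of f corrected by the ambient connection; it differs from the second
  -- fundamental form by a tangent vector.
  set D : EuclideanSpace ℝ (Fin 2) → EuclideanSpace ℝ (Fin 2) → Fin 2 → ℂ := fun u v =>
    fderiv ℝ (fderiv ℝ f) x u v +
      (κ (fderiv ℝ f x u) • fderiv ℝ f x v + κ (fderiv ℝ f x v) • fderiv ℝ f x u) with hD
  have hDs : ∀ u v, D u v = D v u := fun u v => by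
    rw [hD]
    simp only [hsymm u v]
    module
  have hDb : ∀ u v, D u v = (u 0 * v 0) • D (coordVec 0) (coordVec 0) +
      (u 0 * v 1) • D (coordVec 0) (coordVec 1) + (u 1 * v 0) • D (coordVec 1) (coordVec 0) +
      (u 1 * v 1) • D (coordVec 1) (coordVec 1) := by
    intro u v
    conv_lhs => rw [eq_sum_coordVec u, eq_sum_coordVec v]
    simp only [hD, map_add, map_smul, add_apply, smul_apply, Complex.real_smul]
    simp only [← Complex.coe_smul]
    push_cast
    module
  have hS : ∀ u v, secondFundForm (chMetric i) f x u v =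
      D u v - fderiv ℝ f x (christoffel (inducedMetric (chMetric i) f) x u v) := by
    intro u v
    rw [secondFundForm, hff, christoffel_chMetric (hneg x hx)]
  rw [meanCurvature] at hmin
  simp only [inducedMetric_eq_liftMetric hd, inv_metric_eq k₁ k₂ k₁₂, hS] at hmin
  simp only [Fin.sum_univ_two, Matrix.of_apply] at hmin
  generalize christoffel (inducedMetric (chMetric i) f) x = Γ at hmin
  -- The trace with the inverse metric -(m₁⊗m₂ + m₂⊗m₁) is -2h(m₁,m₂). So vanishing mean curvature
  -- leaves only the tangential Christoffel part, traced in the same way.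
  have hw : ∃ w, D m₁ m₂ = fderiv ℝ f x w := by
    refine ⟨(1 / 2 : ℝ) • ((2 * (m₁ 0 * m₂ 0)) • Γ (coordVec 0) (coordVec 0) +
      (m₁ 0 * m₂ 1 + m₂ 0 * m₁ 1) • Γ (coordVec 0) (coordVec 1) +
      (m₁ 0 * m₂ 1 + m₂ 0 * m₁ 1) • Γ (coordVec 1) (coordVec 0) +
      (2 * (m₁ 1 * m₂ 1)) • Γ (coordVec 1) (coordVec 1)), ?_⟩
    rw [← sub_eq_zero, ← neg_eq_zero, ← hmin, hDb m₁ m₂, hDs (coordVec 1) (coordVec 0)]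
    simp only [map_add, map_smul]
    module
  obtain ⟨w, hw⟩ := hw
  -- The horizontal lift of w contains a multiple of the position vector, which is subtracted from
  -- l.
  refine ⟨l - κ (fderiv ℝ f x w), w, ?_⟩
  rw [hl, cov_affineVec_comp hd, cov_affineVec, show _ + _ = D m₁ m₂ from rfl, hw]
  module

end minimal

/-! ### Smooth null frames near a given null pair -/

section frame

variable {E : Type*} [NormedAddCommGroup E] [NormedSpace ℝ E] {Z : E → Fin 3 → ℂ} {U : Set E}
  {x : E}

theorem contDiffOn_liftMetric (hU : IsOpen U) (hZ : ContDiffOn ℝ ∞ Z U)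
    (hneg : ∀ x ∈ U, (hermForm (Z x) (Z x)).re < 0) (u v : E) :
    ContDiffOn ℝ ∞ (fun y => liftMetric Z y u v) U :=
  Complex.reCLM.contDiff.comp_contDiffOn (contDiffOn_normForm hZ
    (contDiffOn_cov_const hU hZ hneg u) (contDiffOn_cov_const hU hZ hneg v) hneg)

/-- A null pair at a point extends to a smooth null frame. -/
theorem exists_smooth_null_pair (hU : IsOpen U) (hZ : ContDiffOn ℝ ∞ Z U)
    (hneg : ∀ x ∈ U, (hermForm (Z x) (Z x)).re < 0) (hx : x ∈ U) {e₁ e₂ : E}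
    (h₁ : liftMetric Z x e₁ e₁ = 0) (h₁₂ : liftMetric Z x e₁ e₂ = -1) :
    ∃ (V : Set E) (n₁ n₂ : E → E), IsOpen V ∧ V ⊆ U ∧ x ∈ V ∧ ContDiffOn ℝ ∞ n₁ V ∧
      ContDiffOn ℝ ∞ n₂ V ∧ ∀ y ∈ V, liftMetric Z y (n₁ y) (n₁ y) = 0 ∧
        liftMetric Z y (n₂ y) (n₂ y) = 0 ∧ liftMetric Z y (n₁ y) (n₂ y) = -1 := by
  set A : E → ℝ := fun y => liftMetric Z y e₁ e₁ with hA
  set B : E → ℝ := fun y => liftMetric Z y e₁ e₂ with hB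
  set C : E → ℝ := fun y => liftMetric Z y e₂ e₂ with hC
  have cA : ContDiffOn ℝ ∞ A U := contDiffOn_liftMetric hU hZ hneg _ _
  have cB : ContDiffOn ℝ ∞ B U := contDiffOn_liftMetric hU hZ hneg _ _
  have cC : ContDiffOn ℝ ∞ C U := contDiffOn_liftMetric hU hZ hneg _ _
  have cD : ContDiffOn ℝ ∞ (fun y => B y * B y - A y * C y) U := (cB.mul cB).sub (cA.mul cC)
  set V := (U ∩ B ⁻¹' Set.Iio 0) ∩ (fun y => B y * B y - A y * C y) ⁻¹' Set.Ioi 0 with hV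
  have hV1 : IsOpen (U ∩ B ⁻¹' Set.Iio 0) :=
    cB.continuousOn.isOpen_inter_preimage hU isOpen_Iio
  have hVo : IsOpen V :=
    (cD.mono Set.inter_subset_left).continuousOn.isOpen_inter_preimage hV1 isOpen_Ioi
  have hVU : V ⊆ U := fun y hy => hy.1.1
  -- Half the root of the discriminant of A + 2Bλ + Cλ², whose zeros λ make e₁ + λe₂ null.
  set r : E → ℝ := fun y => √(B y * B y - A y * C y) with hr
  have cr : ContDiffOn ℝ ∞ r V := (cD.mono hVU).sqrt fun y hy =>
    (show 0 < B y * B y - A y * C y from hy.2).ne'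
  have rpos : ∀ y ∈ V, 0 < r y := fun y hy => Real.sqrt_pos.2 hy.2
  have rsq : ∀ y ∈ V, r y * r y = B y * B y - A y * C y := fun y hy =>
    Real.mul_self_sqrt (le_of_lt hy.2)
  have qpos : ∀ y ∈ V, 0 < r y - B y := fun y hy => by
    have h1 : B y < 0 := hy.1.2
    linarith [rpos y hy]
  have cq : ContDiffOn ℝ ∞ (fun y => r y - B y) V := cr.sub (cB.mono hVU)
  have cqi : ContDiffOn ℝ ∞ (fun y => (r y - B y)⁻¹) V := cq.inv fun y hy => (qpos y hy).ne'
  have cri : ContDiffOn ℝ ∞ (fun y => (2 * (r y * r y))⁻¹) V :=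
    (contDiffOn_const.mul (cr.mul cr)).inv fun y hy => by
      have := rpos y hy
      positivity
  -- The root is written as A/(r-B), not with C in the denominator, since C may vanish while r - B
  -- is positive on V. The second field is built in the same way and scaled to make the pairing -1.
  refine ⟨V, fun y => e₁ + (A y * (r y - B y)⁻¹) • e₂,
    fun y => ((r y - B y) * (2 * (r y * r y))⁻¹) • (e₂ + (C y * (r y - B y)⁻¹) • e₁),
    hVo, hVU, ⟨⟨hx, ?_⟩, ?_⟩, ?_, ?_, fun y hy => ?_⟩
  · simp [hB, h₁₂]
  · simp [hB, hA, h₁₂, h₁]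
  · exact contDiffOn_const.add (((cA.mono hVU).mul cqi).smul contDiffOn_const)
  · exact (cq.mul cri).smul
      (contDiffOn_const.add (((cC.mono hVU).mul cqi).smul contDiffOn_const))
  · have e1 := (qpos y hy).ne'
    have e2 := (rpos y hy).ne'
    have e3 := rsq y hy
    have f1 : liftMetric Z y e₁ e₁ = A y := rfl
    have f2 : liftMetric Z y e₁ e₂ = B y := rfl
    have f3 : liftMetric Z y e₂ e₁ = B y := liftMetric_comm _ _ _ _
    have f4 : liftMetric Z y e₂ e₂ = C y := rfl
    simp only [liftMetric_add_left, liftMetric_add_right, liftMetric_smul_left,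
      liftMetric_smul_right, f1, f2, f3, f4]
    generalize A y = a at *
    generalize B y = b at *
    generalize C y = c at *
    generalize r y = ρ at *
    refine ⟨?_, ?_, ?_⟩
    · field_simp
      linear_combination a * e3
    · field_simp
      linear_combination c * e3
    · field_simp
      linear_combination (2 * ρ - b) * e3
end frame

/-! ### Minimal slant surfaces in an affine chart -/

section surface

variable {i : Fin 3} {f : EuclideanSpace ℝ (Fin 2) → Fin 2 → ℂ} {U : Set (EuclideanSpace ℝ (Fin 2))}
  {x : EuclideanSpace ℝ (Fin 2)}

/-- `f`, a map into the `i`-th affine chart, is slant at `x`, where `σ` is the hyperbolic sine of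
the slant angle. -/
def IsSlantAt (f : EuclideanSpace ℝ (Fin 2) → Fin 2 → ℂ) (i : Fin 3)
    (x : EuclideanSpace ℝ (Fin 2)) (σ : ℝ) : Prop :=
  ∃ e₁ e₂ : EuclideanSpace ℝ (Fin 2),
    inducedMetric (chMetric i) f x e₁ e₁ = 0 ∧
    inducedMetric (chMetric i) f x e₂ e₂ = 0 ∧
    inducedMetric (chMetric i) f x e₁ e₂ = -1 ∧
    IsNormalTo f i x (Complex.I • fderiv ℝ f x e₁ - fderiv ℝ f x (σ • e₁)) ∧
    IsNormalTo f i x (Complex.I • fderiv ℝ f x e₂ - fderiv ℝ f x (-σ • e₂))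

/-- Pairing the normal vector Je₁ - σe₁ with e₂ gives ⟨Je₁,e₂⟩ = -σ, and this is the imaginary part
of the Hermitian product. -/
theorem IsSlantAt.exists_null_pair {σ : ℝ} (h : IsSlantAt f i x σ) (hd : DifferentiableAt ℝ f x) :
    ∃ e₁ e₂ : EuclideanSpace ℝ (Fin 2),
      liftMetric (fun y => affineVec i (f y)) x e₁ e₁ = 0 ∧
      liftMetric (fun y => affineVec i (f y)) x e₂ e₂ = 0 ∧
      liftMetric (fun y => affineVec i (f y)) x e₁ e₂ = -1 ∧
      (normForm (affineVec i (f x))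
        (cov (fun y => affineVec i (f y)) (fun y => affineVec i (f y)) x e₁)
        (cov (fun y => affineVec i (f y)) (fun y => affineVec i (f y)) x e₂)).im = -σ := by
  obtain ⟨e₁, e₂, h₁, h₂, h₁₂, hn, -⟩ := h
  have h0 := hn e₂
  rw [← liftMetric_affineVec, liftMetric_sub_left, liftMetric_affineVec, liftMetric_affineVec,
    chMetric_I_smul hd] at h0
  have h3 : chMetric i (f x) (fderiv ℝ f x (σ • e₁)) (fderiv ℝ f x e₂) =
      inducedMetric (chMetric i) f x (σ • e₁) e₂ := rfl
  rw [h3] at h0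
  rw [inducedMetric_eq_liftMetric hd] at h₁ h₂ h₁₂ h0
  rw [liftMetric_smul_left, h₁₂] at h0
  exact ⟨e₁, e₂, h₁, h₂, h₁₂, by linarith⟩

/-- The slant condition provides null pairs point by point, with no regularity. A smooth frame is
built independently and compared with them: its Kähler angle function has constant square σ², hence
zero derivative. -/
theorem exists_nullFrame (hU : IsOpen U) (hf : ContDiffOn ℝ ∞ f U)
    (hneg : ∀ y ∈ U, (hermForm (affineVec i (f y)) (affineVec i (f y))).re < 0) (hx : x ∈ U)
    (hmin : ∀ y ∈ U, meanCurvature (chMetric i) f y = 0) {σ : ℝ}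
    (hs : ∀ y ∈ U, IsSlantAt f i y σ) :
    ∃ (V : Set (EuclideanSpace ℝ (Fin 2)))
      (n₁ n₂ : EuclideanSpace ℝ (Fin 2) → EuclideanSpace ℝ (Fin 2))
      (s : EuclideanSpace ℝ (Fin 2) → ℝ), V ⊆ U ∧ x ∈ V ∧
      NullFrame (fun y => affineVec i (f y)) V n₁ n₂ s ∧ s x ^ 2 = σ ^ 2 := by
  have hd : ∀ y ∈ U, DifferentiableAt ℝ f y := fun y hy =>
    (hf.contDiffAt (hU.mem_nhds hy)).differentiableAt (by simp)
  have hZ : ContDiffOn ℝ ∞ (fun y => affineVec i (f y)) U :=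
    (contDiff_affineVec i).comp_contDiffOn hf
  obtain ⟨e₁, e₂, h₁, -, h₁₂, -⟩ := (hs x hx).exists_null_pair (hd x hx)
  obtain ⟨V, n₁, n₂, hV, hVU, hxV, c₁, c₂, hn⟩ :=
    exists_smooth_null_pair hU hZ hneg hx h₁ h₁₂
  have hneg' : ∀ y ∈ V, (hermForm (affineVec i (f y)) (affineVec i (f y))).re < 0 :=
    fun y hy => hneg y (hVU hy)
  have hcov := contDiffOn_cov hU hZ hZ hneg
  set Z := fun y => affineVec i (f y) with hZdef
  set s : EuclideanSpace ℝ (Fin 2) → ℝ := fun y =>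
    -(normForm (Z y) (frameLift Z n₁ y) (frameLift Z n₂ y)).im with hsdef
  have cs : ContDiffOn ℝ ∞ s V := (Complex.imCLM.contDiff.comp_contDiffOn (contDiffOn_normForm
    (hZ.mono hVU) ((hcov.mono hVU).clm_apply c₁) ((hcov.mono hVU).clm_apply c₂) hneg')).neg
  have ssq : ∀ y ∈ V, s y ^ 2 = σ ^ 2 := by
    intro y hy
    obtain ⟨e₁, e₂, h₁, h₂, h₁₂, him⟩ := (hs y (hVU hy)).exists_null_pair (hd y (hVU hy))
    have := normForm_im_sq (by simp) h₁ h₂ h₁₂ (hn y hy).1 (hn y hy).2.1 (hn y hy).2.2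
    rw [hsdef]
    simp only [neg_sq]
    rw [him, neg_sq] at this
    exact this
  have hspan : ∀ y ∈ V, ∀ u, ∃ a b : ℝ, u = a • n₁ y + b • n₂ y := fun y hy u =>
    ⟨_, _, liftMetric_expand (by simp) (hn y hy).1 (hn y hy).2.1 (hn y hy).2.2 u⟩
  refine ⟨V, n₁, n₂, s, hVU, hxV, ?_, ssq x hxV⟩
  exact
  { isOpen := hV
    smooth := hZ.mono hVU
    neg := hneg'
    smooth₁ := c₁
    smooth₂ := c₂
    null₁ := fun y hy => Complex.ext (hn y hy).1 (normForm_self_im _ _)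
    null₂ := fun y hy => Complex.ext (hn y hy).2.1 (normForm_self_im _ _)
    pair := fun y hy => by
      have : (normForm (Z y) (frameLift Z n₁ y) (frameLift Z n₂ y)).re = -1 := (hn y hy).2.2
      exact Complex.ext (by simp [this]) (by simp [hsdef])
    angle := fun y hy => hasFDerivAt_zero_of_sq
      ((cs.contDiffAt (hV.mem_nhds hy)).differentiableAt (by simp))
      (Filter.eventually_of_mem (hV.mem_nhds hy) ssq)
    span := hspan
    minimal := fun y hy => by
      have hn2 : DifferentiableAt ℝ n₂ y :=
        (c₂.contDiffAt (hV.mem_nhds hy)).differentiableAt (by simp)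
      have hc : DifferentiableAt ℝ (cov Z Z) y :=
        (hcov.contDiffAt (hU.mem_nhds (hVU hy))).differentiableAt (by simp)
      obtain ⟨l, w, hw⟩ := exists_cov_cov_eq_of_minimal hU hf hneg (hVU hy) (hmin y (hVU hy))
        (hn y hy).1 (hn y hy).2.1 (hn y hy).2.2
      -- Passing from the frozen vector n₂(y) to the field n₂ adds the tangent vector dn₂(n₁).
      obtain ⟨a, b, hab⟩ := hspan y hy (w + fderiv ℝ n₂ y (n₁ y))
      refine ⟨a, b, l, ?_⟩
      have e1 : cov Z (frameLift Z n₂) y (n₁ y) = _ := cov_clm_apply hc hn2 (n₁ y)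
      rw [e1, hw, add_assoc, ← map_add, hab, map_add, map_smul, map_smul, add_assoc]
      simp only [← Complex.coe_smul, frameLift, hZdef] }

/-- A minimal slant surface is Lagrangian. -/
theorem slant_eq_zero (hU : IsOpen U) (hf : ContDiffOn ℝ ∞ f U)
    (hneg : ∀ y ∈ U, (hermForm (affineVec i (f y)) (affineVec i (f y))).re < 0) (hx : x ∈ U)
    (hmin : ∀ y ∈ U, meanCurvature (chMetric i) f y = 0) {σ : ℝ}
    (hs : ∀ y ∈ U, IsSlantAt f i y σ) : σ = 0 := by
  obtain ⟨V, n₁, n₂, s, -, hxV, h, hsq⟩ := exists_nullFrame hU hf hneg hx hmin hs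
  rw [(h.compat hxV).1] at hsq
  simpa using hsq.symm

theorem IsSlantAt.isNormalTo (h : IsSlantAt f i x 0) (hd : DifferentiableAt ℝ f x)
    (u : EuclideanSpace ℝ (Fin 2)) : IsNormalTo f i x (Complex.I • fderiv ℝ f x u) := by
  obtain ⟨e₁, e₂, h₁, h₂, h₁₂, hn₁, hn₂⟩ := h
  simp only [neg_zero, zero_smul, map_zero, sub_zero] at hn₁ hn₂
  rw [inducedMetric_eq_liftMetric hd] at h₁ h₂ h₁₂
  intro v
  rw [liftMetric_expand (by simp) h₁ h₂ h₁₂ u]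
  have e1 := hn₁ v
  have e2 := hn₂ v
  rw [chMetric_I_smul hd] at e1 e2 ⊢
  simp only [map_add, map_smul, ← Complex.coe_smul, normForm_add_left, normForm_smul_left,
    Complex.conj_ofReal, Complex.add_im, Complex.im_ofReal_mul, e1, e2]
  simp

/-- A flat minimal slant surface is locally congruent to the explicit surface. -/
theorem exists_unitary_of_flat (hU : IsOpen U) (hf : ContDiffOn ℝ ∞ f U)
    (hneg : ∀ y ∈ U, (hermForm (affineVec i (f y)) (affineVec i (f y))).re < 0) (hx : x ∈ U)
    (hmin : ∀ y ∈ U, meanCurvature (chMetric i) f y = 0) {σ : ℝ}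
    (hs : ∀ y ∈ U, IsSlantAt f i y σ)
    (hR : ∀ y ∈ U, ∀ u v w, curvature (inducedMetric (chMetric i) f) y u v w = 0) :
    ∃ r > 0, Metric.ball x r ⊆ U ∧
      ∃ (X Y : EuclideanSpace ℝ (Fin 2) → ℝ) (ρ : EuclideanSpace ℝ (Fin 2) → ℂ) (A : HermUnitary),
      ContDiffOn ℝ ∞ X (Metric.ball x r) ∧ ContDiffOn ℝ ∞ Y (Metric.ball x r) ∧
      (∀ y ∈ Metric.ball x r, ∀ u, fderiv ℝ X y u = 0 → fderiv ℝ Y y u = 0 → u = 0) ∧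
      ∀ y ∈ Metric.ball x r, ρ y ≠ 0 ∧
        A.1 (ρ y • affineVec i (f y)) = tildeLVec 1 (X y) (Y y) := by
  obtain ⟨V, n₁, n₂, s, hVU, hxV, h, -⟩ := exists_nullFrame hU hf hneg hx hmin hs
  obtain ⟨W, m₁, m₂, hWV, hxW, h'⟩ := h.exists_flatFrame
    (fun y hy u v => inducedMetric_eq_liftMetric
      ((hf.contDiffAt (hU.mem_nhds (hVU hy))).differentiableAt (by simp)) u v)
    (fun y hy => hR y (hVU hy)) hxV
  obtain ⟨r, hr, hrW, X, Y, ρ, A, hX, hY, hXY, hA⟩ := h'.exists_unitary hxW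
  refine ⟨r, hr, (hrW.trans hWV).trans hVU, X, Y, ρ, A, hX, hY, fun y hy u h1 h2 => ?_, hA⟩
  rw [hXY y hy u, h1, h2]
  simp

end surface

/-! ### Coordinate expressions and changes of chart -/

section charts

theorem isOpen_coordDomain {M : Type*} [TopologicalSpace M] {L : M → CH21}
    {e : OpenPartialHomeomorph M (EuclideanSpace ℝ (Fin 2))} {i : Fin 3}
    (hL : Continuous L) : IsOpen (coordDomain L e i) :=
  e.symm.isOpen_inter_preimage ((CH21.chart i).open_source.preimage hL)

theorem hermForm_coordMap_neg {M : Type*} [TopologicalSpace M] {L : M → CH21}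
    {e : OpenPartialHomeomorph M (EuclideanSpace ℝ (Fin 2))} {i : Fin 3}
    {x : EuclideanSpace ℝ (Fin 2)} (hx : x ∈ coordDomain L e i) :
    (hermForm (affineVec i (coordMap L e i x)) (affineVec i (coordMap L e i x))).re < 0 :=
  (CH21.chart i).map_source hx.2

theorem mem_contDiffGroupoid {φ : OpenPartialHomeomorph (EuclideanSpace ℝ (Fin 2))
    (EuclideanSpace ℝ (Fin 2))} :
    φ ∈ contDiffGroupoid ∞ (𝓡 2) ↔ ContDiffOn ℝ ∞ φ φ.source ∧ ContDiffOn ℝ ∞ φ.symm φ.target := by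
  rw [contDiffGroupoid, mem_groupoid_of_pregroupoid]
  simp [contDiffPregroupoid]

variable {M : Type*} [TopologicalSpace M] [ChartedSpace (EuclideanSpace ℝ (Fin 2)) M]

theorem trans_mem_maximalAtlas {e : OpenPartialHomeomorph M (EuclideanSpace ℝ (Fin 2))}
    (he : e ∈ IsManifold.maximalAtlas (𝓡 2) ∞ M)
    {φ : OpenPartialHomeomorph (EuclideanSpace ℝ (Fin 2)) (EuclideanSpace ℝ (Fin 2))}
    (hφ : φ ∈ contDiffGroupoid ∞ (𝓡 2)) :
    e ≫ₕ φ ∈ IsManifold.maximalAtlas (𝓡 2) ∞ M := by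
  rw [IsManifold.maximalAtlas, mem_maximalAtlas_iff] at he ⊢
  intro e' he'
  obtain ⟨h1, h2⟩ := he e' he'
  rw [OpenPartialHomeomorph.trans_symm_eq_symm_trans_symm, OpenPartialHomeomorph.trans_assoc,
    ← OpenPartialHomeomorph.trans_assoc e'.symm]
  exact ⟨(contDiffGroupoid ∞ (𝓡 2)).trans ((contDiffGroupoid ∞ (𝓡 2)).symm hφ) h1,
    (contDiffGroupoid ∞ (𝓡 2)).trans h2 hφ⟩

theorem toHomeomorph_mem_contDiffGroupoid
    {φ : EuclideanSpace ℝ (Fin 2) ≃ₜ EuclideanSpace ℝ (Fin 2)} (h : ContDiff ℝ ∞ φ)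
    (h' : ContDiff ℝ ∞ φ.symm) : φ.toOpenPartialHomeomorph ∈ contDiffGroupoid ∞ (𝓡 2) :=
  mem_contDiffGroupoid.2 ⟨h.contDiffOn, h'.contDiffOn⟩

/-- Two functions with independent differentials are local coordinates. -/
theorem exists_coordinates {K : Set (EuclideanSpace ℝ (Fin 2))} (hK : IsOpen K)
    {X Y : EuclideanSpace ℝ (Fin 2) → ℝ} (hX : ContDiffOn ℝ ∞ X K) (hY : ContDiffOn ℝ ∞ Y K)
    (hXY : ∀ y ∈ K, ∀ u, fderiv ℝ X y u = 0 → fderiv ℝ Y y u = 0 → u = 0)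
    {x : EuclideanSpace ℝ (Fin 2)} (hx : x ∈ K) :
    ∃ φ : OpenPartialHomeomorph (EuclideanSpace ℝ (Fin 2)) (EuclideanSpace ℝ (Fin 2)),
      φ ∈ contDiffGroupoid ∞ (𝓡 2) ∧ x ∈ φ.source ∧ φ.source ⊆ K ∧
      ∀ y, φ y 0 = X y ∧ φ y 1 = Y y := by
  set Φ : EuclideanSpace ℝ (Fin 2) → EuclideanSpace ℝ (Fin 2) := fun y => !₂[X y, Y y] with hΦ
  have hs : ContDiffOn ℝ ∞ Φ K := by
    rw [contDiffOn_euclidean]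
    intro k
    fin_cases k
    · simpa [hΦ] using hX
    · simpa [hΦ] using hY
  have hd : ∀ y ∈ K, DifferentiableAt ℝ Φ y := fun y hy =>
    (hs.contDiffAt (hK.mem_nhds hy)).differentiableAt (by simp)
  have hequiv : ∀ y ∈ K, ∃ A : EuclideanSpace ℝ (Fin 2) ≃L[ℝ] EuclideanSpace ℝ (Fin 2),
      HasFDerivAt Φ (A : EuclideanSpace ℝ (Fin 2) →L[ℝ] EuclideanSpace ℝ (Fin 2)) y := by
    intro y hy
    have hinj : Function.Injective (fderiv ℝ Φ y).toLinearMap := by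
      rw [← LinearMap.ker_eq_bot, LinearMap.ker_eq_bot']
      intro u hu
      have hk : ∀ k : Fin 2, fderiv ℝ (fun y => Φ y k) y u = 0 := by
        intro k
        have h1 : HasFDerivAt (fun y => Φ y k) _ y :=
          (hasFDerivAt_coord k (Φ y)).comp y
            (hd y hy).hasFDerivAt
        have h2 : fderiv ℝ Φ y u = 0 := hu
        rw [h1.fderiv]
        simp [h2]
      exact hXY y hy u (by simpa [hΦ] using hk 0) (by simpa [hΦ] using hk 1)
    refine ⟨(LinearEquiv.ofInjectiveEndo _ hinj).toContinuousLinearEquiv, ?_⟩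
    exact (hd y hy).hasFDerivAt.congr_fderiv (by ext1 u; rfl)
  obtain ⟨A, hA⟩ := hequiv x hx
  have hxs := hs.contDiffAt (hK.mem_nhds hx)
  set ψ := hxs.toOpenPartialHomeomorph Φ hA (by simp) with hψ
  have hcoe : ∀ y, ψ y = Φ y := fun y => rfl
  -- Restricting to K, where the differential is invertible everywhere, makes the inverse smooth on
  -- the whole target.
  refine ⟨ψ.restrOpen K hK, mem_contDiffGroupoid.2 ⟨?_, ?_⟩,
    ⟨hxs.mem_toOpenPartialHomeomorph_source hA (by simp), hx⟩, fun y hy => hy.2, fun y => ?_⟩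
  · exact hs.mono fun y hy => hy.2
  · intro z hz
    have h1 := (ψ.restrOpen K hK).map_target hz
    have h2 : (ψ.restrOpen K hK).symm z ∈ K := h1.2
    obtain ⟨B, hB⟩ := hequiv _ h2
    exact ((ψ.restrOpen K hK).contDiffAt_symm hz hB
      (hs.contDiffAt (hK.mem_nhds h2))).contDiffWithinAt
  · exact ⟨rfl, rfl⟩

variable {L : M → CH21} {e : OpenPartialHomeomorph M (EuclideanSpace ℝ (Fin 2))} {i : Fin 3}

theorem contDiffOn_coordMap [IsManifold (𝓡 2) ∞ M]
    (hL : ContMDiff (𝓡 2) 𝓘(ℝ, Fin 2 → ℂ) ∞ L)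
    (he : e ∈ IsManifold.maximalAtlas (𝓡 2) ∞ M) :
    ContDiffOn ℝ ∞ (coordMap L e i) (coordDomain L e i) := by
  have hi : CH21.chart i ∈ IsManifold.maximalAtlas 𝓘(ℝ, Fin 2 → ℂ) ∞ CH21 :=
    IsManifold.subset_maximalAtlas (Set.mem_range_self i)
  have h := (contMDiffOn_iff_of_mem_maximalAtlas' (s := e.source ∩ L ⁻¹' (CH21.chart i).source)
    he hi Set.inter_subset_left (fun x hx => hx.2)).1 hL.contMDiffOn
  have himage : coordDomain L e i = e '' (e.source ∩ L ⁻¹' (CH21.chart i).source) := by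
    ext x
    constructor
    · rintro ⟨h1, h2⟩
      exact ⟨e.symm x, ⟨e.map_target h1, h2⟩, e.right_inv h1⟩
    · rintro ⟨q, ⟨h1, h2⟩, rfl⟩
      refine ⟨e.map_source h1, ?_⟩
      rw [e.left_inv h1]
      exact h2
  rw [himage]
  simp only [mfld_simps] at h
  exact h

theorem hopf_eq_hopf_iff {z w : H52} :
    hopf z = hopf w ↔ ∃ c : ℂ, c ≠ 0 ∧ (w : Fin 3 → ℂ) = c • (z : Fin 3 → ℂ) :=
  Quotient.eq

/-- A point of `CH²₁(-4)` is determined by its affine coordinates. -/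
theorem congruence_eq_hopf {q : CH21} (hq : q ∈ (CH21.chart i).source) {A : HermUnitary} {w : H52}
    {ρ : ℂ} (hρ : ρ ≠ 0) (h : A.1 (ρ • affineVec i (CH21.chart i q)) = w) :
    A.congruence q = hopf w := by
  have hneg : (hermForm (affineVec i (CH21.chart i q)) (affineVec i (CH21.chart i q))).re < 0 :=
    (CH21.chart i).map_source hq
  have h1 : q = hopf ⟨normalizeVec (affineVec i (CH21.chart i q)), normalizeVec_mem hneg⟩ := by
    rw [← CH21.ofCoord_eq hneg]
    exact ((CH21.chart i).left_inv hq).symm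
  generalize CH21.chart i q = v at *
  subst h1
  -- The factor ρ, times the square root that undoes `normalizeVec`.
  refine hopf_eq_hopf_iff.2 ⟨ρ * ((√(-(hermForm (affineVec i v) (affineVec i v)).re) : ℝ) : ℂ),
    mul_ne_zero hρ ?_, ?_⟩
  · exact Complex.ofReal_ne_zero.2 (Real.sqrt_pos.2 (by linarith)).ne'
  · have h0 : ((√(-(hermForm (affineVec i v) (affineVec i v)).re) : ℝ) : ℂ) ≠ 0 :=
      Complex.ofReal_ne_zero.2 (Real.sqrt_pos.2 (by linarith)).ne'
    rw [← h]
    show A.1 _ = _ • A.1 (normalizeVec _)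
    rw [normalizeVec, ← map_smul, smul_smul]
    congr 2
    push_cast
    field_simp

end charts

/-! ### From local congruences to a single one -/

section gluing

variable {M : Type*} [TopologicalSpace M] [ChartedSpace (EuclideanSpace ℝ (Fin 2)) M]
  {L : M → CH21}

/-- In the chart `e`, the surface `L` is the explicit surface up to the congruence `A`. -/
def IsExplicitIn (L : M → CH21) (A : HermUnitary)
    (e : OpenPartialHomeomorph M (EuclideanSpace ℝ (Fin 2))) : Prop :=
  ∀ q ∈ e.source, A.congruence (L q) = hopf (tildeL 1 (e q 0) (e q 1))

/-- If the surface is explicit in two overlapping charts, with congruences `A` and `A'`, then the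
second chart can be changed such that `A` serves for it, too. -/
theorem IsExplicitIn.exists_chart {A A' : HermUnitary}
    {e e' : OpenPartialHomeomorph M (EuclideanSpace ℝ (Fin 2))} (h : IsExplicitIn L A e)
    (h' : IsExplicitIn L A' e') (he : e ∈ IsManifold.maximalAtlas (𝓡 2) ∞ M)
    (he' : e' ∈ IsManifold.maximalAtlas (𝓡 2) ∞ M) {q : M} (hq : q ∈ e.source)
    (hq' : q ∈ e'.source) :
    ∃ e'' ∈ IsManifold.maximalAtlas (𝓡 2) ∞ M, e''.source = e'.source ∧ IsExplicitIn L A e'' := by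
  -- The unitary map AA'⁻¹ that relates the two explicit pictures of the surface on the overlap.
  set B : HermUnitary := ⟨A'.1.symm.trans A.1, fun z w => by
    rw [LinearEquiv.trans_apply, LinearEquiv.trans_apply, A.2, ← A'.2, A'.1.apply_symm_apply,
      A'.1.apply_symm_apply]⟩ with hB
  have hcomp : ∀ p, B.congruence (A'.congruence p) = A.congruence p := by
    intro p
    obtain ⟨z, rfl⟩ := p.exists_rep
    refine hopf_eq_hopf_iff.2 ⟨1, one_ne_zero, ?_⟩
    show A.1 z = (1 : ℂ) • A.1 (A'.1.symm (A'.1 z))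
    rw [A'.1.symm_apply_apply, one_smul]
  set ψ := e'.symm ≫ₕ e with hψ
  have hψs : ContDiffOn ℝ ∞ ψ ψ.source :=
    (mem_contDiffGroupoid.1 (IsManifold.compatible_of_mem_maximalAtlas he' he)).1
  have hqψ : e' q ∈ ψ.source := by
    rw [hψ, OpenPartialHomeomorph.trans_source]
    refine ⟨e'.map_source hq', ?_⟩
    show e'.symm (e' q) ∈ e.source
    rwa [e'.left_inv hq']
  -- The overlap need not be connected. Rigidity on one ball suffices, because its conclusion holds
  -- on all of ℝ².
  obtain ⟨r, hr, hrψ⟩ := Metric.isOpen_iff.1 ψ.open_source _ hqψ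
  have hψr := contDiffOn_euclidean.1 (hψs.mono hrψ)
  obtain ⟨a, b, c, hrig⟩ := tildeVec_rigid (B := B) Metric.isOpen_ball (convex_ball _ _)
    (Metric.nonempty_ball.2 hr) (hψr 0) (hψr 1) (by
      intro s hs
      have hs' := hrψ hs
      rw [hψ, OpenPartialHomeomorph.trans_source] at hs'
      have h1 := h _ hs'.2
      have h2 := h' _ (e'.map_target hs'.1)
      rw [e'.right_inv hs'.1] at h2
      rw [← hcomp, h2] at h1
      obtain ⟨c, -, hc⟩ := hopf_eq_hopf_iff.1 h1
      exact ⟨c, hc⟩)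
  have key : ∀ τ : EuclideanSpace ℝ (Fin 2) ≃ₜ EuclideanSpace ℝ (Fin 2), ContDiff ℝ ∞ τ →
      ContDiff ℝ ∞ τ.symm → (∀ s, tildeLVec 1 (τ s 0) (τ s 1) = c • B.1 (tildeLVec 1 (s 0) (s 1))) →
      ∃ e'' ∈ IsManifold.maximalAtlas (𝓡 2) ∞ M, e''.source = e'.source ∧
        IsExplicitIn L A e'' := by
    intro τ h1 h2 h3
    refine ⟨e' ≫ₕ τ.toOpenPartialHomeomorph,
      trans_mem_maximalAtlas he' (toHomeomorph_mem_contDiffGroupoid h1 h2), by simp, ?_⟩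
    intro p hp
    have hp' : p ∈ e'.source := by simpa using hp
    rw [← hcomp, h' p hp']
    refine hopf_eq_hopf_iff.2 ⟨c, ?_, h3 (e' p)⟩
    rintro rfl
    have h4 : hermForm _ _ = -1 := tildeLVec_mem 1 (τ (e' p) 0) (τ (e' p) 1)
    rw [h3, zero_smul] at h4
    simp [hermForm] at h4
  rcases hrig with hrig | hrig
  · exact key (Homeomorph.addRight !₂[a, b]) (contDiff_id.add contDiff_const)
      (by
        rw [Homeomorph.addRight_symm]
        exact contDiff_id.add contDiff_const) (fun s => by simpa using hrig s)
  -- The exchange comes before the translation, hence the order b, a.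
  · set σ := LinearIsometryEquiv.piLpCongrLeft 2 ℝ ℝ (Equiv.swap (0 : Fin 2) 1) with hσ
    have c1 : ContDiff ℝ ∞ fun s => σ s + !₂[b, a] := σ.contDiff.add contDiff_const
    have c2 : ContDiff ℝ ∞ fun s => σ.symm (s + -!₂[b, a]) :=
      σ.symm.contDiff.comp (contDiff_id.add contDiff_const)
    refine key (σ.toHomeomorph.trans (Homeomorph.addRight !₂[b, a])) c1 c2 (fun s => ?_)
    simpa [hσ, LinearIsometryEquiv.piLpCongrLeft_apply] using hrig s

/-- If a surface is locally explicit up to congruence, a single congruence serves everywhere. -/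
theorem exists_congruence_of_local [ConnectedSpace M]
    (h : ∀ p : M, ∃ (A : HermUnitary), ∃ e ∈ IsManifold.maximalAtlas (𝓡 2) ∞ M,
      p ∈ e.source ∧ IsExplicitIn L A e) :
    ∃ A : HermUnitary, ∀ p : M, ∃ e ∈ IsManifold.maximalAtlas (𝓡 2) ∞ M,
      p ∈ e.source ∧ IsExplicitIn L A e := by
  obtain ⟨p₀⟩ : Nonempty M := inferInstance
  obtain ⟨A, hA⟩ := h p₀
  refine ⟨A, ?_⟩
  set S : Set M := {p | ∃ e ∈ IsManifold.maximalAtlas (𝓡 2) ∞ M,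
    p ∈ e.source ∧ IsExplicitIn L A e} with hS
  have hopen : IsOpen S := isOpen_iff_forall_mem_open.2 fun p ⟨e, he, hp, hE⟩ =>
    ⟨e.source, fun q hq => ⟨e, he, hq, hE⟩, e.open_source, hp⟩
  -- If a chart at p that is explicit for some A' meets S, it can be changed to one explicit for A,
  -- so p belongs to S.
  have hclosed : IsClosed S := by
    rw [← isOpen_compl_iff, isOpen_iff_forall_mem_open]
    intro p hp
    obtain ⟨A', e', he', hpe', hE'⟩ := h p
    refine ⟨e'.source, fun q hq' hq => hp ?_, e'.open_source, hpe'⟩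
    obtain ⟨e, he, hqe, hE⟩ := hq
    obtain ⟨e'', he'', hsrc, hE''⟩ := hE.exists_chart hE' he he' hqe hq'
    exact ⟨e'', he'', hsrc ▸ hpe', hE''⟩
  have huniv : S = Set.univ := IsClopen.eq_univ ⟨hclosed, hopen⟩ ⟨p₀, hA⟩
  exact fun p => huniv.symm.subset (Set.mem_univ p)

end gluing

end

theorem theorem7p1 {M : Type*} [TopologicalSpace M] [ConnectedSpace M]
    [ChartedSpace (EuclideanSpace ℝ (Fin 2)) M] [IsManifold (𝓡 2) ∞ M]
    (L : M → CH21) (hL : ContMDiff (𝓡 2) 𝓘(ℝ, Fin 2 → ℂ) ∞ L)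
    (hmin : IsMinimalSurface L) (hflat : IsFlatSurface L) (hslant : IsSlantSurface L) :
    IsLagrangianSurface L ∧
    ∃ a : ℝ, a ≠ 0 ∧ ∃ A : HermUnitary,
      ∀ p : M, ∃ e ∈ IsManifold.maximalAtlas (𝓡 2) ∞ M, p ∈ e.source ∧
        ∀ q ∈ e.source, A.congruence (L q) = hopf (tildeL a (e q 0) (e q 1)) := by
  obtain ⟨α, hα⟩ := hslant
  -- The choice a = 1 loses nothing: the explicit map depends on a, x, y only through x/a and ay, so
  -- a is a rescaling of the coordinates.
  refine ⟨fun e he i x hx => ?_, 1, one_ne_zero, exists_congruence_of_local fun p => ?_⟩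
  · have hU := isOpen_coordDomain (e := e) (i := i) hL.continuous
    have hf := contDiffOn_coordMap (i := i) hL he
    have hσ : Real.sinh α = 0 := slant_eq_zero hU hf (fun y hy => hermForm_coordMap_neg hy) hx
      (hmin e he i) (hα e he i)
    have hs : IsSlantAt (coordMap L e i) i x (Real.sinh α) := hα e he i x hx
    rw [hσ] at hs
    exact hs.isNormalTo ((hf.contDiffAt (hU.mem_nhds hx)).differentiableAt (by simp))
  · set e := chartAt (EuclideanSpace ℝ (Fin 2)) p
    have he : e ∈ IsManifold.maximalAtlas (𝓡 2) ∞ M := IsManifold.chart_mem_maximalAtlas p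
    obtain ⟨i, hi⟩ := CH21.exists_mem_source (L p)
    have hU := isOpen_coordDomain (e := e) (i := i) hL.continuous
    have hf := contDiffOn_coordMap (i := i) hL he
    have hp : p ∈ e.source := mem_chart_source _ p
    have hx : e p ∈ coordDomain L e i := ⟨e.map_source hp, by rwa [e.left_inv hp]⟩
    obtain ⟨r, hr, hrU, X, Y, ρ, A, hX, hY, hXY, hA⟩ := exists_unitary_of_flat hU hf
      (fun y hy => hermForm_coordMap_neg hy) hx (hmin e he i) (hα e he i) (hflat e he i)
    obtain ⟨φ, hφ, hxφ, hφK, hφXY⟩ := exists_coordinates Metric.isOpen_ball hX hY hXY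
      (Metric.mem_ball_self hr)
    refine ⟨A, e ≫ₕ φ, trans_mem_maximalAtlas he hφ, ?_, fun q hq => ?_⟩
    · rw [OpenPartialHomeomorph.trans_source]
      exact ⟨hp, hxφ⟩
    · rw [OpenPartialHomeomorph.trans_source] at hq
      have hqK := hφK hq.2
      have hqd := (hrU hqK).2
      have hqA := hA _ hqK
      rw [coordMap] at hqA
      rw [e.left_inv hq.1] at hqd hqA
      refine congruence_eq_hopf (i := i) hqd hqA.1 ?_
      rw [hqA.2]
      show _ = tildeLVec 1 (φ (e q) 0) (φ (e q) 1)
      rw [(hφXY (e q)).1, (hφXY (e q)).2]
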